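/- Let $I=\{1,\dots,n\}$, let $(a_{ij})$ be the Cartan matrix of type $A_n$, let $P=\bigoplus_{i\in I}\mathbb Z\Lambda_i$ be the weight lattice with $\langle h_i,\Lambda_j\rangle=\delta_{ij}$, and let $\lambda=a_1\Lambda_1+\cdots+a_n\Lambda_n$ with $a_1,\dots,a_n\in\mathbb Z_{\ge 0}$. A crystal isomorphism below is a bijection between crystals that preserves $\mathrm{wt},\varepsilon_i,\varphi_i$ and commutes with $\tilde e_i,\tilde f_i$ (with $0\mapsto 0$) for all $i\in I$. **Monomials.** Let $\mathcal M$ be the set of Laurent monomials $M=\prod_{i\in I,\,k\in\mathbb Z}Y_i(k)^{y_i(k)}$ (finite products) in commuting variables, and put $Y_0(k)=Y_{n+1}(k)=1$. Put $\mathrm{wt}(M)=\sum_{i,k}y_i(k)\Lambda_i$, $\varphi_i(M)=\max_{m\in\mathbb Z}\sum_{k\le m}y_i(k)$, $\varepsilon_i(M)=\max_{m\in\mathbb Z}\bigl(-\sum_{k>m}y_i(k)\bigr)$ and $$A_i(m)=Y_i(m)\,Y_i(m+1)\,Y_{i-1}(m+1)^{-1}\,Y_{i+1}(m)^{-1}.$$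 Set $\tilde f_iM=0$ if $\varphi_i(M)=0$ and $\tilde f_iM=A_i(n_f)^{-1}M$ otherwise, and $\tilde e_iM=0$ if $\varepsilon_i(M)=0$ and $\tilde e_iM=A_i(n_e)M$ otherwise, where $n_f$ (resp. $n_e$) is the smallest (resp. largest) $m\in\mathbb Z$ with $\sum_{k\le m}y_i(k)=\varphi_i(M)$. Let $\mathcal M(\lambda)$ be the connected component of the crystal graph of $\mathcal M$ (with arrows $M\to\tilde f_iM\ne 0$) that contains $Y_1(0)^{a_1}\cdots Y_n(0)^{a_n}$. Put $X_i(m)=Y_{i-1}(m+1)^{-1}Y_i(m)$ for $1\le i\le n+1$. **Tableaux.** Let $T(\lambda)$ be the set of semistandard Young tableaux with entries in $\{1,\dots,n+1\}$ whose shape is the Young diagram with $a_k$ columns of length $k$ for each $k\in I$. Let $S(\lambda)$ be the set of fillings, with entries in $\{1,\dots,n+1\}$, of that diagram rotated by $180^\circ$ (columns aligned at the bottom, column lengths weakly increasing from left to right) such that rows weakly increase from left to right and columns strictly increase from top to bottom. Both carry the Kashiwara–Nakashima crystal structure: a tableau is identified with the tensor product of its entries, read along the columns from right to left and down each column, where the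 letters form the crystal $1\xrightarrow{1}2\xrightarrow{2}\cdots\xrightarrow{n}n+1$, the letter $x$ having weight $\Lambda_x-\Lambda_{x-1}$ (with $\Lambda_0=\Lambda_{n+1}=0$), and where $$\tilde f_i(b_1\otimes b_2)=\begin{cases}\tilde f_ib_1\otimes b_2&\text{if }\varphi_i(b_1)>\varepsilon_i(b_2),\\ b_1\otimes\tilde f_ib_2&\text{if }\varphi_i(b_1)\le\varepsilon_i(b_2),\end{cases}\qquad \tilde e_i(b_1\otimes b_2)=\begin{cases}\tilde e_ib_1\otimes b_2&\text{if }\varphi_i(b_1)\ge\varepsilon_i(b_2),\\ b_1\otimes\tilde e_ib_2&\text{if }\varphi_i(b_1)<\varepsilon_i(b_2).\end{cases}$$ **Statement.** Every $M\in\mathcal M(\lambda)$ can be written as $M=\prod_{1\le i\le n+1,\;0\le j\le n-1}X_i(j)^{m_{ij}}$ with unique $m_{ij}\in\mathbb Z_{\ge 0}$. Let $\psi(M)$ be the right-justified tableau with weakly increasing rows whose $(j+1)$-st row from the bottom contains exactly $m_{ij}$ entries $i$. Then $\psi$ is a crystal isomorphism $\mathcal M(\lambda)\to S(\lambda)$.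 For $S\in S(\lambda)$ with columns $C_1,\dots,C_r$ from right to left, let $\varphi(S)=C_1\leftarrow C_2\leftarrow\cdots\leftarrow C_r$ be obtained, starting with the empty tableau, by column-inserting the entries of $C_1$ from top to bottom, then those of $C_2$ from top to bottom, and so on. (To insert $x$ into a column, replace the smallest entry $\ge x$ by $x$ and insert the replaced entry into the next column to the right; if there is no such entry, put $x$ at the bottom of the column.) Then $\varphi$ is a crystal isomorphism $S(\lambda)\to T(\lambda)$. Consequently $\phi=\varphi\circ\psi:\mathcal M(\lambda)\to T(\lambda)$ is a crystal isomorphism. -/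

import Mathlib

/-!
Crystals of type `A_n`: Nakajima monomials, reverse tableaux, Young tableaux, column insertion.

Indexing: the vertex set `I = {1, …, n}` is `Fin n`, with `i : Fin n` standing for `i + 1`; the
alphabet `{1, …, n + 1}` is `Fin (n + 1)`, with `x` standing for `x + 1`.  The weight lattice
`P = ⨁ ℤ Λ_i` is `Fin n → ℤ`, coordinate `i` being the coefficient of the fundamental weight, so
that `⟨h_i, μ⟩ = μ i`.  A dominant weight `λ = a_1 Λ_1 + ⋯ + a_n Λ_n` is `a : Fin n → ℕ`.
-/

namespace TypeACrystal

/-- The data of a `U_q(A_n)`-crystal on `B`: weight, `ε_i`, `φ_i` and the Kashiwara operators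
`e_i`, `f_i : B → B ∪ {0}`, where `none` is `0`. -/
structure CrystalData (n : ℕ) (B : Type*) where
  wt : B → Fin n → ℤ
  eps : Fin n → B → ℤ
  phi : Fin n → B → ℤ
  e : Fin n → B → Option B
  f : Fin n → B → Option B

/-- `X` is stable under the Kashiwara operators (up to `0`). -/
def CrystalData.Stable {n : ℕ} {B : Type*} (C : CrystalData n B) (X : Set B) : Prop :=
  ∀ b ∈ X, ∀ i : Fin n, (∀ b', C.e i b = some b' → b' ∈ X) ∧ (∀ b', C.f i b = some b' → b' ∈ X)

/-- `F` restricts to an isomorphism from the subcrystal `X` onto the subcrystal `Y`: both sets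
are stable under the Kashiwara operators and `F : X → Y` is a bijection which preserves `wt`,
`ε_i`, `φ_i` and commutes with `e_i`, `f_i` (`0` going to `0`). -/
structure IsCrystalIso {n : ℕ} {B B' : Type*} (C : CrystalData n B) (C' : CrystalData n B')
    (X : Set B) (Y : Set B') (F : B → B') : Prop where
  stable_source : C.Stable X
  stable_target : C'.Stable Y
  bijOn : Set.BijOn F X Y
  map_wt : ∀ b ∈ X, C'.wt (F b) = C.wt b
  map_eps : ∀ b ∈ X, ∀ i, C'.eps i (F b) = C.eps i b
  map_phi : ∀ b ∈ X, ∀ i, C'.phi i (F b) = C.phi i b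
  map_e : ∀ b ∈ X, ∀ i, C'.e i (F b) = (C.e i b).map F
  map_f : ∀ b ∈ X, ∀ i, C'.f i (F b) = (C.f i b).map F

/-- The connected component of `b` in the crystal graph, whose arrows are `b → b'` whenever
`f_i b = b'` for some `i`. -/
def CrystalData.component {n : ℕ} {B : Type*} (C : CrystalData n B) (b : B) : Set B :=
  {b' | Relation.EqvGen (fun x y => ∃ i, C.f i x = some y) b b'}

/-! ### Nakajima monomials -/

/-- Laurent monomials in the commuting variables `Y_i(m)`, `i ∈ I`, `m ∈ ℤ`, given by their
exponents; the product of monomials is the sum of exponents. -/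
abbrev Monomial (n : ℕ) : Type := (Fin n × ℤ) →₀ ℤ

/-- The variable `Y_i(m)` for `i : Fin n`. -/
noncomputable def Y {n : ℕ} (i : Fin n) (m : ℤ) : Monomial n := Finsupp.single (i, m) 1

/-- The integers `c_{ij}`, `i ≠ j`: `0` if `i > j` and `1` if `i < j`. -/
def c {n : ℕ} (i j : Fin n) : ℤ := if i < j then 1 else 0

/-- `A_i(m) = Y_i(m) Y_i(m+1) ∏_{j ≠ i} Y_j(m + c_{ji})^{α_i(h_j)}`, where `α_i(h_j) = a_{ji}`
is an entry of the Cartan matrix. -/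
noncomputable def A {n : ℕ} (i : Fin n) (m : ℤ) : Monomial n :=
  Y i m + Y i (m + 1) +
    ∑ j ∈ Finset.univ.filter (fun j => j ≠ i), CartanMatrix.A n j i • Y j (m + c j i)

/-- The sum of the exponents of the `Y_i(k)` in `M` with `k ≤ m`. -/
noncomputable def lowerSum {n : ℕ} (i : Fin n) (M : Monomial n) (m : ℤ) : ℤ :=
  M.sum fun p a => if p.1 = i ∧ p.2 ≤ m then a else 0

/-- The sum of the exponents of the `Y_i(k)` in `M` with `k > m`. -/
noncomputable def upperSum {n : ℕ} (i : Fin n) (M : Monomial n) (m : ℤ) : ℤ :=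
  M.sum fun p a => if p.1 = i ∧ m < p.2 then a else 0

/-- `wt(M)`: the coefficient of `Λ_i` is the sum of all exponents of the `Y_i(k)`. -/
noncomputable def monomialWt {n : ℕ} (M : Monomial n) (i : Fin n) : ℤ :=
  M.sum fun p a => if p.1 = i then a else 0

/-- `φ_i(M)`, the maximum over `m` of the sum of the exponents of the `Y_i(k)` with `k ≤ m` (the
set of values is finite and contains `0`). -/
noncomputable def monomialPhi {n : ℕ} (i : Fin n) (M : Monomial n) : ℤ :=
  ⨆ m : ℤ, lowerSum i M m

/-- `ε_i(M)`, the maximum over `m` of minus the sum of the exponents of the `Y_i(k)` with `k > m`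
(the set of values is finite and contains `0`). -/
noncomputable def monomialEps {n : ℕ} (i : Fin n) (M : Monomial n) : ℤ :=
  ⨆ m : ℤ, -upperSum i M m

/-- `n_f`, the smallest `m` at which `φ_i(M)` is attained (used when `φ_i(M) > 0`; then it
exists). -/
noncomputable def nf {n : ℕ} (i : Fin n) (M : Monomial n) : ℤ :=
  sInf {m : ℤ | monomialPhi i M = lowerSum i M m}

/-- `n_e`, the largest `m` at which `φ_i(M)` is attained (used when `ε_i(M) > 0`; then it
exists). -/
noncomputable def ne {n : ℕ} (i : Fin n) (M : Monomial n) : ℤ :=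
  sSup {m : ℤ | monomialPhi i M = lowerSum i M m}

/-- The crystal of all monomials: `f_i M = A_i(n_f)⁻¹ M` if `φ_i(M) > 0`, and `0` otherwise;
`e_i M = A_i(n_e) M` if `ε_i(M) > 0`, and `0` otherwise. -/
noncomputable def monomialCrystal (n : ℕ) : CrystalData n (Monomial n) where
  wt := monomialWt
  eps := monomialEps
  phi := monomialPhi
  e i M := if monomialEps i M = 0 then none else some (A i (ne i M) + M)
  f i M := if monomialPhi i M = 0 then none else some (-A i (nf i M) + M)

/-- `Y_1(0)^{a_1} ⋯ Y_n(0)^{a_n}`. -/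
noncomputable def highestMonomial {n : ℕ} (a : Fin n → ℕ) : Monomial n :=
  ∑ i, a i • Y i 0

/-- `M(λ)`: the connected component containing `Y_1(0)^{a_1} ⋯ Y_n(0)^{a_n}`. -/
def MSet {n : ℕ} (a : Fin n → ℕ) : Set (Monomial n) :=
  (monomialCrystal n).component (highestMonomial a)

/-- `Y_k(m)` for the actual index `k`, with `Y_k(m) = 1` unless `1 ≤ k ≤ n`. -/
noncomputable def Ybd (n : ℕ) (k : ℕ) (m : ℤ) : Monomial n :=
  if h : 1 ≤ k ∧ k ≤ n then Y ⟨k - 1, by omega⟩ m else 0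

/-- `X_i(m) = Y_{i-1}(m+1)⁻¹ Y_i(m)` for `i = x + 1`, `x : Fin (n + 1)`. -/
noncomputable def X {n : ℕ} (x : Fin (n + 1)) (m : ℤ) : Monomial n :=
  -Ybd n x.val (m + 1) + Ybd n (x.val + 1) m

/-- `∏_{1 ≤ i ≤ n+1, 0 ≤ j ≤ n-1} X_i(j)^{m_{ij}}`. -/
noncomputable def XMonomial {n : ℕ} (m : Fin (n + 1) → Fin n → ℕ) : Monomial n :=
  ∑ x, ∑ j, m x j • X x (j.val : ℤ)

/-! ### Tableaux and their crystal structure -/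

/-- The vector representation `1 → 2 → ⋯ → n + 1`. -/
def vectorCrystal (n : ℕ) : CrystalData n (Fin (n + 1)) where
  wt x i := (if x = i.castSucc then 1 else 0) - (if x = i.succ then 1 else 0)
  eps i x := if x = i.succ then 1 else 0
  phi i x := if x = i.castSucc then 1 else 0
  e i x := if x = i.succ then some i.castSucc else none
  f i x := if x = i.castSucc then some i.succ else none

section Tensor

variable {n : ℕ} {B : Type*} (C : CrystalData n B)

/-- Weight of `b_1 ⊗ ⋯ ⊗ b_r`. -/
def tensorWt (l : List B) (i : Fin n) : ℤ := (l.map fun b => C.wt b i).sum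

/-- `ε_i(b ⊗ b') = max (ε_i(b), ε_i(b') - ⟨h_i, wt b⟩)`. -/
def tensorEps (i : Fin n) : List B → ℤ
  | [] => 0
  | b :: l => max (C.eps i b) (tensorEps i l - C.wt b i)

/-- `φ_i(b ⊗ b') = max (φ_i(b'), φ_i(b) + ⟨h_i, wt b'⟩)`. -/
def tensorPhi (i : Fin n) : List B → ℤ
  | [] => 0
  | b :: l => max (tensorPhi i l) (C.phi i b + tensorWt C l i)

/-- `e_i(b ⊗ b')` is `e_i b ⊗ b'` if `φ_i(b) ≥ ε_i(b')`, and `b ⊗ e_i b'` otherwise. -/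
def tensorE (i : Fin n) : List B → Option (List B)
  | [] => none
  | b :: l =>
      if tensorEps C i l ≤ C.phi i b then (C.e i b).map (fun b' => b' :: l)
      else (tensorE i l).map (fun l' => b :: l')

/-- `f_i(b ⊗ b')` is `f_i b ⊗ b'` if `φ_i(b) > ε_i(b')`, and `b ⊗ f_i b'` otherwise. -/
def tensorF (i : Fin n) : List B → Option (List B)
  | [] => none
  | b :: l =>
      if tensorEps C i l < C.phi i b then (C.f i b).map (fun b' => b' :: l)
      else (tensorF i l).map (fun l' => b :: l')

/-- Tensor products `b_1 ⊗ ⋯ ⊗ b_r` of any length `r` (the empty product is the trivial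
crystal), with the tensor product rule. -/
def tensorCrystal : CrystalData n (List B) where
  wt := tensorWt C
  eps := tensorEps C
  phi := tensorPhi C
  e := tensorE C
  f := tensorF C

end Tensor

/-- A filling of a diagram, as the list of its columns from left to right; each column lists its
entries from top to bottom.  Whether the columns are justified at the top or at the bottom depends
on the kind of diagram. -/
abbrev Filling (n : ℕ) : Type := List (List (Fin (n + 1)))

/-- The Kashiwara–Nakashima crystal structure: a filling is identified with the tensor product of
its columns from right to left, a column with the tensor product of its entries from top to
bottom. -/
def fillingCrystal (n : ℕ) : CrystalData n (Filling n) :=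
  let R := tensorCrystal (tensorCrystal (vectorCrystal n))
  { wt := fun T => R.wt T.reverse
    eps := fun i T => R.eps i T.reverse
    phi := fun i T => R.phi i T.reverse
    e := fun i T => (R.e i T.reverse).map List.reverse
    f := fun i T => (R.f i T.reverse).map List.reverse }

theorem antitone_tail {n : ℕ} (a : Fin n → ℕ) :
    Antitone fun i : Fin n => ∑ k ∈ Finset.Ici i, a k :=
  fun _ _ h => Finset.sum_le_sum_of_subset (Finset.Ici_subset_Ici.2 h)

/-- The Young diagram of `λ`: its `i`-th row has `a_i + ⋯ + a_n` boxes (that is, it has `a_k`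
columns of length `k`). -/
def shape {n : ℕ} (a : Fin n → ℕ) : YoungDiagram :=
  YoungDiagram.ofRowLens (List.ofFn fun i : Fin n => ∑ k ∈ Finset.Ici i, a k)
    (antitone_tail a).sortedGE_ofFn

/-- The columns of a semistandard Young tableau from left to right, each from top to bottom. -/
def columns {μ : YoungDiagram} (T : SemistandardYoungTableau μ) : List (List ℕ) :=
  (List.range (μ.rowLen 0)).map fun j => (List.range (μ.colLen j)).map fun i => T i j

/-- `T(λ)`: semistandard Young tableaux of shape `λ` with entries in the alphabet. -/
def TSet {n : ℕ} (a : Fin n → ℕ) : Set (Filling n) :=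
  {C | ∃ T : SemistandardYoungTableau (shape a), C.map (List.map Fin.val) = columns T}

/-- The column lengths, from left to right, of the reverse Young diagram of `λ` (the Young diagram
rotated by 180 degrees): `1` (`a_1` times), …, `n` (`a_n` times). -/
def reverseColLens {n : ℕ} (a : Fin n → ℕ) : List ℕ :=
  (List.finRange n).flatMap fun k => List.replicate (a k) (k.val + 1)

/-- `S(λ)`: reverse semistandard tableaux of shape `λ`.  The columns strictly increase from top to
bottom and the rows weakly increase from left to right; the columns are aligned at the bottom, so
that rows are compared by counting from the bottom. -/
def SSet {n : ℕ} (a : Fin n → ℕ) : Set (Filling n) :=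
  {C | C.map List.length = reverseColLens a ∧ (∀ col ∈ C, col.SortedLT) ∧
    C.Pairwise fun left right => ∀ (k : ℕ) (x y : Fin (n + 1)),
      left.reverse[k]? = some x → right.reverse[k]? = some y → x ≤ y}

/-! ### The maps -/

/-- A row with `m x` entries equal to `x` for each `x`, listed from right to left, weakly
decreasing. -/
def rowFromRight {n : ℕ} (m : Fin (n + 1) → ℕ) : List (Fin (n + 1)) :=
  (List.finRange (n + 1)).reverse.flatMap fun x => List.replicate (m x) x

/-- The right-justified filling with weakly increasing rows whose `(j+1)`-st row from the bottom
has `m x j` entries equal to `x`, written by columns. -/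
def fillingOfRows {n : ℕ} (m : Fin (n + 1) → Fin n → ℕ) : Filling n :=
  (List.range (Finset.univ.sup fun j => (rowFromRight fun x => m x j).length)).reverse.map
    fun k => (List.finRange n).reverse.filterMap fun j => (rowFromRight fun x => m x j)[k]?

open Classical in
/-- `ψ`: if `M = ∏ X_i(j)^{m_{ij}}`, then `ψ(M)` is the right-justified tableau with `m_{ij}`
entries `i` in its `(j+1)`-st row from the bottom.  (Monomials not of this form go to the empty
filling.) -/
noncomputable def psi {n : ℕ} (M : Monomial n) : Filling n :=
  if h : ∃ m : Fin (n + 1) → Fin n → ℕ, M = XMonomial m then fillingOfRows h.choose else []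

/-- Insert `x` into a column: `x` replaces the first (topmost) entry `≥ x`, which is returned as
the bumped entry; if there is none, `x` is appended at the bottom. -/
def bump {n : ℕ} (x : Fin (n + 1)) :
    List (Fin (n + 1)) → List (Fin (n + 1)) × Option (Fin (n + 1))
  | [] => ([x], none)
  | y :: l => if x ≤ y then (x :: l, some y) else (y :: (bump x l).1, (bump x l).2)

/-- Column insertion of a letter into a tableau: insert it into the first column, the bumped entry
into the second column, and so on. -/
def insertLetter {n : ℕ} (x : Fin (n + 1)) : Filling n → Filling n
  | [] => [[x]]
  | col :: T =>
      match bump x col with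
      | (col', none) => col' :: T
      | (col', some y) => col' :: insertLetter y T

/-- `T ← col`: column insertion of the entries of a column, from top to bottom. -/
def insertColumn {n : ℕ} (T : Filling n) (col : List (Fin (n + 1))) : Filling n :=
  col.foldl (fun T' x => insertLetter x T') T

/-- `φ(S) = C_1 ← C_2 ← ⋯ ← C_r`, where `C_1, …, C_r` are the columns of `S` from right to left. -/
def columnInsertion {n : ℕ} (S : Filling n) : Filling n :=
  S.reverse.foldl insertColumn []

end TypeACrystal

namespace TypeACrystal

/-! Write i and i+1 for the letters `i.castSucc` and `i.succ`. Both basic isomorphisms come from one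
principle, `CrystalData.IsGeneratedBy.isCrystalIso`. In a seminormal subcrystal with a single
highest weight element h, where chains of e_i terminate, every element is reached from h by the f_i.
A map that preserves wt and ε_i and commutes with f_i is therefore injective there, and its image is
the connected component of the image of h.

Reverse tableaux and ordinary tableaux both qualify as sources. Their row conditions survive e_i and
f_i (`rowsFromBottom_stable`, `rowsFromTop_stable`), a highest weight filling must have columns 1,
…, m (`highest_filling_unique`), and e_i lowers the sum of the entries.

Column insertion: inserting x into a column c turns c ⊗ x into y ⊗ c', where y is the bumped letter,
and this exchange commutes with f_i (`bump_f`). Associativity of the tensor product carries this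
through the successive columns (`insertLetter_f`) and then through a whole word (`insertWord_spec`).
Insertion sends the highest weight reverse tableau to the highest weight tableau, so its image is
T(λ).

Monomials: the map studied is the inverse of ψ, namely `fillingMonomial`, which multiplies X_x(j)
over the boxes. Since A_i(m) = X_i(m) X_{i+1}(m)⁻¹ (`A_eq`), multiplication by A_i(m)⁻¹ turns a
letter i of row m into i+1. In the partial sums for i, X_i(m) counts +1 from m on and X_{i+1}(m)
counts −1 from m+1 on. Below an uncancelled i or i+1 of a column all entries exceed i+1, and since
rows increase, so do the entries of those rows in the columns further right. Hence those columns
contribute nothing to the earlier partial sums. The order by rows thus agrees with the reading order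
by columns: the maximal partial sum is φ_i, and the first place where it is attained is the row of
the box on which f_i acts (`fillingMonomial_f`). Finally the exponents m_{ij} are determined by the
monomial (`XMonomial_injective`), and they determine the rows of the tableau. -/

/-- The compatibilities between `wt`, `ε_i`, `φ_i` and `e_i`, `f_i` used to transport `e_i`
from `f_i`. -/
structure CrystalData.Invertible {n : ℕ} {B : Type*} (C : CrystalData n B) : Prop where
  phi_eq : ∀ i b, C.phi i b = C.eps i b + C.wt b i
  e_eq_none : ∀ i b, C.e i b = none ↔ C.eps i b = 0
  e_of_f : ∀ i b b', C.f i b = some b' → C.e i b' = some b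

/-- A (seminormal) crystal: `ε_i` and `φ_i` are non-negative and vanish exactly where `e_i` and
`f_i` do, and `e_i`, `f_i` are mutually inverse. -/
structure CrystalData.Regular {n : ℕ} {B : Type*} (C : CrystalData n B) : Prop
    extends C.Invertible where
  eps_nonneg : ∀ i b, 0 ≤ C.eps i b
  phi_nonneg : ∀ i b, 0 ≤ C.phi i b
  f_eq_none : ∀ i b, C.f i b = none ↔ C.phi i b = 0
  f_of_e : ∀ i b b', C.e i b = some b' → C.f i b' = some b
  eps_f : ∀ i b b', C.f i b = some b' → C.eps i b' = C.eps i b + 1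
  phi_f : ∀ i b b', C.f i b = some b' → C.phi i b' = C.phi i b - 1

/-! ### Seminormal crystals. -/

namespace CrystalData.Regular

variable {n : ℕ} {B : Type*} {C : CrystalData n B}

theorem wt_eq (hC : C.Regular) (i : Fin n) (b : B) : C.wt b i = C.phi i b - C.eps i b := by
  rw [hC.phi_eq]; ring

theorem exists_f (hC : C.Regular) {i : Fin n} {b : B} (h : 0 < C.phi i b) :
    ∃ b', C.f i b = some b' := by
  rw [← Option.ne_none_iff_exists', Ne, hC.f_eq_none]; omega

theorem exists_e (hC : C.Regular) {i : Fin n} {b : B} (h : 0 < C.eps i b) :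
    ∃ b', C.e i b = some b' := by
  rw [← Option.ne_none_iff_exists', Ne, hC.e_eq_none]; omega

theorem phi_pos_of_f (hC : C.Regular) {i : Fin n} {b b' : B} (h : C.f i b = some b') :
    0 < C.phi i b := by
  have := hC.phi_nonneg i b
  have h' := mt (hC.f_eq_none i b).2 (by simp [h])
  omega

theorem eps_pos_of_e (hC : C.Regular) {i : Fin n} {b b' : B} (h : C.e i b = some b') :
    0 < C.eps i b := by
  have := hC.eps_nonneg i b
  have h' := mt (hC.e_eq_none i b).2 (by simp [h])
  omega

end CrystalData.Regular

theorem vectorCrystal_regular (n : ℕ) : (vectorCrystal n).Regular := by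
  have hne : ∀ i : Fin n, i.succ ≠ i.castSucc := fun i h => by
    have := congrArg Fin.val h; simp at this
  refine ⟨⟨?_, ?_, ?_⟩, ?_, ?_, ?_, ?_, ?_, ?_⟩ <;> intro i b <;>
    simp only [vectorCrystal] <;> grind

/-! ### Tensor products of crystals. -/

section Tensor

variable {n : ℕ} {B : Type*} {C : CrystalData n B}

@[simp] theorem tensorCrystal_wt (l : List B) : (tensorCrystal C).wt l = tensorWt C l := rfl
@[simp] theorem tensorCrystal_eps (i : Fin n) (l : List B) :
    (tensorCrystal C).eps i l = tensorEps C i l := rfl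
@[simp] theorem tensorCrystal_phi (i : Fin n) (l : List B) :
    (tensorCrystal C).phi i l = tensorPhi C i l := rfl
@[simp] theorem tensorCrystal_e (i : Fin n) (l : List B) :
    (tensorCrystal C).e i l = tensorE C i l := rfl
@[simp] theorem tensorCrystal_f (i : Fin n) (l : List B) :
    (tensorCrystal C).f i l = tensorF C i l := rfl

@[simp] theorem tensorWt_nil (i : Fin n) : tensorWt C [] i = 0 := rfl
@[simp] theorem tensorWt_cons (b : B) (l : List B) (i : Fin n) :
    tensorWt C (b :: l) i = C.wt b i + tensorWt C l i := by simp [tensorWt]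
@[simp] theorem tensorWt_append (l l' : List B) (i : Fin n) :
    tensorWt C (l ++ l') i = tensorWt C l i + tensorWt C l' i := by simp [tensorWt]

theorem tensorEps_nonneg (hC : C.Regular) (i : Fin n) (l : List B) : 0 ≤ tensorEps C i l := by
  cases l with
  | nil => simp [tensorEps]
  | cons b l => have := hC.eps_nonneg i b; simp only [tensorEps]; omega

theorem tensorPhi_nonneg (i : Fin n) (l : List B) : 0 ≤ tensorPhi C i l := by
  induction l with
  | nil => simp [tensorPhi]
  | cons b l ih => simp only [tensorPhi]; omega

theorem tensorPhi_eq (hC : C.Regular) (i : Fin n) (l : List B) :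
    tensorPhi C i l = tensorEps C i l + tensorWt C l i := by
  induction l with
  | nil => simp [tensorPhi, tensorEps]
  | cons b l ih =>
    have := hC.phi_eq i b
    simp only [tensorPhi, tensorEps, tensorWt_cons]; omega

theorem tensorF_eq_none (hC : C.Regular) (i : Fin n) (l : List B) :
    tensorF C i l = none ↔ tensorPhi C i l = 0 := by
  induction l with
  | nil => simp [tensorPhi, tensorF]
  | cons b l ih =>
    have h1 := tensorPhi_eq hC i l
    have h2 := tensorPhi_nonneg (C := C) i l
    have h3 := tensorEps_nonneg hC i l
    have h4 := hC.f_eq_none i b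
    have h5 := hC.phi_nonneg i b
    simp only [tensorPhi, tensorF]
    split_ifs with h
    · rw [Option.map_eq_none_iff, h4]; omega
    · rw [Option.map_eq_none_iff, ih]; omega

theorem tensorE_eq_none (hC : C.Regular) (i : Fin n) (l : List B) :
    tensorE C i l = none ↔ tensorEps C i l = 0 := by
  induction l with
  | nil => simp [tensorEps, tensorE]
  | cons b l ih =>
    have h1 := hC.phi_eq i b
    have h3 := tensorEps_nonneg hC i l
    have h4 := hC.e_eq_none i b
    have h5 := hC.eps_nonneg i b
    have h6 := hC.phi_nonneg i b
    simp only [tensorEps, tensorE]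
    split_ifs with h
    · rw [Option.map_eq_none_iff, h4]; omega
    · rw [Option.map_eq_none_iff, ih]; omega

/-- The strict inequality for f_i and the weak one for e_i fit together: if f_i acts on the first
factor, φ_i drops by one and ε < φ becomes ε ≤ φ; if it acts on the second, ε rises by one and φ ≤ ε
becomes φ < ε. Hence e_i picks the factor just changed. -/
theorem tensor_f_step (hC : C.Regular) (i : Fin n) (l l' : List B)
    (h : tensorF C i l = some l') :
    tensorEps C i l' = tensorEps C i l + 1 ∧ tensorPhi C i l' = tensorPhi C i l - 1 ∧
      tensorE C i l' = some l := by
  induction l generalizing l' with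
  | nil => simp [tensorF] at h
  | cons b l ih =>
    have h1 := hC.phi_eq i b
    have h2 := tensorPhi_eq hC i l
    simp only [tensorF] at h
    split_ifs at h with hc
    · obtain ⟨b', hb, rfl⟩ := Option.map_eq_some_iff.1 h
      have h3 := hC.eps_f i b b' hb
      have h4 := hC.phi_f i b b' hb
      have h5 := hC.e_of_f i b b' hb
      have h6 := hC.phi_eq i b'
      simp only [tensorEps, tensorPhi, tensorE]
      rw [if_pos (by omega), h5]
      refine ⟨by omega, by omega, rfl⟩
    · obtain ⟨m, hm, rfl⟩ := Option.map_eq_some_iff.1 h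
      obtain ⟨h3, h4, h5⟩ := ih m hm
      have h6 := tensorPhi_eq hC i m
      simp only [tensorEps, tensorPhi, tensorE]
      rw [if_neg (by omega), h5]
      refine ⟨by omega, by omega, rfl⟩

theorem tensor_f_of_e (hC : C.Regular) (i : Fin n) (l l' : List B)
    (h : tensorE C i l = some l') :
    tensorF C i l' = some l ∧ tensorEps C i l' = tensorEps C i l - 1 := by
  induction l generalizing l' with
  | nil => simp [tensorE] at h
  | cons b l ih =>
    have h1 := hC.phi_eq i b
    simp only [tensorE] at h
    split_ifs at h with hc
    · obtain ⟨b', hb, rfl⟩ := Option.map_eq_some_iff.1 h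
      have h5 := hC.f_of_e i b b' hb
      have h3 := hC.eps_f i b' b h5
      have h4 := hC.phi_f i b' b h5
      have h6 := hC.phi_eq i b'
      simp only [tensorEps, tensorF]
      rw [if_pos (by omega), h5]
      exact ⟨rfl, by omega⟩
    · obtain ⟨m, hm, rfl⟩ := Option.map_eq_some_iff.1 h
      obtain ⟨h3, h4⟩ := ih m hm
      simp only [tensorEps, tensorF]
      rw [if_neg (by omega), h3]
      exact ⟨rfl, by omega⟩

theorem tensorCrystal_regular (hC : C.Regular) : (tensorCrystal C).Regular where
  phi_eq := tensorPhi_eq hC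
  e_eq_none := tensorE_eq_none hC
  e_of_f i l l' h := (tensor_f_step hC i l l' h).2.2
  eps_nonneg := tensorEps_nonneg hC
  phi_nonneg := tensorPhi_nonneg
  f_eq_none := tensorF_eq_none hC
  f_of_e i l l' h := (tensor_f_of_e hC i l l' h).1
  eps_f i l l' h := (tensor_f_step hC i l l' h).1
  phi_f i l l' h := (tensor_f_step hC i l l' h).2.1

theorem tensorEps_append (hC : C.Regular) (i : Fin n) (l l' : List B) :
    tensorEps C i (l ++ l') = max (tensorEps C i l) (tensorEps C i l' - tensorWt C l i) := by
  induction l with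
  | nil => have := tensorEps_nonneg hC i l'; simp [tensorEps, this]
  | cons b l ih => simp only [List.cons_append, tensorEps, tensorWt_cons, ih]; omega

/-- Associativity of the tensor product rule: the recursion splits off one factor on the left, while
this splits at any place. -/
theorem tensorF_append (hC : C.Regular) (i : Fin n) (l l' : List B) :
    tensorF C i (l ++ l') = if tensorEps C i l' < tensorPhi C i l
      then (tensorF C i l).map (· ++ l') else (tensorF C i l').map (l ++ ·) := by
  induction l with
  | nil =>
    have := tensorEps_nonneg hC i l'
    rw [if_neg (by simpa [tensorPhi] using this)]; simp
  | cons b l ih =>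
    have h1 := tensorPhi_eq hC i l
    have h6 : tensorPhi C i (b :: l) = max (tensorPhi C i l) (C.phi i b + tensorWt C l i) := rfl
    have h7 := tensorEps_append hC i l l'
    simp only [List.cons_append, tensorF, ih]
    have h2 := hC.phi_nonneg i b
    have h3 := tensorPhi_nonneg (C := C) i l
    have h4 := tensorEps_nonneg hC i l
    have h5 := tensorEps_nonneg hC i l'
    split_ifs <;> first
      | omega
      | simp [Option.map_map, Function.comp_def]

theorem tensorE_append (hC : C.Regular) (i : Fin n) (l l' : List B) :
    tensorE C i (l ++ l') = if tensorEps C i l' ≤ tensorPhi C i l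
      then (tensorE C i l).map (· ++ l') else (tensorE C i l').map (l ++ ·) := by
  induction l with
  | nil =>
    have h1 := tensorEps_nonneg hC i l'
    have h2 := tensorE_eq_none hC i l'
    by_cases h : tensorEps C i l' = 0
    · rw [if_pos (by simp [tensorPhi, h])]; simp [h2.2 h, tensorE]
    · rw [if_neg (by simp only [tensorPhi]; omega)]; simp
  | cons b l ih =>
    have h1 := tensorPhi_eq hC i l
    have h6 : tensorPhi C i (b :: l) = max (tensorPhi C i l) (C.phi i b + tensorWt C l i) := rfl
    have h7 := tensorEps_append hC i l l'
    simp only [List.cons_append, tensorE, ih]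
    have h2 := hC.phi_nonneg i b
    have h3 := tensorPhi_nonneg (C := C) i l
    have h4 := tensorEps_nonneg hC i l
    have h5 := tensorEps_nonneg hC i l'
    split_ifs <;> first
      | omega
      | simp [Option.map_map, Function.comp_def]

/-- Iterated associativity: a tensor product of columns has the same structure as the word of its
letters. -/
theorem tensorF_flatten (hC : C.Regular) (i : Fin n) (L : List (List B)) :
    tensorF C i L.flatten = (tensorF (tensorCrystal C) i L).map List.flatten ∧
    tensorEps C i L.flatten = tensorEps (tensorCrystal C) i L ∧
    tensorWt C L.flatten i = tensorWt (tensorCrystal C) L i := by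
  induction L with
  | nil => simp [tensorF, tensorEps]
  | cons l L ih =>
    obtain ⟨h1, h2, h3⟩ := ih
    refine ⟨?_, ?_, ?_⟩
    · simp only [List.flatten_cons, tensorF_append hC, tensorF, h2, h1]
      change _ = Option.map _ (if _ < tensorPhi C i l then (tensorF C i l).map _ else _)
      split_ifs <;> simp [Option.map_map, Function.comp_def]
    · simp only [List.flatten_cons, tensorEps_append hC, tensorEps, tensorCrystal_eps, h2,
        tensorCrystal_wt]
    · simp [h3]

/-- A statistic lowered by every `e_i` of `C` is lowered by every `e_i` of the tensor powers. -/
theorem tensorE_measure {m : B → ℕ} (hm : ∀ i b b', C.e i b = some b' → m b' < m b)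
    (i : Fin n) (l l' : List B) (h : tensorE C i l = some l') :
    (l'.map m).sum < (l.map m).sum := by
  induction l generalizing l' with
  | nil => simp [tensorE] at h
  | cons b l ih =>
    simp only [tensorE] at h
    split_ifs at h with hc
    · obtain ⟨b', hb, rfl⟩ := Option.map_eq_some_iff.1 h
      simpa using hm i b b' hb
    · obtain ⟨w, hw, rfl⟩ := Option.map_eq_some_iff.1 h
      simpa using ih w hw

end Tensor

/-! ### Fillings, peeled off column by column from the left. -/

section Fillings

variable {n : ℕ}

theorem letters_regular : (tensorCrystal (vectorCrystal n)).Regular :=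
  tensorCrystal_regular (vectorCrystal_regular n)

theorem fillingCrystal_regular : (fillingCrystal n).Regular := by
  have h := tensorCrystal_regular (letters_regular (n := n))
  refine ⟨⟨fun i b => h.phi_eq i _, fun i b => ?_, fun i b b' hb => ?_⟩, fun i b => h.eps_nonneg i _,
    fun i b => h.phi_nonneg i _, fun i b => ?_, fun i b b' hb => ?_, fun i b b' hb => ?_,
    fun i b b' hb => ?_⟩
  · exact Option.map_eq_none_iff.trans (h.e_eq_none i _)
  · obtain ⟨w, hw, rfl⟩ := Option.map_eq_some_iff.1 hb
    have := h.e_of_f i _ _ hw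
    simp only [fillingCrystal, List.reverse_reverse]
    rw [this]; simp
  · exact Option.map_eq_none_iff.trans (h.f_eq_none i _)
  · obtain ⟨w, hw, rfl⟩ := Option.map_eq_some_iff.1 hb
    have := h.f_of_e i _ _ hw
    simp only [fillingCrystal, List.reverse_reverse]
    rw [this]; simp
  · obtain ⟨w, hw, rfl⟩ := Option.map_eq_some_iff.1 hb
    have := h.eps_f i _ _ hw
    simpa [fillingCrystal] using this
  · obtain ⟨w, hw, rfl⟩ := Option.map_eq_some_iff.1 hb
    have := h.phi_f i _ _ hw
    simpa [fillingCrystal] using this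

@[simp] theorem filling_wt_nil (i : Fin n) : (fillingCrystal n).wt [] i = 0 := rfl
@[simp] theorem filling_eps_nil (i : Fin n) : (fillingCrystal n).eps i [] = 0 := rfl
@[simp] theorem filling_phi_nil (i : Fin n) : (fillingCrystal n).phi i [] = 0 := rfl
@[simp] theorem filling_f_nil (i : Fin n) : (fillingCrystal n).f i [] = none := rfl
@[simp] theorem filling_e_nil (i : Fin n) : (fillingCrystal n).e i [] = none := rfl

theorem filling_wt_cons (c : List (Fin (n + 1))) (T : Filling n) (i : Fin n) :
    (fillingCrystal n).wt (c :: T) i =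
      (fillingCrystal n).wt T i + tensorWt (vectorCrystal n) c i := by
  simp [fillingCrystal]

theorem tensorEps_singleton {α : Type*} {C : CrystalData n α} (hC : C.Regular) (i : Fin n)
    (b : α) : tensorEps C i [b] = C.eps i b := by
  have h1 := hC.phi_nonneg i b
  rw [hC.phi_eq] at h1
  have h2 := hC.eps_nonneg i b
  change max (C.eps i b) (0 - C.wt b i) = _
  omega

theorem tensorF_singleton {α : Type*} {C : CrystalData n α} (hC : C.Regular) (i : Fin n) (b : α) :
    tensorF C i [b] = (C.f i b).map fun b' => [b'] := by
  have h1 := hC.phi_nonneg i b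
  have h2 := hC.f_eq_none i b
  have h3 : tensorEps C i [] = 0 := rfl
  rw [tensorF]
  split_ifs
  · rfl
  · rw [h2.2 (by omega)]; rfl

theorem tensorE_singleton {α : Type*} {C : CrystalData n α} (hC : C.Regular) (i : Fin n) (b : α) :
    tensorE C i [b] = (C.e i b).map fun b' => [b'] := by
  rw [tensorE]
  exact if_pos (hC.phi_nonneg i b)

/-- Columns are read from right to left, so `c :: T` stands for T ⊗ c. This formula and the next
ones are the tensor product rule with the leftmost column as last factor. -/
theorem filling_eps_cons (i : Fin n) (c : List (Fin (n + 1))) (T : Filling n) :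
    (fillingCrystal n).eps i (c :: T) = max ((fillingCrystal n).eps i T)
      (tensorEps (vectorCrystal n) i c - (fillingCrystal n).wt T i) := by
  change tensorEps (tensorCrystal (vectorCrystal n)) i (c :: T).reverse =
    max (tensorEps (tensorCrystal (vectorCrystal n)) i T.reverse)
      (_ - tensorWt (tensorCrystal (vectorCrystal n)) T.reverse i)
  rw [List.reverse_cons, tensorEps_append letters_regular, tensorEps_singleton letters_regular,
    tensorCrystal_eps]

theorem filling_phi_cons (i : Fin n) (c : List (Fin (n + 1))) (T : Filling n) :
    (fillingCrystal n).phi i (c :: T) = max (tensorPhi (vectorCrystal n) i c)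
      ((fillingCrystal n).phi i T + tensorWt (vectorCrystal n) c i) := by
  have h1 := (fillingCrystal_regular (n := n)).phi_eq i (c :: T)
  have h2 := (fillingCrystal_regular (n := n)).phi_eq i T
  have h3 := tensorPhi_eq (vectorCrystal_regular n) i c
  have h4 := filling_eps_cons i c T
  have h5 := filling_wt_cons c T i
  omega

theorem filling_f_cons (i : Fin n) (c : List (Fin (n + 1))) (T : Filling n) :
    (fillingCrystal n).f i (c :: T) =
      if tensorEps (vectorCrystal n) i c < (fillingCrystal n).phi i T
      then ((fillingCrystal n).f i T).map (c :: ·)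
      else (tensorF (vectorCrystal n) i c).map (· :: T) := by
  change Option.map List.reverse (tensorF (tensorCrystal (vectorCrystal n)) i (c :: T).reverse) =
    if tensorEps (vectorCrystal n) i c < tensorPhi (tensorCrystal (vectorCrystal n)) i T.reverse
    then ((tensorF (tensorCrystal (vectorCrystal n)) i T.reverse).map List.reverse).map _ else _
  rw [List.reverse_cons, tensorF_append letters_regular, tensorF_singleton letters_regular,
    tensorEps_singleton letters_regular, tensorCrystal_eps, tensorCrystal_f]
  split_ifs <;> simp [Option.map_map, Function.comp_def]

theorem filling_e_cons (i : Fin n) (c : List (Fin (n + 1))) (T : Filling n) :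
    (fillingCrystal n).e i (c :: T) =
      if tensorEps (vectorCrystal n) i c ≤ (fillingCrystal n).phi i T
      then ((fillingCrystal n).e i T).map (c :: ·)
      else (tensorE (vectorCrystal n) i c).map (· :: T) := by
  change Option.map List.reverse (tensorE (tensorCrystal (vectorCrystal n)) i (c :: T).reverse) =
    if tensorEps (vectorCrystal n) i c ≤ tensorPhi (tensorCrystal (vectorCrystal n)) i T.reverse
    then ((tensorE (tensorCrystal (vectorCrystal n)) i T.reverse).map List.reverse).map _ else _
  rw [List.reverse_cons, tensorE_append letters_regular, tensorE_singleton letters_regular,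
    tensorEps_singleton letters_regular, tensorCrystal_eps, tensorCrystal_e]
  split_ifs <;> simp [Option.map_map, Function.comp_def]

end Fillings

/-! ### Strictly increasing columns -/

section Column

variable {n : ℕ}

/-- The effect of `f_i` on letters, extended by the identity. -/
def raiseLetter (i : Fin n) (x : Fin (n + 1)) : Fin (n + 1) := if x = i.castSucc then i.succ else x

/-- The effect of `e_i` on letters, extended by the identity. -/
def lowerLetter (i : Fin n) (x : Fin (n + 1)) : Fin (n + 1) := if x = i.succ then i.castSucc else x

theorem castSucc_ne_succ (i : Fin n) : i.castSucc ≠ i.succ := fun h => by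
  have := congrArg Fin.val h; simp at this

theorem map_raiseLetter {i : Fin n} {c : List (Fin (n + 1))} (h : i.castSucc ∉ c) :
    c.map (raiseLetter i) = c := by
  rw [List.map_congr_left (g := id), List.map_id]
  intro x hx
  rw [raiseLetter, if_neg (by rintro rfl; exact h hx)]; rfl

theorem map_lowerLetter {i : Fin n} {c : List (Fin (n + 1))} (h : i.succ ∉ c) :
    c.map (lowerLetter i) = c := by
  rw [List.map_congr_left (g := id), List.map_id]
  intro x hx
  rw [lowerLetter, if_neg (by rintro rfl; exact h hx)]; rfl

/-- Each letter occurs at most once, and i precedes i+1. If both occur, the +1 of φ_i(i) cancels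
against ε_i(i+1), so only a letter without its partner is visible. -/
theorem column_stats (i : Fin n) {c : List (Fin (n + 1))} (hc : c.SortedLT) :
    tensorEps (vectorCrystal n) i c = (if i.succ ∈ c ∧ i.castSucc ∉ c then 1 else 0) ∧
    tensorPhi (vectorCrystal n) i c = (if i.castSucc ∈ c ∧ i.succ ∉ c then 1 else 0) := by
  rw [List.sortedLT_iff_pairwise] at hc
  have hne := castSucc_ne_succ i
  have hlt : i.castSucc < i.succ := Fin.castSucc_lt_succ
  induction c with
  | nil => simp [tensorEps, tensorPhi]
  | cons x c ih =>
    rw [List.pairwise_cons] at hc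
    have hr := tensorPhi_eq (vectorCrystal_regular n) i c
    obtain ⟨h1, h2⟩ := ih hc.2
    have h3 := hc.1 i.castSucc
    have h4 := hc.1 i.succ
    have h5 : tensorWt (vectorCrystal n) c i =
      tensorPhi (vectorCrystal n) i c - tensorEps (vectorCrystal n) i c := by omega
    have h6 : (vectorCrystal n).eps i x = if x = i.succ then 1 else 0 := rfl
    have h7 : (vectorCrystal n).phi i x = if x = i.castSucc then 1 else 0 := rfl
    have h8 := (vectorCrystal_regular n).phi_eq i x
    rw [tensorEps, tensorPhi, h1, h2, h5, h1, h2]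
    grind

/-- The letter i occurs only once in a strictly increasing column, so changing one i is the same as
raising every i. This makes f_i on columns a `map`. -/
theorem column_f {i : Fin n} {c c' : List (Fin (n + 1))} (hc : c.SortedLT)
    (h : tensorF (vectorCrystal n) i c = some c') : c' = c.map (raiseLetter i) := by
  induction c generalizing c' with
  | nil => simp [tensorF] at h
  | cons x c ih =>
    rw [List.sortedLT_iff_pairwise, List.pairwise_cons] at hc
    rw [tensorF] at h
    split_ifs at h with h1
    · obtain ⟨y, hy, rfl⟩ := Option.map_eq_some_iff.1 h
      simp only [vectorCrystal, Option.ite_none_right_eq_some, Option.some.injEq] at hy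
      obtain ⟨rfl, rfl⟩ := hy
      rw [List.map_cons, map_raiseLetter fun hm => lt_irrefl _ (hc.1 _ hm)]
      simp [raiseLetter]
    · obtain ⟨w, hw, rfl⟩ := Option.map_eq_some_iff.1 h
      have hs := List.sortedLT_iff_pairwise.2 hc.2
      have h2 := letters_regular.phi_pos_of_f hw
      rw [tensorCrystal_phi, (column_stats i hs).2] at h2
      -- If f_i acts inside the tail, then i lies in the tail, so the smaller head is not i and is
      -- left alone.
      rw [ih hs hw, List.map_cons, raiseLetter, if_neg]
      rintro rfl
      split_ifs at h2 with h3
      · exact lt_irrefl _ (hc.1 _ h3.1)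
      · exact lt_irrefl _ h2

theorem column_e {i : Fin n} {c c' : List (Fin (n + 1))} (hc : c.SortedLT)
    (h : tensorE (vectorCrystal n) i c = some c') : c' = c.map (lowerLetter i) := by
  induction c generalizing c' with
  | nil => simp [tensorE] at h
  | cons x c ih =>
    rw [List.sortedLT_iff_pairwise, List.pairwise_cons] at hc
    rw [tensorE] at h
    split_ifs at h with h1
    · obtain ⟨y, hy, rfl⟩ := Option.map_eq_some_iff.1 h
      simp only [vectorCrystal, Option.ite_none_right_eq_some, Option.some.injEq] at hy
      obtain ⟨rfl, rfl⟩ := hy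
      rw [List.map_cons, map_lowerLetter fun hm => lt_irrefl _ (hc.1 _ hm)]
      simp [lowerLetter]
    · obtain ⟨w, hw, rfl⟩ := Option.map_eq_some_iff.1 h
      have hs := List.sortedLT_iff_pairwise.2 hc.2
      have h2 := letters_regular.eps_pos_of_e hw
      rw [tensorCrystal_eps, (column_stats i hs).1] at h2
      rw [ih hs hw, List.map_cons, lowerLetter, if_neg]
      rintro rfl
      split_ifs at h2 with h3
      · exact lt_irrefl _ (hc.1 _ h3.1)
      · exact lt_irrefl _ h2

end Column

/-! ### Column insertion is a crystal morphism -/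

section Insertion

variable {n : ℕ}

theorem bump_of_forall_lt {x : Fin (n + 1)} {c : List (Fin (n + 1))} (h : ∀ y ∈ c, y < x) :
    bump x c = (c ++ [x], none) := by
  induction c with
  | nil => rfl
  | cons y c ih =>
    rw [List.forall_mem_cons] at h
    rw [bump, if_neg (not_le.2 h.1), ih h.2]
    rfl

/-- In a strictly increasing column the first entry ≥ x is the smallest one. The resulting
membership criterion is what feeds `column_stats` after an insertion. -/
theorem bump_spec (x : Fin (n + 1)) {c : List (Fin (n + 1))} (hc : c.SortedLT) :
    (bump x c).1.SortedLT ∧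
    ((∀ y ∈ c, y < x) ∨ ∃ y ∈ c, (bump x c).2 = some y ∧ x ≤ y ∧ (∀ z ∈ c, x ≤ z → y ≤ z) ∧
      ∀ z, z ∈ (bump x c).1 ↔ z = x ∨ (z ∈ c ∧ z ≠ y)) := by
  simp only [List.sortedLT_iff_pairwise] at hc ⊢
  induction c with
  | nil => simp [bump]
  | cons y c ih =>
    rw [List.pairwise_cons] at hc
    obtain ⟨ih1, ih2⟩ := ih hc.2
    rw [bump]
    split_ifs with h
    · refine ⟨List.pairwise_cons.2 ⟨fun z hz => h.trans_lt (hc.1 z hz), hc.2⟩, Or.inr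
        ⟨y, by simp, rfl, h, ?_, ?_⟩⟩
      · intro z hz _
        rcases List.mem_cons.1 hz with rfl | hz
        exacts [le_rfl, (hc.1 z hz).le]
      · intro z
        have := hc.1 z
        grind
    · push Not at h
      rcases ih2 with h2 | ⟨w, hw, h3, h4, h5, h6⟩
      · rw [bump_of_forall_lt h2] at ih1 ⊢
        refine ⟨List.pairwise_cons.2 ⟨?_, ih1⟩, Or.inl (List.forall_mem_cons.2 ⟨h, h2⟩)⟩
        intro z hz
        rcases List.mem_append.1 hz with hz | hz
        · exact hc.1 z hz
        · simpa using (List.mem_singleton.1 hz) ▸ h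
      · refine ⟨List.pairwise_cons.2 ⟨?_, ih1⟩, Or.inr ⟨w, by simp [hw], h3, h4, ?_, ?_⟩⟩
        · intro z hz
          rcases (h6 z).1 hz with rfl | hz
          exacts [h, hc.1 z hz.1]
        · intro z hz hxz
          rcases List.mem_cons.1 hz with rfl | hz
          exacts [absurd hxz (not_le.2 h), h5 z hz hxz]
        · intro z
          have := hc.1 w hw
          have := h6 z
          grind

/-- Bumping uses only comparisons of x with the entries, so it commutes with any relabelling that
preserves these. -/
theorem bump_map {g : Fin (n + 1) → Fin (n + 1)} {x : Fin (n + 1)} {c : List (Fin (n + 1))}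
    (h : ∀ y ∈ c, x ≤ y ↔ g x ≤ g y) :
    bump (g x) (c.map g) = ((bump x c).1.map g, (bump x c).2.map g) := by
  induction c with
  | nil => rfl
  | cons y c ih =>
    rw [List.forall_mem_cons] at h
    rw [List.map_cons, bump, bump, ih h.2]
    by_cases hxy : x ≤ y
    · rw [if_pos hxy, if_pos (h.1.1 hxy)]; rfl
    · rw [if_neg hxy, if_neg (mt h.1.2 hxy)]; rfl

/-- Inserting `i` into a column containing `i` but not `i + 1`, after `f_i` was applied to it. -/
theorem bump_map_raiseLetter {i : Fin n} {c : List (Fin (n + 1))} (hc : c.SortedLT)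
    (h : i.castSucc ∈ c) : bump i.castSucc (c.map (raiseLetter i)) = (c, some i.succ) := by
  rw [List.sortedLT_iff_pairwise] at hc
  induction c with
  | nil => simp at h
  | cons y c ih =>
    rw [List.pairwise_cons] at hc
    by_cases hy : y = i.castSucc
    · subst hy
      rw [List.map_cons, map_raiseLetter fun hm => lt_irrefl _ (hc.1 _ hm), bump]
      simp [raiseLetter, Fin.castSucc_lt_succ.le]
    · have h' := (List.mem_cons.1 h).resolve_left (Ne.symm hy)
      have := hc.1 _ h'
      rw [List.map_cons, bump, raiseLetter, if_neg hy, if_neg (not_le.2 this), ih hc.2 h']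

theorem bump_self {x : Fin (n + 1)} {c : List (Fin (n + 1))} (hc : c.SortedLT) (h : x ∈ c) :
    bump x c = (c, some x) := by
  rw [List.sortedLT_iff_pairwise] at hc
  induction c with
  | nil => simp at h
  | cons y c ih =>
    rw [List.pairwise_cons] at hc
    rcases List.mem_cons.1 h with rfl | h
    · simp [bump]
    · rw [bump, if_neg (not_le.2 (hc.1 x h)), ih hc.2 h]

/-- `f_i` on `column ⊗ letter`. -/
def columnLetterF (i : Fin n) (c : List (Fin (n + 1))) (x : Fin (n + 1)) :
    Option (List (Fin (n + 1)) × Fin (n + 1)) :=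
  if (vectorCrystal n).eps i x < tensorPhi (vectorCrystal n) i c
  then (tensorF (vectorCrystal n) i c).map fun c' => (c', x)
  else ((vectorCrystal n).f i x).map fun x' => (c, x')

/-- `f_i` on `letter ⊗ column`, with the factors listed in the order column, letter. -/
def letterColumnF (i : Fin n) (c : List (Fin (n + 1))) (y : Fin (n + 1)) :
    Option (List (Fin (n + 1)) × Option (Fin (n + 1))) :=
  if tensorEps (vectorCrystal n) i c < (vectorCrystal n).phi i y
  then ((vectorCrystal n).f i y).map fun y' => (c, some y')
  else (tensorF (vectorCrystal n) i c).map fun c' => (c', some y)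

theorem tensorF_eq_map {i : Fin n} {c : List (Fin (n + 1))} (hc : c.SortedLT)
    (h1 : i.castSucc ∈ c) (h2 : i.succ ∉ c) :
    tensorF (vectorCrystal n) i c = some (c.map (raiseLetter i)) := by
  have h := (column_stats i hc).2
  rw [if_pos ⟨h1, h2⟩] at h
  obtain ⟨c', hc'⟩ := (letters_regular (n := n)).exists_f (i := i) (b := c)
    (by rw [tensorCrystal_phi, h]; exact one_pos)
  rw [tensorCrystal_f] at hc'
  rw [hc', column_f hc hc']

/-- Weight and ε_i agree on c ⊗ x and y ⊗ c'. By `column_stats` everything depends only on which of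
i, i+1 lie in c and c' and on whether x, y are among them; minimality of y leaves finitely many
consistent cases. -/
theorem bump_stats (i : Fin n) {x y : Fin (n + 1)} {c : List (Fin (n + 1))} (hc : c.SortedLT)
    (h : (bump x c).2 = some y) :
    max ((vectorCrystal n).eps i y)
      (tensorEps (vectorCrystal n) i (bump x c).1 - (vectorCrystal n).wt y i) =
    max (tensorEps (vectorCrystal n) i c)
      ((vectorCrystal n).eps i x - tensorWt (vectorCrystal n) c i) ∧
    (vectorCrystal n).wt y i + tensorWt (vectorCrystal n) (bump x c).1 i =
      tensorWt (vectorCrystal n) c i + (vectorCrystal n).wt x i := by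
  obtain ⟨hs, hb⟩ := bump_spec x hc
  have e1 : ∀ x, (vectorCrystal n).eps i x = if x = i.succ then 1 else 0 := fun _ => rfl
  have e2 : ∀ x, (vectorCrystal n).phi i x = if x = i.castSucc then 1 else 0 := fun _ => rfl
  have e3 := fun x => (vectorCrystal_regular n).wt_eq i x
  have e4 := fun c => tensorPhi_eq (vectorCrystal_regular n) i c
  have e5 : ∀ c, tensorWt (vectorCrystal n) c i =
    tensorPhi (vectorCrystal n) i c - tensorEps (vectorCrystal n) i c := by
    intro c; rw [e4]; ring
  rcases hb with hb | ⟨y', hy, h', hxy, hmin, hmem⟩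
  · rw [bump_of_forall_lt hb] at h; simp at h
  obtain rfl : y = y' := by rw [h] at h'; exact Option.some.inj h'
  have h1 := hmem i.castSucc
  have h2 := hmem i.succ
  have h3 := hmin i.castSucc
  have h4 := hmin i.succ
  have h5 : i.succ.val = i.castSucc.val + 1 := by simp
  rw [e5, e5, e3, e3, e1, e1, e2, e2, (column_stats i hs).1, (column_stats i hs).2,
    (column_stats i hc).1, (column_stats i hc).2]
  have hyp : y = i.castSucc → i.castSucc ∈ c := by rintro rfl; exact hy
  have hyq : y = i.succ → i.succ ∈ c := by rintro rfl; exact hy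
  clear hmem hmin e1 e2 e3 e4 e5 h' hs hc h hy
  simp only [Fin.ext_iff, Fin.le_def, ne_eq, h5] at h1 h2 h3 h4 hyp hyq hxy ⊢
  grind

/-- The exchange c ⊗ x ↦ y ⊗ c' commutes with f_i. The factor on which f_i acts may change: the
cases follow how raising an i in c, or raising x, alters the bumped letter. -/
theorem bump_f (i : Fin n) {x y : Fin (n + 1)} {c : List (Fin (n + 1))} (hc : c.SortedLT)
    (h : (bump x c).2 = some y) :
    (columnLetterF i c x).map (fun p => bump p.2 p.1) = letterColumnF i (bump x c).1 y := by
  obtain ⟨hs, hb⟩ := bump_spec x hc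
  have e1 : ∀ x, (vectorCrystal n).eps i x = if x = i.succ then 1 else 0 := fun _ => rfl
  have e2 : ∀ x, (vectorCrystal n).phi i x = if x = i.castSucc then 1 else 0 := fun _ => rfl
  have e3 : (vectorCrystal n).f i i.castSucc = some i.succ := if_pos rfl
  have e4 : ∀ z, z ≠ i.castSucc → (vectorCrystal n).f i z = none := fun z hz => if_neg hz
  have hpq := castSucc_ne_succ i
  have hlt : i.castSucc < i.succ := Fin.castSucc_lt_succ
  rcases hb with hb | ⟨y', hy, h', hxy, hmin, hmem⟩
  · rw [bump_of_forall_lt hb] at h; simp at h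
  obtain rfl : y = y' := by rw [h] at h'; exact Option.some.inj h'
  have h5 := (column_stats i hc).2
  have h6 := (column_stats i hs).1
  have h7 := (column_stats i hs).2
  have hp := hmem i.castSucc
  have hq := hmem i.succ
  have hbe : bump x c = ((bump x c).1, some y) := by rw [← h]
  rw [columnLetterF, letterColumnF]
  -- This is exactly φ_i(c) > ε_i(x), the case where f_i acts on the column.
  by_cases hA : i.castSucc ∈ c ∧ i.succ ∉ c ∧ x ≠ i.succ
  · obtain ⟨a1, a2, a3⟩ := hA
    rw [if_pos (by rw [e1, if_neg a3, h5, if_pos ⟨a1, a2⟩]; exact one_pos), tensorF_eq_map hc a1 a2]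
    -- If x = i, then x bumps the i of c, and after raising it bumps the new i+1, restoring c: on
    -- the other side f_i acts on y. If x ≠ i, raising i in c changes no comparison with x, because
    -- x ≠ i+1.
    by_cases hx : x = i.castSucc
    · subst hx
      rw [bump_self hc a1] at h hs h6 ⊢
      obtain rfl := Option.some.inj h
      rw [if_pos (by rw [h6, e2, if_pos rfl, if_neg (by tauto)]; exact one_pos), e3]
      simp [bump_map_raiseLetter hc a1]
    · have hg : raiseLetter i x = x := if_neg hx
      have hb := bump_map (g := raiseLetter i) (x := x) (c := c) (by
        intro z hz
        rw [hg]
        by_cases hz' : z = i.castSucc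
        · subst hz'
          simp only [raiseLetter, if_true, Ne, Fin.le_def, Fin.ext_iff, Fin.val_castSucc,
            Fin.val_succ] at a3 ⊢
          omega
        · rw [raiseLetter, if_neg hz'])
      rw [hg] at hb
      simp only [Option.map_some, hb, h]
      by_cases hy' : y = i.castSucc
      · subst hy'
        rw [if_pos (by rw [h6, e2, if_pos rfl, if_neg (by tauto)]; exact one_pos), e3,
          map_raiseLetter (by tauto)]
        simp [raiseLetter]
      · rw [if_neg (by rw [h6, e2, if_neg hy']; split_ifs <;> decide),
          tensorF_eq_map hs (by tauto) (by tauto)]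
        simp [raiseLetter, hy']
  -- Here f_i acts on the letter x.
  · rw [if_neg (by rw [e1, h5]; split_ifs <;> first | decide | tauto)]
    by_cases hx : x = i.castSucc
    · subst hx
      rw [e3, Option.map_some, Option.map_some]
      -- If i ∈ c, then also i+1 ∈ c, and i, i+1 each bump themselves, so y is raised. If i ∉ c,
      -- then i and i+1 bump the same letter, and the inserted letter inside c' is raised.
      by_cases a1 : i.castSucc ∈ c
      · have a2 : i.succ ∈ c := by tauto
        rw [bump_self hc a1] at h hs h6 ⊢
        obtain rfl := Option.some.inj h
        rw [if_pos (by rw [h6, e2, if_pos rfl, if_neg (by tauto)]; exact one_pos), e3]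
        simp [bump_self hc a2]
      · have hg : raiseLetter i i.castSucc = i.succ := if_pos rfl
        have hb := bump_map (g := raiseLetter i) (x := i.castSucc) (c := c) (by
          intro z hz
          have hz' : z ≠ i.castSucc := by rintro rfl; exact a1 hz
          rw [hg, raiseLetter, if_neg hz']
          simp only [Ne, Fin.le_def, Fin.ext_iff, Fin.val_castSucc, Fin.val_succ] at hz' ⊢
          omega)
        have hy' : y ≠ i.castSucc := by rintro rfl; exact a1 hy
        have hq' : i.succ ∉ (bump i.castSucc c).1 := by
          intro hm
          rcases hq.1 hm with h0 | ⟨h0, h1⟩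
          · exact hpq h0.symm
          · have := hmin _ h0 hlt.le
            simp only [Ne, Fin.le_def, Fin.ext_iff, Fin.val_castSucc, Fin.val_succ] at *
            omega
        rw [hg, map_raiseLetter a1] at hb
        rw [if_neg (by rw [h6, e2, if_neg hy']; split_ifs <;> decide),
          tensorF_eq_map hs (hp.2 (Or.inl rfl)) hq', hb, h]
        simp [raiseLetter, hy']
    -- Now x ≠ i, so the left side is 0; it remains to see that neither y nor c' can be raised.
    · rw [e4 x hx, Option.map_none, Option.map_none]
      have hmp : i.castSucc ∈ c → x ≤ i.castSucc → y ≤ i.castSucc := hmin _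
      have hyp : y = i.castSucc → i.castSucc ∈ c := by rintro rfl; exact hy
      have hxp : y = i.castSucc → x ≠ i.succ := by
        rintro rfl rfl; exact not_le.2 hlt hxy
      rw [if_neg]
      · symm
        rw [Option.map_eq_none_iff]
        refine (letters_regular.f_eq_none i _).2 (h7.trans (if_neg ?_))
        rintro ⟨b1, b2⟩
        have b3 := (hp.1 b1).resolve_left (Ne.symm hx)
        have b4 : x ≠ i.succ := fun h => b2 (hq.2 (Or.inl h.symm))
        have b5 : i.succ ∈ c := by_contra fun h => hA ⟨b3.1, h, b4⟩
        have b6 : i.succ = y := by_contra fun h => b2 (hq.2 (Or.inr ⟨b5, h⟩))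
        rw [← b6] at hxy
        have b8 := hmp b3.1
        clear * - b6 b4 hx hxy b8
        simp only [Ne, Fin.le_def, Fin.ext_iff, Fin.val_castSucc, Fin.val_succ] at *
        omega
      · rw [h6, e2]
        by_cases hy' : y = i.castSucc
        · have b1 := hyp hy'
          have b2 : i.succ ∈ c := by_contra fun h => hA ⟨b1, h, hxp hy'⟩
          have b3 : i.succ ∈ (bump x c).1 := hq.2 (Or.inr ⟨b2, fun h => hpq (hy'.symm.trans h.symm)⟩)
          have b4 : i.castSucc ∉ (bump x c).1 := fun h => by
            rcases hp.1 h with h | h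
            exacts [hx h.symm, h.2 hy'.symm]
          rw [if_pos ⟨b3, b4⟩, if_pos hy']; decide
        · rw [if_neg hy']; split_ifs <;> decide

end Insertion

/-! ### Column insertion of letters and words commutes with the crystal operators. -/

section Insertion

variable {n : ℕ}

/-- All columns are strictly increasing. -/
def ColumnStrict (T : Filling n) : Prop := ∀ c ∈ T, c.SortedLT

theorem insertLetter_of_some {x y : Fin (n + 1)} {c c' : List (Fin (n + 1))} {T : Filling n}
    (h : bump x c = (c', some y)) : insertLetter x (c :: T) = c' :: insertLetter y T := by
  simp [insertLetter, h]

theorem insertLetter_of_none {x : Fin (n + 1)} {c c' : List (Fin (n + 1))} {T : Filling n}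
    (h : bump x c = (c', none)) : insertLetter x (c :: T) = c' :: T := by
  simp [insertLetter, h]

/-- Continue the insertion of a letter after the first column has been treated. -/
def attachBumped (T : Filling n) (p : List (Fin (n + 1)) × Option (Fin (n + 1))) : Filling n :=
  match p with
  | (c, none) => c :: T
  | (c, some y) => c :: insertLetter y T

theorem ColumnStrict.insertLetter {T : Filling n} (hT : ColumnStrict T) (x : Fin (n + 1)) :
    ColumnStrict (insertLetter x T) := by
  induction T generalizing x with
  | nil => simp [ColumnStrict, TypeACrystal.insertLetter, List.sortedLT_iff_pairwise]
  | cons c T ih =>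
    simp only [ColumnStrict, List.forall_mem_cons] at hT
    have hb := (bump_spec x hT.1).1
    rcases h : bump x c with ⟨c', _ | y⟩ <;> rw [h] at hb
    · rw [insertLetter_of_none h]
      exact List.forall_mem_cons.2 ⟨hb, hT.2⟩
    · rw [insertLetter_of_some h]
      exact List.forall_mem_cons.2 ⟨hb, ih hT.2 y⟩

theorem bump_none {x : Fin (n + 1)} {c c' : List (Fin (n + 1))} (h : bump x c = (c', none)) :
    (∀ y ∈ c, y < x) ∧ c' = c ++ [x] := by
  have key : ∀ y ∈ c, y < x := by
    induction c generalizing c' with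
    | nil => simp
    | cons y c ih =>
      rw [bump] at h
      split_ifs at h with hxy
      · simp at h
      · exact List.forall_mem_cons.2 ⟨not_le.1 hxy, ih (c' := (bump x c).1)
          (Prod.ext rfl (by simpa using congrArg Prod.snd h))⟩
  rw [bump_of_forall_lt key] at h
  exact ⟨key, (congrArg Prod.fst h).symm⟩

theorem insertLetter_wt {T : Filling n} (hT : ColumnStrict T) (x : Fin (n + 1)) (i : Fin n) :
    (fillingCrystal n).wt (insertLetter x T) i =
      (fillingCrystal n).wt T i + (vectorCrystal n).wt x i := by
  induction T generalizing x with
  | nil => simp [insertLetter, filling_wt_cons]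
  | cons c T ih =>
    simp only [ColumnStrict, List.forall_mem_cons] at hT
    rcases h : bump x c with ⟨c', _ | y⟩
    · rw [insertLetter_of_none h, (bump_none h).2, filling_wt_cons, filling_wt_cons,
        tensorWt_append]
      simp [add_assoc]
    · have := (bump_stats i hT.1 (congrArg Prod.snd h)).2
      rw [h] at this
      rw [insertLetter_of_some h, filling_wt_cons, filling_wt_cons, ih hT.2]
      dsimp only at this
      omega

/-- ε_i is computed along T ⊗ c ⊗ x ↦ T ⊗ y ⊗ c' ↦ (T ← y) ⊗ c'. The first arrow is `bump_stats`,
the second the induction hypothesis; when nothing is bumped, c ⊗ x is itself the column `c ++ [x]`.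
-/
theorem insertLetter_eps {T : Filling n} (hT : ColumnStrict T) (x : Fin (n + 1)) (i : Fin n) :
    (fillingCrystal n).eps i (insertLetter x T) = max ((fillingCrystal n).eps i T)
      ((vectorCrystal n).eps i x - (fillingCrystal n).wt T i) := by
  induction T generalizing x with
  | nil =>
    rw [insertLetter, filling_eps_cons, tensorEps_singleton (vectorCrystal_regular n)]
  | cons c T ih =>
    simp only [ColumnStrict, List.forall_mem_cons] at hT
    rcases h : bump x c with ⟨c', _ | y⟩
    · rw [insertLetter_of_none h, (bump_none h).2, filling_wt_cons, filling_eps_cons,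
        filling_eps_cons, tensorEps_append (vectorCrystal_regular n),
        tensorEps_singleton (vectorCrystal_regular n)]
      omega
    · obtain ⟨h1, h2⟩ := bump_stats i hT.1 (congrArg Prod.snd h)
      rw [h] at h1 h2
      rw [insertLetter_of_some h, filling_eps_cons, filling_wt_cons, filling_eps_cons, ih hT.2,
        insertLetter_wt hT.2]
      dsimp only at h1 h2
      omega

theorem insertLetter_phi {T : Filling n} (hT : ColumnStrict T) (x : Fin (n + 1)) (i : Fin n) :
    (fillingCrystal n).phi i (insertLetter x T) = max ((vectorCrystal n).phi i x)
      ((fillingCrystal n).phi i T + (vectorCrystal n).wt x i) := by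
  have h1 := insertLetter_eps hT x i
  have h2 := insertLetter_wt hT x i
  have h3 := (fillingCrystal_regular (n := n)).phi_eq i (insertLetter x T)
  have h4 := (fillingCrystal_regular (n := n)).phi_eq i T
  have h5 := (vectorCrystal_regular n).phi_eq i x
  omega

/-- The map `T ⊗ x ↦ (T ← x)` commutes with `f_i`. -/
theorem insertLetter_f {T : Filling n} (hT : ColumnStrict T) (x : Fin (n + 1)) (i : Fin n) :
    (fillingCrystal n).f i (insertLetter x T) =
      if (vectorCrystal n).eps i x < (fillingCrystal n).phi i T
      then ((fillingCrystal n).f i T).map (insertLetter x)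
      else ((vectorCrystal n).f i x).map fun x' => insertLetter x' T := by
  have hV := vectorCrystal_regular n
  induction T generalizing x with
  | nil =>
    have := hV.eps_nonneg i x
    have h0 : (fillingCrystal n).phi i [] = 0 := rfl
    rw [insertLetter, filling_f_cons, h0, if_neg (by
      rw [tensorEps_singleton hV]; omega), if_neg (by omega), tensorF_singleton hV, Option.map_map]
    rfl
  | cons c T ih =>
    simp only [ColumnStrict, List.forall_mem_cons] at hT
    have e1 := filling_phi_cons i c T
    have e2 := tensorPhi_eq hV i c
    have e3 := hV.phi_eq i x
    rw [filling_f_cons i c T]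
    rcases h : bump x c with ⟨c', _ | y⟩
    · obtain ⟨hlt, rfl⟩ := bump_none h
      have hs := (bump_spec x hT.1).1
      rw [h] at hs
      rw [insertLetter_of_none h, filling_f_cons, tensorEps_append hV, tensorF_append hV,
        tensorEps_singleton hV, tensorF_singleton hV]
      -- The filling with x is T ⊗ (c ⊗ x): either f_i acts on T, or on the pair c ⊗ x. The maximum
      -- is ε_i(c ⊗ x).
      by_cases c1 : max (tensorEps (vectorCrystal n) i c)
        ((vectorCrystal n).eps i x - tensorWt (vectorCrystal n) c i) < (fillingCrystal n).phi i T
      · rw [if_pos c1, if_pos (by omega), if_pos (by omega), Option.map_map]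
        congr 1; funext T'
        exact (insertLetter_of_none h).symm
      · rw [if_neg c1]
        by_cases c2 : (vectorCrystal n).eps i x < tensorPhi (vectorCrystal n) i c
        · rw [if_pos c2, if_pos (by omega), if_neg (by omega)]
          rcases hc : tensorF (vectorCrystal n) i c with _ | w
          · rfl
          -- No letter is bumped after f_i either: since f_i acts on c rather than on x, the letter
          -- x is not i+1, so raising an i < x keeps it below x.
          · have hb : bump x w = (w ++ [x], none) := by
              apply bump_of_forall_lt
              rw [column_f hT.1 hc]
              intro z hz
              obtain ⟨u, hu, rfl⟩ := List.mem_map.1 hz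
              have h1 := hlt u hu
              have h2 : x ≠ i.succ := by
                rintro rfl
                rw [(column_stats i hT.1).2] at c2
                have : (vectorCrystal n).eps i i.succ = 1 := if_pos rfl
                rw [this] at c2
                split_ifs at c2 <;> omega
              rw [raiseLetter]
              split_ifs with h3
              · subst h3
                simp only [Ne, Fin.lt_def, Fin.ext_iff, Fin.val_castSucc, Fin.val_succ] at *
                omega
              · exact h1
            simp [insertLetter_of_none hb]
        · rw [if_neg c2, if_neg (by omega), Option.map_map, Option.map_map]
          rcases hx : (vectorCrystal n).f i x with _ | x'
          · rfl
          · simp only [vectorCrystal, Option.ite_none_right_eq_some, Option.some.injEq] at hx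
            obtain ⟨rfl, rfl⟩ := hx
            have hb : bump i.succ c = (c ++ [i.succ], none) :=
              bump_of_forall_lt fun z hz => (hlt z hz).trans Fin.castSucc_lt_succ
            simp [insertLetter_of_none hb]
    · obtain ⟨h1, h2⟩ := bump_stats i hT.1 (congrArg Prod.snd h)
      have e4 := insertLetter_phi hT.2 y i
      have e5 := hV.phi_eq i y
      rw [h] at h1 h2
      dsimp only at h1 h2
      rw [insertLetter_of_some h, filling_f_cons, ih hT.2]
      have e6 := tensorPhi_eq hV i c'
      by_cases c1 : max (tensorEps (vectorCrystal n) i c)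
        ((vectorCrystal n).eps i x - tensorWt (vectorCrystal n) c i) < (fillingCrystal n).phi i T
      · rw [if_pos (by omega), if_pos (by omega), if_pos (by omega), if_pos (by omega),
          Option.map_map, Option.map_map]
        congr 1; funext T'
        exact (insertLetter_of_some h).symm
      -- If f_i acts within c ⊗ x, both sides are obtained from the two sides of `bump_f` by
      -- continuing the insertion with T.
      · have hR : ∀ o, Option.map (fun p => insertLetter p.2 (p.1 :: T)) o =
            Option.map (attachBumped T) (Option.map
              (fun p : List (Fin (n + 1)) × Fin (n + 1) => bump p.2 p.1) o) := by
          intro o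
          rw [Option.map_map]
          congr 1
        have e8 := hR (columnLetterF i c x)
        rw [bump_f i hT.1 (congrArg Prod.snd h), h, columnLetterF, letterColumnF] at e8
        dsimp only at e8
        refine Eq.trans (b := _) ?_ (e8.symm.trans ?_)
        · by_cases c2 : tensorEps (vectorCrystal n) i c' < (vectorCrystal n).phi i y
          · rw [if_pos (by omega), if_neg (by omega), if_pos c2, Option.map_map, Option.map_map]
            rfl
          · rw [if_neg (by omega), if_neg c2, Option.map_map]
            rfl
        · by_cases c2 : (vectorCrystal n).eps i x < tensorPhi (vectorCrystal n) i c
          · rw [if_pos c2, if_pos (by omega), if_neg (by omega), Option.map_map, Option.map_map]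
            rfl
          · rw [if_neg c2, if_neg (by omega), Option.map_map]
            rfl

theorem filling_eps_flatten (i : Fin n) (T : Filling n) :
    (fillingCrystal n).eps i T = tensorEps (vectorCrystal n) i T.reverse.flatten :=
  (tensorF_flatten (vectorCrystal_regular n) i _).2.1.symm

theorem filling_wt_flatten (i : Fin n) (T : Filling n) :
    (fillingCrystal n).wt T i = tensorWt (vectorCrystal n) T.reverse.flatten i :=
  (tensorF_flatten (vectorCrystal_regular n) i _).2.2.symm

theorem filling_f_flatten (i : Fin n) (T : Filling n) :
    ((fillingCrystal n).f i T).map (fun T' => T'.reverse.flatten) =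
      tensorF (vectorCrystal n) i T.reverse.flatten := by
  rw [(tensorF_flatten (vectorCrystal_regular n) i _).1]
  change Option.map _ (Option.map List.reverse
    (tensorF (tensorCrystal (vectorCrystal n)) i T.reverse)) = _
  rw [Option.map_map]
  congr 1; funext w
  simp

/-- The column insertion of a word. -/
def insertWord (w : List (Fin (n + 1))) : Filling n := w.foldl (fun T x => insertLetter x T) []

theorem insertWord_concat (w : List (Fin (n + 1))) (x : Fin (n + 1)) :
    insertWord (w ++ [x]) = insertLetter x (insertWord w) := by
  simp [insertWord]

theorem columnInsertion_eq (S : Filling n) : columnInsertion S = insertWord S.reverse.flatten := by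
  rw [columnInsertion, insertWord, List.foldl_flatten]
  rfl

/-- Appending a letter to a word is ⊗ x on the right, which is the situation of `insertLetter_f`;
hence the induction from the right end. -/
theorem insertWord_spec (w : List (Fin (n + 1))) : ColumnStrict (insertWord w) ∧
    ∀ i, (fillingCrystal n).wt (insertWord w) i = tensorWt (vectorCrystal n) w i ∧
      (fillingCrystal n).eps i (insertWord w) = tensorEps (vectorCrystal n) i w ∧
      (fillingCrystal n).f i (insertWord w) = (tensorF (vectorCrystal n) i w).map insertWord := by
  have hV := vectorCrystal_regular n
  induction w using List.reverseRecOn with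
  | nil => simp [ColumnStrict, insertWord, tensorEps, tensorF]
  | append_singleton w x ih =>
    obtain ⟨h0, ih⟩ := ih
    rw [insertWord_concat]
    refine ⟨h0.insertLetter x, fun i => ?_⟩
    obtain ⟨h1, h2, h3⟩ := ih i
    have h4 := (fillingCrystal_regular (n := n)).phi_eq i (insertWord w)
    have h5 := tensorPhi_eq hV i w
    refine ⟨?_, ?_, ?_⟩
    · rw [insertLetter_wt h0, h1, tensorWt_append]; simp
    · rw [insertLetter_eps h0, h1, h2, tensorEps_append hV, tensorEps_singleton hV]
    · rw [insertLetter_f h0, h3, tensorF_append hV, tensorEps_singleton hV, tensorF_singleton hV]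
      have h6 : (fillingCrystal n).phi i (insertWord w) = tensorPhi (vectorCrystal n) i w := by
        omega
      rw [h6]
      split_ifs
      · simp [Option.map_map, Function.comp_def, insertWord_concat]
      · simp [Option.map_map, Function.comp_def, insertWord_concat]

/-- Insertion of a filling depends only on its reading word, and by `tensorF_flatten` the crystal
structure does too. No row condition enters at this point. -/
theorem columnInsertion_spec (S : Filling n) (i : Fin n) :
    (fillingCrystal n).wt (columnInsertion S) i = (fillingCrystal n).wt S i ∧
    (fillingCrystal n).eps i (columnInsertion S) = (fillingCrystal n).eps i S ∧
    (fillingCrystal n).f i (columnInsertion S) =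
      ((fillingCrystal n).f i S).map columnInsertion := by
  obtain ⟨h1, h2, h3⟩ := (insertWord_spec S.reverse.flatten).2 i
  rw [columnInsertion_eq, h1, h2, h3, filling_eps_flatten, filling_wt_flatten,
    ← filling_f_flatten, Option.map_map]
  refine ⟨rfl, rfl, ?_⟩
  congr 1; funext T
  exact (columnInsertion_eq T).symm

end Insertion

/-! ### Isomorphisms out of a crystal with one highest weight element. -/

section Generic

variable {n : ℕ} {B B' B'' : Type*} {C : CrystalData n B} {C' : CrystalData n B'}
  {C'' : CrystalData n B''}

/-- `X` is a subcrystal of `C` whose only highest weight element is `h`, and a statistic with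
values in `ℕ` bounds the lengths of chains of `e_i`. -/
structure CrystalData.IsGeneratedBy (C : CrystalData n B) (X : Set B) (h : B) : Prop where
  stable : C.Stable X
  mem : h ∈ X
  eps_eq_zero : ∀ i, C.eps i h = 0
  unique : ∀ b ∈ X, (∀ i, C.eps i b = 0) → b = h
  exists_measure : ∃ m : B → ℕ, ∀ i b b', C.e i b = some b' → m b' < m b

/-- Apply operators e_i until none acts; the measure makes this stop, uniqueness makes it stop at h,
and the path is retraced with f_i. -/
theorem CrystalData.IsGeneratedBy.induction (hC : C.Regular) {X : Set B} {h : B}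
    (hX : C.IsGeneratedBy X h) {P : B → Prop} (base : P h)
    (step : ∀ b ∈ X, ∀ i b', C.f i b = some b' → P b → P b') : ∀ b ∈ X, P b := by
  obtain ⟨m, hm⟩ := hX.exists_measure
  intro b
  induction hk : m b using Nat.strong_induction_on generalizing b with
  | _ k ih =>
    intro hb
    by_cases hz : ∀ i, C.eps i b = 0
    · rw [hX.unique b hb hz]; exact base
    · push Not at hz
      obtain ⟨i, hi⟩ := hz
      obtain ⟨b', hb'⟩ := hC.exists_e (lt_of_le_of_ne (hC.eps_nonneg i b) (Ne.symm hi))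
      have hX' := (hX.stable b hb i).1 b' hb'
      exact step b' hX' i b (hC.f_of_e i b b' hb')
        (ih (m b') (hk ▸ hm i b b' hb') b' rfl hX')

/-- A map which preserves `wt`, `ε_i` and commutes with `f_i` is an isomorphism from a subcrystal
with a single highest weight element onto a connected component. -/
theorem CrystalData.IsGeneratedBy.isCrystalIso (hC : C.Regular) (hC' : C'.Invertible) {X : Set B}
    {h : B} (hX : C.IsGeneratedBy X h) {F : B → B'} (hwt : ∀ b ∈ X, ∀ i, C'.wt (F b) i = C.wt b i)
    (heps : ∀ b ∈ X, ∀ i, C'.eps i (F b) = C.eps i b)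
    (hf : ∀ b ∈ X, ∀ i, C'.f i (F b) = (C.f i b).map F) :
    IsCrystalIso C C' X (C'.component (F h)) F := by
  -- Commutation with e_i is automatic: vanishing is read off ε_i, and otherwise e_i inverts f_i on
  -- both sides.
  have he : ∀ b ∈ X, ∀ i, C'.e i (F b) = (C.e i b).map F := by
    intro b hb i
    rcases hbe : C.e i b with _ | b'
    · rw [Option.map_none, hC'.e_eq_none, heps b hb, (hC.e_eq_none i b).1 hbe]
    · have h1 := hC.f_of_e i b b' hbe
      have h2 := hf b' ((hX.stable b hb i).1 b' hbe) i
      rw [h1] at h2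
      exact hC'.e_of_f i _ _ h2
  -- Highest weight elements are detected by ε_i, which F preserves. For c = f_i b, applying e_i to
  -- F c = F c' reduces the claim to b.
  have hinj : ∀ b ∈ X, ∀ b' ∈ X, F b = F b' → b = b' := by
    refine hX.induction hC ?_ ?_
    · intro b' hb' h1
      refine (hX.unique b' hb' fun i => ?_).symm
      rw [← heps b' hb', ← h1, heps h hX.mem, hX.eps_eq_zero]
    · intro b hb i c hc ih c' hc' h1
      have h2 := hC.e_of_f i b c hc
      have h3 := he c ((hX.stable b hb i).2 c hc) i
      rw [h1, he c' hc', h2, Option.map_some, Option.map_eq_some_iff] at h3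
      obtain ⟨b', hb', h4⟩ := h3
      have h5 := ih b' ((hX.stable c' hc' i).1 b' hb') h4.symm
      subst h5
      have h6 := hC.f_of_e i _ _ hb'
      rw [hc] at h6
      exact Option.some.inj h6
  -- The image is closed under following an arrow of C' in either direction, so it contains the
  -- component.
  have hback : ∀ y y', Relation.EqvGen (fun x y => ∃ i, C'.f i x = some y) y y' →
      (y ∈ F '' X ↔ y' ∈ F '' X) := by
    intro y y' hr
    induction hr with
    | rel x y hxy =>
      obtain ⟨i, hi⟩ := hxy
      constructor
      · rintro ⟨b, hb, rfl⟩
        rw [hf b hb, Option.map_eq_some_iff] at hi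
        obtain ⟨b', hb', rfl⟩ := hi
        exact ⟨b', (hX.stable b hb i).2 b' hb', rfl⟩
      · rintro ⟨b, hb, rfl⟩
        have h1 := hC'.e_of_f i _ _ hi
        rw [he b hb, Option.map_eq_some_iff] at h1
        obtain ⟨b', hb', rfl⟩ := h1
        exact ⟨b', (hX.stable b hb i).1 b' hb', rfl⟩
    | refl x => rfl
    | symm x y _ ih => exact ih.symm
    | trans x y z _ _ ih1 ih2 => exact ih1.trans ih2
  have himage : F '' X = C'.component (F h) := by
    ext y
    constructor
    · rintro ⟨b, hb, rfl⟩
      refine hX.induction hC (P := fun b => F b ∈ C'.component (F h)) (Relation.EqvGen.refl _) ?_ b hb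
      intro b hb i b' hb' ih
      exact Relation.EqvGen.trans _ _ _ ih (Relation.EqvGen.rel _ _ ⟨i, by rw [hf b hb, hb']; rfl⟩)
    · intro hy
      exact (hback _ _ hy).1 ⟨h, hX.mem, rfl⟩
  refine ⟨hX.stable, ?_, ⟨fun b hb => himage ▸ Set.mem_image_of_mem F hb,
    fun b hb b' hb' => hinj b hb b' hb', himage.symm.subset⟩, fun b hb => funext (hwt b hb), heps, ?_,
    he, hf⟩
  · rw [← himage]
    rintro _ ⟨b, hb, rfl⟩ i
    rw [he b hb, hf b hb]
    constructor <;> intro y hy <;> obtain ⟨b', hb', rfl⟩ := Option.map_eq_some_iff.1 hy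
    · exact ⟨b', (hX.stable b hb i).1 b' hb', rfl⟩
    · exact ⟨b', (hX.stable b hb i).2 b' hb', rfl⟩
  · intro b hb i
    rw [hC'.phi_eq, hC.phi_eq, heps b hb, hwt b hb]

/-- The identity map serves as F. This turns an abstract component into an explicit set when the
target is also understood. -/
theorem CrystalData.IsGeneratedBy.eq_component (hC : C.Regular) {X : Set B} {h : B}
    (hX : C.IsGeneratedBy X h) : X = C.component h := by
  have := (hX.isCrystalIso hC hC.toInvertible (F := id) (fun _ _ _ => rfl) (fun _ _ _ => rfl)
    (fun _ _ _ => by simp)).bijOn.image_eq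
  simpa using this

/-- Applied to ψ: its inverse is given by an explicit product and is easier to study. -/
theorem IsCrystalIso.symm_of_leftInverse {X : Set B} {Y : Set B'} {F : B → B'} {G : B' → B}
    (h : IsCrystalIso C C' X Y F) (hG : ∀ b ∈ X, G (F b) = b) : IsCrystalIso C' C Y X G := by
  have hsurj := h.bijOn.image_eq
  refine ⟨h.stable_target, h.stable_source, h.bijOn.symm ⟨?_, hG⟩, ?_, ?_, ?_, ?_, ?_⟩ <;>
    rw [← hsurj] <;> rintro _ ⟨b, hb, rfl⟩
  · rw [hG b hb]
  · rw [hG b hb, h.map_wt b hb]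
  · intro i; rw [hG b hb, h.map_eps b hb]
  · intro i; rw [hG b hb, h.map_phi b hb]
  · intro i
    rw [hG b hb, h.map_e b hb]
    rcases hb' : C.e i b with _ | b'
    · rfl
    · simp [hG b' ((h.stable_source b hb i).1 b' hb')]
  · intro i
    rw [hG b hb, h.map_f b hb]
    rcases hb' : C.f i b with _ | b'
    · rfl
    · simp [hG b' ((h.stable_source b hb i).2 b' hb')]

theorem IsCrystalIso.comp {X : Set B} {Y : Set B'} {Z : Set B''} {F : B → B'} {G : B' → B''}
    (hG : IsCrystalIso C' C'' Y Z G) (hF : IsCrystalIso C C' X Y F) :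
    IsCrystalIso C C'' X Z (G ∘ F) := by
  have hm := hF.bijOn.mapsTo
  refine ⟨hF.stable_source, hG.stable_target, hG.bijOn.comp hF.bijOn, fun b hb => ?_,
    fun b hb i => ?_, fun b hb i => ?_, fun b hb i => ?_, fun b hb i => ?_⟩
  · exact (hG.map_wt _ (hm hb)).trans (hF.map_wt b hb)
  · exact (hG.map_eps _ (hm hb) i).trans (hF.map_eps b hb i)
  · exact (hG.map_phi _ (hm hb) i).trans (hF.map_phi b hb i)
  · exact (hG.map_e _ (hm hb) i).trans (by rw [hF.map_e b hb, Option.map_map])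
  · exact (hG.map_f _ (hm hb) i).trans (by rw [hF.map_f b hb, Option.map_map])

end Generic

/-! ### Stability of the row conditions -/

section Rows

variable {n : ℕ}

theorem column_f_mem {i : Fin n} {c c' : List (Fin (n + 1))} (hc : c.SortedLT)
    (h : tensorF (vectorCrystal n) i c = some c') : i.castSucc ∈ c ∧ i.succ ∉ c := by
  have h1 := letters_regular.phi_pos_of_f h
  rw [tensorCrystal_phi, (column_stats i hc).2] at h1
  by_contra h2
  rw [if_neg h2] at h1
  exact lt_irrefl _ h1

theorem column_e_mem {i : Fin n} {c c' : List (Fin (n + 1))} (hc : c.SortedLT)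
    (h : tensorE (vectorCrystal n) i c = some c') : i.succ ∈ c ∧ i.castSucc ∉ c := by
  have h1 := letters_regular.eps_pos_of_e h
  rw [tensorCrystal_eps, (column_stats i hc).1] at h1
  by_contra h2
  rw [if_neg h2] at h1
  exact lt_irrefl _ h1

theorem column_f_sorted {i : Fin n} {c c' : List (Fin (n + 1))} (hc : c.SortedLT)
    (h : tensorF (vectorCrystal n) i c = some c') : c'.SortedLT := by
  have hm := column_f_mem hc h
  rw [column_f hc h]
  rw [List.sortedLT_iff_pairwise] at hc ⊢
  rw [List.pairwise_map]
  refine hc.imp_of_mem fun {x y} hx hy hxy => ?_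
  have h1 : y ≠ i.succ := by rintro rfl; exact hm.2 hy
  rw [raiseLetter, raiseLetter]
  split_ifs <;> simp only [Ne, Fin.lt_def, Fin.ext_iff, Fin.val_castSucc, Fin.val_succ] at * <;>
    omega

theorem column_e_sorted {i : Fin n} {c c' : List (Fin (n + 1))} (hc : c.SortedLT)
    (h : tensorE (vectorCrystal n) i c = some c') : c'.SortedLT := by
  have hm := column_e_mem hc h
  rw [column_e hc h]
  rw [List.sortedLT_iff_pairwise] at hc ⊢
  rw [List.pairwise_map]
  refine hc.imp_of_mem fun {x y} hx hy hxy => ?_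
  have h1 : x ≠ i.castSucc := by rintro rfl; exact hm.2 hx
  rw [lowerLetter, lowerLetter]
  split_ifs <;> simp only [Ne, Fin.lt_def, Fin.ext_iff, Fin.val_castSucc, Fin.val_succ] at * <;>
    omega

/-- A relation between neighbouring columns (left, right) which is preserved by the crystal
operators. -/
structure StableRel (R : List (Fin (n + 1)) → List (Fin (n + 1)) → Prop) : Prop where
  trans : ∀ {c d e}, R c d → R d e → R c e
  -- The vanishing of φ_i(d) here and of ε_i(c) in `e_right` is what the tensor rule guarantees when
  -- the operator picks that column of a neighbouring pair d ⊗ c.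
  f_left : ∀ {i c d c'}, c.SortedLT → d.SortedLT → R c d → tensorF (vectorCrystal n) i c = some c' →
    tensorPhi (vectorCrystal n) i d = 0 → R c' d
  f_right : ∀ {i c d d'}, c.SortedLT → d.SortedLT → R c d →
    tensorF (vectorCrystal n) i d = some d' → R c d'
  e_left : ∀ {i c d c'}, c.SortedLT → d.SortedLT → R c d →
    tensorE (vectorCrystal n) i c = some c' → R c' d
  e_right : ∀ {i c d d'}, c.SortedLT → d.SortedLT → R c d →
    tensorE (vectorCrystal n) i d = some d' → tensorEps (vectorCrystal n) i c = 0 → R c d'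

/-- The fillings with strictly increasing columns of given lengths satisfying a relation between
columns. -/
def fillingsWith (R : List (Fin (n + 1)) → List (Fin (n + 1)) → Prop) (L : List ℕ) :
    Set (Filling n) := {T | T.map List.length = L ∧ ColumnStrict T ∧ T.Pairwise R}

theorem column_stats_mem_zero_one (i : Fin n) {c : List (Fin (n + 1))} (hc : c.SortedLT) :
    (tensorEps (vectorCrystal n) i c = 0 ∨ tensorEps (vectorCrystal n) i c = 1) ∧
    (tensorPhi (vectorCrystal n) i c = 0 ∨ tensorPhi (vectorCrystal n) i c = 1) ∧
    (tensorEps (vectorCrystal n) i c = 0 ∨ tensorPhi (vectorCrystal n) i c = 0) := by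
  rw [(column_stats i hc).1, (column_stats i hc).2]
  grind

/-- Only one column changes, so only its two neighbours have to be compared; transitivity of R later
recovers all pairs. -/
theorem StableRel.f_mem {R : List (Fin (n + 1)) → List (Fin (n + 1)) → Prop} (hR : StableRel R)
    {i : Fin n} {T T' : Filling n} (hT : ColumnStrict T) (hr : T.IsChain R)
    (h : (fillingCrystal n).f i T = some T') :
    T'.map List.length = T.map List.length ∧ ColumnStrict T' ∧ T'.IsChain R := by
  induction T generalizing T' with
  | nil => simp at h
  | cons c T ih =>
    simp only [ColumnStrict, List.forall_mem_cons] at hT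
    rw [filling_f_cons] at h
    split_ifs at h with h1
    · obtain ⟨T₁, hT₁, rfl⟩ := Option.map_eq_some_iff.1 h
      obtain ⟨h2, h3, h4⟩ := ih hT.2 hr.tail hT₁
      refine ⟨by simp [h2], List.forall_mem_cons.2 ⟨hT.1, h3⟩, ?_⟩
      rcases T with _ | ⟨d, T⟩
      · simp at hT₁
      · rw [List.isChain_cons_cons] at hr
        have hd := hT.2 d (by simp)
        rw [filling_f_cons] at hT₁
        split_ifs at hT₁
        · obtain ⟨T₂, hT₂, rfl⟩ := Option.map_eq_some_iff.1 hT₁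
          exact List.isChain_cons_cons.2 ⟨hr.1, h4⟩
        · obtain ⟨d', hd', rfl⟩ := Option.map_eq_some_iff.1 hT₁
          exact List.isChain_cons_cons.2 ⟨hR.f_right hT.1 hd hr.1 hd', h4⟩
    · obtain ⟨c', hc', rfl⟩ := Option.map_eq_some_iff.1 h
      refine ⟨by simp [column_f hT.1 hc'],
        List.forall_mem_cons.2 ⟨column_f_sorted hT.1 hc', hT.2⟩, ?_⟩
      rcases T with _ | ⟨d, T⟩
      · simp
      · rw [List.isChain_cons_cons] at hr ⊢
        have hd := hT.2 d (by simp)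
        refine ⟨hR.f_left hT.1 hd hr.1 hc' ?_, hr.2⟩
        rw [filling_phi_cons] at h1
        have h2 := letters_regular.phi_pos_of_f hc'
        rw [tensorCrystal_phi] at h2
        have h3 := column_stats_mem_zero_one i hT.1
        have h4 := column_stats_mem_zero_one i hd
        omega

theorem StableRel.e_mem {R : List (Fin (n + 1)) → List (Fin (n + 1)) → Prop} (hR : StableRel R)
    {i : Fin n} {T T' : Filling n} (hT : ColumnStrict T) (hr : T.IsChain R)
    (h : (fillingCrystal n).e i T = some T') :
    T'.map List.length = T.map List.length ∧ ColumnStrict T' ∧ T'.IsChain R := by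
  induction T generalizing T' with
  | nil => simp at h
  | cons c T ih =>
    simp only [ColumnStrict, List.forall_mem_cons] at hT
    rw [filling_e_cons] at h
    split_ifs at h with h1
    · obtain ⟨T₁, hT₁, rfl⟩ := Option.map_eq_some_iff.1 h
      obtain ⟨h2, h3, h4⟩ := ih hT.2 hr.tail hT₁
      refine ⟨by simp [h2], List.forall_mem_cons.2 ⟨hT.1, h3⟩, ?_⟩
      rcases T with _ | ⟨d, T⟩
      · simp at hT₁
      · rw [List.isChain_cons_cons] at hr
        have hd := hT.2 d (by simp)
        rw [filling_e_cons] at hT₁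
        split_ifs at hT₁ with h5
        · obtain ⟨T₂, hT₂, rfl⟩ := Option.map_eq_some_iff.1 hT₁
          exact List.isChain_cons_cons.2 ⟨hr.1, h4⟩
        · obtain ⟨d', hd', rfl⟩ := Option.map_eq_some_iff.1 hT₁
          refine List.isChain_cons_cons.2 ⟨hR.e_right hT.1 hd hr.1 hd' ?_, h4⟩
          rw [filling_phi_cons] at h1
          have h6 := column_stats_mem_zero_one i hT.1
          have h7 := column_stats_mem_zero_one i hd
          have h8 := tensorPhi_eq (vectorCrystal_regular n) i d
          have h9 := (fillingCrystal_regular (n := n)).phi_nonneg i T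
          omega
    · obtain ⟨c', hc', rfl⟩ := Option.map_eq_some_iff.1 h
      refine ⟨by simp [column_e hT.1 hc'],
        List.forall_mem_cons.2 ⟨column_e_sorted hT.1 hc', hT.2⟩, ?_⟩
      rcases T with _ | ⟨d, T⟩
      · simp
      · rw [List.isChain_cons_cons] at hr ⊢
        exact ⟨hR.e_left hT.1 (hT.2 d (by simp)) hr.1 hc', hr.2⟩

theorem StableRel.stable {R : List (Fin (n + 1)) → List (Fin (n + 1)) → Prop} (hR : StableRel R)
    (L : List ℕ) : (fillingCrystal n).Stable (fillingsWith R L) := by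
  have : IsTrans _ R := ⟨fun _ _ _ => hR.trans⟩
  rintro T ⟨h1, h2, h3⟩ i
  constructor <;> intro T' hT'
  · obtain ⟨h4, h5, h6⟩ := hR.e_mem h2 (List.isChain_iff_pairwise.2 h3) hT'
    exact ⟨h4.trans h1, h5, List.isChain_iff_pairwise.1 h6⟩
  · obtain ⟨h4, h5, h6⟩ := hR.f_mem h2 (List.isChain_iff_pairwise.2 h3) hT'
    exact ⟨h4.trans h1, h5, List.isChain_iff_pairwise.1 h6⟩

/-- Letters with nothing between them in the order occupy consecutive positions. The relation r is
arbitrary so that columns can be read from the top (<) or from the bottom (>). -/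
theorem getElem?_succ_of_adjacent {α : Type*} {r : α → α → Prop} {l : List α} (hl : l.Pairwise r)
    {a b : α} (hne : a ≠ b) (hba : ¬ r b a) (hab : ∀ z, r a z → ¬ r z b) {k : ℕ}
    (ha : l[k]? = some a) (hb : b ∈ l) : l[k + 1]? = some b := by
  obtain ⟨m, hm, rfl⟩ := List.getElem_of_mem hb
  obtain ⟨hk, rfl⟩ := List.getElem?_eq_some_iff.1 ha
  rw [List.pairwise_iff_getElem] at hl
  rcases lt_trichotomy m k with h | rfl | h
  · exact absurd (hl m k hm hk h) hba
  · exact absurd rfl hne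
  · rcases Nat.lt_or_ge (k + 1) m with h' | h'
    · exact absurd (hl (k + 1) m (by omega) hm h') (hab _ (hl k (k + 1) hk (by omega) (by omega)))
    · obtain rfl : m = k + 1 := by omega
      exact List.getElem?_eq_getElem hm

theorem exists_getElem?_of_adjacent {α : Type*} {r : α → α → Prop} {l : List α}
    (hl : l.Pairwise r) {a b : α} (hne : a ≠ b) (hba : ¬ r b a) (hab : ∀ z, r a z → ¬ r z b) {k : ℕ}
    (ha : l[k]? = some b) (hb : a ∈ l) : ∃ m, k = m + 1 ∧ l[m]? = some a := by
  obtain ⟨m, hm, rfl⟩ := List.getElem_of_mem hb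
  have h := getElem?_succ_of_adjacent hl hne hba hab (List.getElem?_eq_getElem hm)
    (List.mem_of_getElem? ha)
  obtain ⟨hk, h1⟩ := List.getElem?_eq_some_iff.1 ha
  obtain ⟨hm1, h2⟩ := List.getElem?_eq_some_iff.1 h
  rw [List.pairwise_iff_getElem] at hl
  refine ⟨m, ?_, List.getElem?_eq_getElem hm⟩
  rcases lt_trichotomy m k with h | rfl | h
  · by_contra hne'
    have := hl (m + 1) k hm1 hk (by omega)
    rw [h1, ← h2] at this
    exact hab _ (hl m (m + 1) hm hm1 (by omega)) (by rwa [← h2])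
  · exact absurd h1 hne
  · have := hl k m hk hm h
    rw [h1] at this
    exact absurd this hba

/-- Weakly increasing rows of two columns aligned at the bottom, the right one being longer. -/
def RowsFromBottom (l r : List (Fin (n + 1))) : Prop :=
  l.length ≤ r.length ∧
    ∀ (k : ℕ) (x y : Fin (n + 1)), l.reverse[k]? = some x → r.reverse[k]? = some y → x ≤ y

/-- Weakly increasing rows of two columns aligned at the top, the left one being longer. -/
def RowsFromTop (l r : List (Fin (n + 1))) : Prop :=
  r.length ≤ l.length ∧
    ∀ (k : ℕ) (x y : Fin (n + 1)), l[k]? = some x → r[k]? = some y → x ≤ y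

theorem le_raiseLetter (i : Fin n) (x : Fin (n + 1)) : x ≤ raiseLetter i x := by
  rw [raiseLetter]
  split_ifs with h
  · rw [h]; exact Fin.castSucc_lt_succ.le
  · exact le_rfl

theorem lowerLetter_le (i : Fin n) (x : Fin (n + 1)) : lowerLetter i x ≤ x := by
  rw [lowerLetter]
  split_ifs with h
  · rw [h]; exact Fin.castSucc_lt_succ.le
  · exact le_rfl

theorem not_between (i : Fin n) (z : Fin (n + 1)) : i.castSucc < z → ¬ z < i.succ := by
  simp only [Fin.lt_def, Fin.val_castSucc, Fin.val_succ]
  omega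

/-- The danger for f_i on the left column is an i next to an i on its right. Then φ_i = 0 puts i+1
directly below the right i. The entry below the left i is > i and ≤ i+1, so it is i+1, which
contradicts that f_i acts on the left column. For e_i on the right column the argument uses the
entries directly above, present because the right column is longer. -/
theorem rowsFromBottom_stable : StableRel (RowsFromBottom (n := n)) where
  trans := by
    rintro l m r ⟨h1, h2⟩ ⟨h3, h4⟩
    refine ⟨h1.trans h3, fun k x y hx hy => ?_⟩
    obtain ⟨hk, -⟩ := List.getElem?_eq_some_iff.1 hx
    have hm : m.reverse[k]? = some (m.reverse[k]'(by simp at hk ⊢; omega)) :=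
      List.getElem?_eq_getElem _
    exact (h2 k x _ hx hm).trans (h4 k _ y hm hy)
  f_left := by
    rintro i l r l' hl hr ⟨h1, h2⟩ hf hphi
    have hm := column_f_mem hl hf
    rw [column_f hl hf]
    refine ⟨by simpa using h1, fun k x y hx hy => ?_⟩
    rw [← List.map_reverse, List.getElem?_map, Option.map_eq_some_iff] at hx
    obtain ⟨x, hx, rfl⟩ := hx
    have hxy := h2 k x y hx hy
    rw [raiseLetter]
    split_ifs with hxi
    · subst hxi
      by_contra hlt
      obtain rfl : i.castSucc = y := by
        simp only [Fin.le_def, Fin.ext_iff, Fin.val_castSucc, Fin.val_succ] at *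
        omega
      rw [(column_stats i hr).2] at hphi
      have hmem := List.mem_reverse.1 (List.mem_of_getElem? hy)
      have hs : i.succ ∈ r := by
        by_contra h; rw [if_pos ⟨hmem, h⟩] at hphi; omega
      have hr' := List.pairwise_reverse.2 (List.sortedLT_iff_pairwise.1 hr)
      obtain ⟨m, rfl, hm'⟩ := exists_getElem?_of_adjacent hr' (castSucc_ne_succ i).symm
        (lt_asymm Fin.castSucc_lt_succ) (fun z h h' => not_between i z h' h) hy
        (List.mem_reverse.2 hs)
      obtain ⟨hk, hx'⟩ := List.getElem?_eq_some_iff.1 hx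
      have hz := List.getElem?_eq_getElem (l := l.reverse) (i := m) (by omega)
      have h3 := h2 m _ _ hz hm'
      have hl' := List.pairwise_iff_getElem.1
        (List.pairwise_reverse.2 (List.sortedLT_iff_pairwise.1 hl)) m (m + 1) (by omega) hk
        (by omega)
      rw [hx'] at hl'
      rcases h3.lt_or_eq with h4 | h4
      · exact not_between i _ hl' h4
      · exact hm.2 (List.mem_reverse.1 (h4 ▸ List.getElem_mem _))
    · exact hxy
  f_right := by
    rintro i l r r' hl hr ⟨h1, h2⟩ hf
    rw [column_f hr hf]
    refine ⟨by simpa using h1, fun k x y hx hy => ?_⟩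
    rw [← List.map_reverse, List.getElem?_map, Option.map_eq_some_iff] at hy
    obtain ⟨y, hy, rfl⟩ := hy
    exact (h2 k x y hx hy).trans (le_raiseLetter i y)
  e_left := by
    rintro i l r r' hl hr ⟨h1, h2⟩ hf
    rw [column_e hl hf]
    refine ⟨by simpa using h1, fun k x y hx hy => ?_⟩
    rw [← List.map_reverse, List.getElem?_map, Option.map_eq_some_iff] at hx
    obtain ⟨x, hx, rfl⟩ := hx
    exact (lowerLetter_le i x).trans (h2 k x y hx hy)
  e_right := by
    rintro i l r r' hl hr ⟨h1, h2⟩ hf heps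
    have hm := column_e_mem hr hf
    rw [column_e hr hf]
    refine ⟨by simpa using h1, fun k x y hx hy => ?_⟩
    rw [← List.map_reverse, List.getElem?_map, Option.map_eq_some_iff] at hy
    obtain ⟨y, hy, rfl⟩ := hy
    have hxy := h2 k x y hx hy
    rw [lowerLetter]
    split_ifs with hyi
    · subst hyi
      by_contra hlt
      obtain rfl : i.succ = x := by
        simp only [Fin.le_def, Fin.ext_iff, Fin.val_castSucc, Fin.val_succ] at *
        omega
      rw [(column_stats i hl).1] at heps
      have hmem := List.mem_reverse.1 (List.mem_of_getElem? hx)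
      have hs : i.castSucc ∈ l := by
        by_contra h; rw [if_pos ⟨hmem, h⟩] at heps; omega
      have hl' := List.pairwise_reverse.2 (List.sortedLT_iff_pairwise.1 hl)
      have hm' := getElem?_succ_of_adjacent hl' (castSucc_ne_succ i).symm
        (lt_asymm Fin.castSucc_lt_succ) (fun z h h' => not_between i z h' h) hx
        (List.mem_reverse.2 hs)
      obtain ⟨hk, hx'⟩ := List.getElem?_eq_some_iff.1 hm'
      obtain ⟨hk', hy'⟩ := List.getElem?_eq_some_iff.1 hy
      have hk2 : k + 1 < r.reverse.length := by
        have := hk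
        rw [List.length_reverse] at this ⊢
        omega
      have hz := List.getElem?_eq_getElem hk2
      have h3 := h2 (k + 1) _ _ hm' hz
      have hr' := List.pairwise_iff_getElem.1
        (List.pairwise_reverse.2 (List.sortedLT_iff_pairwise.1 hr)) k (k + 1) hk' hk2 (by omega)
      rw [hy'] at hr'
      rcases h3.lt_or_eq with h4 | h4
      · exact not_between i _ h4 hr'
      · exact hm.2 (List.mem_reverse.1 (h4 ▸ List.getElem_mem _))
    · exact hxy

/-- Same argument as for rows counted from the bottom; now the longer left column guarantees the
entry below that f_i needs. -/
theorem rowsFromTop_stable : StableRel (RowsFromTop (n := n)) where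
  trans := by
    rintro l m r ⟨h1, h2⟩ ⟨h3, h4⟩
    refine ⟨h3.trans h1, fun k x y hx hy => ?_⟩
    obtain ⟨hk, -⟩ := List.getElem?_eq_some_iff.1 hy
    have hm : m[k]? = some (m[k]'(by omega)) := List.getElem?_eq_getElem _
    exact (h2 k x _ hx hm).trans (h4 k _ y hm hy)
  f_left := by
    rintro i l r l' hl hr ⟨h1, h2⟩ hf hphi
    have hm := column_f_mem hl hf
    rw [column_f hl hf]
    refine ⟨by simpa using h1, fun k x y hx hy => ?_⟩
    rw [List.getElem?_map, Option.map_eq_some_iff] at hx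
    obtain ⟨x, hx, rfl⟩ := hx
    have hxy := h2 k x y hx hy
    rw [raiseLetter]
    split_ifs with hxi
    · subst hxi
      by_contra hlt
      obtain rfl : i.castSucc = y := by
        simp only [Fin.le_def, Fin.ext_iff, Fin.val_castSucc, Fin.val_succ] at *
        omega
      rw [(column_stats i hr).2] at hphi
      have hmem := List.mem_of_getElem? hy
      have hs : i.succ ∈ r := by
        by_contra h; rw [if_pos ⟨hmem, h⟩] at hphi; omega
      have hm' := getElem?_succ_of_adjacent (List.sortedLT_iff_pairwise.1 hr)
        (castSucc_ne_succ i) (lt_asymm Fin.castSucc_lt_succ) (not_between i) hy hs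
      obtain ⟨hk, hx'⟩ := List.getElem?_eq_some_iff.1 hm'
      obtain ⟨hk', hy'⟩ := List.getElem?_eq_some_iff.1 hx
      have hk2 : k + 1 < l.length := by omega
      have hz := List.getElem?_eq_getElem hk2
      have h3 := h2 (k + 1) _ _ hz hm'
      have hl' := List.pairwise_iff_getElem.1 (List.sortedLT_iff_pairwise.1 hl) k (k + 1) hk' hk2
        (by omega)
      rw [hy'] at hl'
      rcases h3.lt_or_eq with h4 | h4
      · exact not_between i _ hl' h4
      · exact hm.2 (h4 ▸ List.getElem_mem _)
    · exact hxy
  f_right := by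
    rintro i l r r' hl hr ⟨h1, h2⟩ hf
    rw [column_f hr hf]
    refine ⟨by simpa using h1, fun k x y hx hy => ?_⟩
    rw [List.getElem?_map, Option.map_eq_some_iff] at hy
    obtain ⟨y, hy, rfl⟩ := hy
    exact (h2 k x y hx hy).trans (le_raiseLetter i y)
  e_left := by
    rintro i l r r' hl hr ⟨h1, h2⟩ hf
    rw [column_e hl hf]
    refine ⟨by simpa using h1, fun k x y hx hy => ?_⟩
    rw [List.getElem?_map, Option.map_eq_some_iff] at hx
    obtain ⟨x, hx, rfl⟩ := hx
    exact (lowerLetter_le i x).trans (h2 k x y hx hy)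
  e_right := by
    rintro i l r r' hl hr ⟨h1, h2⟩ hf heps
    have hm := column_e_mem hr hf
    rw [column_e hr hf]
    refine ⟨by simpa using h1, fun k x y hx hy => ?_⟩
    rw [List.getElem?_map, Option.map_eq_some_iff] at hy
    obtain ⟨y, hy, rfl⟩ := hy
    have hxy := h2 k x y hx hy
    rw [lowerLetter]
    split_ifs with hyi
    · subst hyi
      by_contra hlt
      obtain rfl : i.succ = x := by
        simp only [Fin.le_def, Fin.ext_iff, Fin.val_castSucc, Fin.val_succ] at *
        omega
      rw [(column_stats i hl).1] at heps
      have hmem := List.mem_of_getElem? hx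
      have hs : i.castSucc ∈ l := by
        by_contra h; rw [if_pos ⟨hmem, h⟩] at heps; omega
      obtain ⟨m, rfl, hm'⟩ := exists_getElem?_of_adjacent (List.sortedLT_iff_pairwise.1 hl)
        (castSucc_ne_succ i) (lt_asymm Fin.castSucc_lt_succ) (not_between i) hx hs
      obtain ⟨hk, hy'⟩ := List.getElem?_eq_some_iff.1 hy
      have hz := List.getElem?_eq_getElem (l := r) (i := m) (by omega)
      have h3 := h2 m _ _ hm' hz
      have hr' := List.pairwise_iff_getElem.1 (List.sortedLT_iff_pairwise.1 hr) m (m + 1)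
        (by omega) hk (by omega)
      rw [hy'] at hr'
      rcases h3.lt_or_eq with h4 | h4
      · exact not_between i _ h4 hr'
      · exact hm.2 (h4 ▸ List.getElem_mem _)
    · exact hxy

end Rows

/-! ### Highest weight fillings -/

section Highest

variable {n : ℕ}

/-- The column with entries `1, …, m`. -/
def initialColumn (n m : ℕ) : List (Fin (n + 1)) := (List.finRange (n + 1)).take m

theorem length_initialColumn {m : ℕ} (hm : m ≤ n + 1) : (initialColumn n m).length = m := by
  simp [initialColumn, hm]

theorem getElem?_initialColumn {m k : ℕ} {x : Fin (n + 1)} :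
    (initialColumn n m)[k]? = some x ↔ k < m ∧ x.val = k := by
  rw [initialColumn, List.getElem?_take]
  split_ifs with h
  · rw [List.getElem?_eq_some_iff]
    simp only [List.length_finRange, List.getElem_finRange, Fin.ext_iff, h, true_and]
    constructor
    · rintro ⟨_, h⟩; exact h.symm
    · intro h'; exact ⟨by omega, h'.symm⟩
  · simp [h]

theorem mem_initialColumn {m : ℕ} {x : Fin (n + 1)} : x ∈ initialColumn n m ↔ x.val < m := by
  rw [List.mem_iff_getElem?]
  simp only [getElem?_initialColumn]
  constructor
  · rintro ⟨k, h, rfl⟩; exact h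
  · intro h; exact ⟨_, h, rfl⟩

theorem initialColumn_sorted (m : ℕ) : (initialColumn n m).SortedLT := by
  rw [List.sortedLT_iff_pairwise]
  exact (List.pairwise_lt_finRange (n + 1)).sublist (List.take_sublist _ _)

theorem SortedLT_add_le {l : List (Fin (n + 1))} (hl : l.SortedLT) {j k : ℕ} (hjk : j ≤ k)
    (hk : k < l.length) : l[j].val + (k - j) ≤ l[k].val := by
  rw [List.sortedLT_iff_pairwise, List.pairwise_iff_getElem] at hl
  induction k with
  | zero => obtain rfl : j = 0 := by omega
            simp
  | succ k ih =>
    rcases Nat.lt_or_ge k j with h | h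
    · obtain rfl : j = k + 1 := by omega
      simp
    · have h1 := ih h (by omega)
      have h2 := hl k (k + 1) (by omega) hk (by omega)
      rw [Fin.lt_def] at h2
      omega

/-- The entry in position k is at least k. If it were larger, its predecessor would lie in the
column, and there is no room: the earlier positions hold 0, …, k−1 and the later entries are too
large. -/
theorem eq_initialColumn {l : List (Fin (n + 1))} (hl : l.SortedLT)
    (h : ∀ i : Fin n, i.succ ∈ l → i.castSucc ∈ l) : l = initialColumn n l.length := by
  have key : ∀ (k : ℕ) (hk : k < l.length), l[k].val = k := by
    intro k
    induction k using Nat.strong_induction_on with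
    | _ k ih =>
      intro hk
      have h1 := SortedLT_add_le hl (Nat.zero_le k) hk
      by_contra hne
      have h2 : l[k].val ≠ 0 := by omega
      obtain ⟨i, hi⟩ := Fin.exists_succ_eq.2 (show l[k] ≠ 0 from fun h0 => h2 (by simp [h0]))
      have h3 := h i (hi ▸ List.getElem_mem hk)
      obtain ⟨m, hm, hmi⟩ := List.getElem_of_mem h3
      have h4 := congrArg Fin.val hi
      have h5 := congrArg Fin.val hmi
      simp only [Fin.val_succ, Fin.val_castSucc] at h4 h5
      rcases Nat.lt_or_ge m k with h6 | h6
      · have := ih m h6 hm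
        omega
      · have := SortedLT_add_le hl h6 hm
        omega
  refine List.ext_getElem? fun k => ?_
  rcases Nat.lt_or_ge k l.length with hk | hk
  · rw [List.getElem?_eq_getElem hk]
    exact (getElem?_initialColumn.2 ⟨hk, key k hk⟩).symm
  · rw [List.getElem?_eq_none hk, initialColumn, List.getElem?_take, if_neg (by omega)]

theorem initialColumn_wt (i : Fin n) (m : ℕ) :
    tensorEps (vectorCrystal n) i (initialColumn n m) = 0 ∧
    tensorWt (vectorCrystal n) (initialColumn n m) i = if m = i.val + 1 then 1 else 0 := by
  have h1 := (column_stats i (initialColumn_sorted (n := n) m)).1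
  have h2 := (column_stats i (initialColumn_sorted (n := n) m)).2
  have h3 := tensorPhi_eq (vectorCrystal_regular n) i (initialColumn n m)
  simp only [mem_initialColumn, Fin.val_succ, Fin.val_castSucc] at h1 h2
  rw [if_neg (by omega)] at h1
  refine ⟨h1, ?_⟩
  have h4 : (i.val < m ∧ ¬ (i.val + 1 < m)) ↔ m = i.val + 1 := by omega
  simp only [h4] at h2
  omega

theorem highest_filling_stats (L : List ℕ) (i : Fin n) :
    (fillingCrystal n).eps i (L.map (initialColumn n)) = 0 ∧
    (fillingCrystal n).wt (L.map (initialColumn n)) i = L.count (i.val + 1) := by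
  induction L with
  | nil => simp
  | cons m L ih =>
    rw [List.map_cons, filling_eps_cons, filling_wt_cons, ih.1, ih.2, (initialColumn_wt i m).1,
      (initialColumn_wt i m).2, List.count_cons]
    refine ⟨by omega, ?_⟩
    simp only [beq_iff_eq]
    split_ifs <;> simp

/-- The columns to the right of the leftmost one form a highest weight filling T, so induction
applies to them. A leftmost column with i+1 but not i has ε_i = 1, which the weight of T must
absorb; hence T contains the column 1, …, i, which `hR` forbids. -/
theorem highest_filling_unique {R : List (Fin (n + 1)) → List (Fin (n + 1)) → Prop}
    (hR : ∀ (l : List (Fin (n + 1))) (i : Fin n), l.SortedLT → i.succ ∈ l → i.castSucc ∉ l →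
      ¬ R l (initialColumn n (i.val + 1))) {T : Filling n} (hT : ColumnStrict T)
    (hr : T.Pairwise R) (h : ∀ i, (fillingCrystal n).eps i T = 0) :
    T = (T.map List.length).map (initialColumn n) := by
  induction T with
  | nil => rfl
  | cons l T ih =>
    simp only [ColumnStrict, List.forall_mem_cons] at hT
    rw [List.pairwise_cons] at hr
    have h1 : ∀ i, (fillingCrystal n).eps i T = 0 := by
      intro i
      have h1 := h i
      have h2 := (fillingCrystal_regular (n := n)).eps_nonneg i T
      rw [filling_eps_cons] at h1
      omega
    have h2 := ih hT.2 hr.2 h1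
    rw [List.map_cons, List.map_cons, ← h2, ← eq_initialColumn hT.1]
    intro i hi
    by_contra hi'
    have h3 := h i
    have h4 := (highest_filling_stats (T.map List.length) i).2
    rw [← h2] at h4
    rw [filling_eps_cons, (column_stats i hT.1).1, if_pos ⟨hi, hi'⟩, h4] at h3
    have h5 : i.val + 1 ∈ T.map List.length := List.count_pos_iff.1 (by omega)
    have h6 : initialColumn n (i.val + 1) ∈ T := by
      rw [h2]; exact List.mem_map_of_mem h5
    exact hR l i hT.1 hi hi' (hr.1 _ h6)

theorem exists_filling_measure : ∃ m : Filling n → ℕ, ∀ i T T',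
    (fillingCrystal n).e i T = some T' → m T' < m T := by
  -- The statistic is the sum of all entries: e_i replaces one letter i+1 by i.
  refine ⟨fun T => (T.map fun l => (l.map Fin.val).sum).sum, fun i T T' h => ?_⟩
  obtain ⟨w, hw, rfl⟩ := Option.map_eq_some_iff.1 h
  have := tensorE_measure (m := fun l : List (Fin (n + 1)) => (l.map Fin.val).sum)
    (fun i l l' h => tensorE_measure (m := Fin.val) (fun i b b' hb => by
      simp only [vectorCrystal, Option.ite_none_right_eq_some, Option.some.injEq] at hb
      obtain ⟨rfl, rfl⟩ := hb
      simp) i l l' h) i T.reverse w hw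
  simpa [List.map_reverse, List.sum_reverse] using this

theorem StableRel.isGeneratedBy {R : List (Fin (n + 1)) → List (Fin (n + 1)) → Prop}
    (hs : StableRel R)
    (hR : ∀ (l : List (Fin (n + 1))) (i : Fin n), l.SortedLT → i.succ ∈ l → i.castSucc ∉ l →
      ¬ R l (initialColumn n (i.val + 1))) {L : List ℕ} (hL : ∀ m ∈ L, m ≤ n + 1)
    (hLR : L.Pairwise fun m m' => R (initialColumn n m) (initialColumn n m')) :
    (fillingCrystal n).IsGeneratedBy (fillingsWith R L) (L.map (initialColumn n)) where
  stable := hs.stable L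
  mem := by
    refine ⟨?_, ?_, List.pairwise_map.2 hLR⟩
    · rw [List.map_map, List.map_congr_left (f := List.length ∘ initialColumn n) (g := id) fun m hm => length_initialColumn (hL m hm),
        List.map_id]
    · intro l hl
      obtain ⟨m, -, rfl⟩ := List.mem_map.1 hl
      exact initialColumn_sorted m
  eps_eq_zero i := (highest_filling_stats L i).1
  unique T hT h := by
    rw [← hT.1]
    exact highest_filling_unique hR hT.2.1 hT.2.2 h
  exists_measure := exists_filling_measure

/-- The bottom entry of the left column is at least i+1, while that of 1, …, i is i. -/
theorem rowsFromBottom_initialColumn (l : List (Fin (n + 1))) (i : Fin n) (hl : l.SortedLT)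
    (hi : i.succ ∈ l) (_ : i.castSucc ∉ l) : ¬ RowsFromBottom l (initialColumn n (i.val + 1)) := by
  rintro ⟨-, h⟩
  obtain ⟨k, hk, hki⟩ := List.getElem_of_mem hi
  have h1 := SortedLT_add_le hl (show k ≤ l.length - 1 by omega) (by omega)
  have h2 : l.reverse[0]? = some (l[l.length - 1]'(by omega)) := by
    rw [List.getElem?_reverse (by omega), List.getElem?_eq_getElem (by omega)]
    simp
  have hlen := length_initialColumn (n := n) (m := i.val + 1) (by omega)
  have h3 : (initialColumn n (i.val + 1)).reverse[0]? = some i.castSucc := by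
    rw [List.getElem?_reverse (by omega), hlen, getElem?_initialColumn]
    simp
  have h4 := h 0 _ _ h2 h3
  rw [hki] at h1
  simp only [Fin.le_def, Fin.val_succ, Fin.val_castSucc] at h1 h4
  omega

/-- If i+1 lies below the i-th row, strictness forces the column to begin with 1, …, i+1, so it
contains i. Otherwise i+1 stands in a row where 1, …, i has an entry ≤ i. -/
theorem rowsFromTop_initialColumn (l : List (Fin (n + 1))) (i : Fin n) (hl : l.SortedLT)
    (hi : i.succ ∈ l) (hi' : i.castSucc ∉ l) :
    ¬ RowsFromTop l (initialColumn n (i.val + 1)) := by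
  rintro ⟨-, h⟩
  obtain ⟨k, hk, hki⟩ := List.getElem_of_mem hi
  have h0 := congrArg Fin.val hki
  rw [Fin.val_succ] at h0
  rcases Nat.lt_or_ge i.val k with h1 | h1
  · have h2 := SortedLT_add_le hl h1.le hk
    have h3 := SortedLT_add_le hl (Nat.zero_le i.val) (by omega)
    refine hi' (List.mem_of_getElem (i := i.val) (h := by omega) (Fin.ext ?_))
    rw [Fin.val_castSucc]
    omega
  · have h2 := h k i.succ ⟨k, by omega⟩ (List.getElem?_eq_some_iff.2 ⟨hk, hki⟩)
      (getElem?_initialColumn.2 ⟨by omega, rfl⟩)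
    simp only [Fin.le_def, Fin.val_succ] at h2
    omega

theorem rowsFromTop_initialColumns {m m' : ℕ} (h : m' ≤ m) (hm : m ≤ n + 1) :
    RowsFromTop (initialColumn n m) (initialColumn n m') := by
  refine ⟨by rw [length_initialColumn hm, length_initialColumn (h.trans hm)]; exact h, ?_⟩
  intro k x y hx hy
  rw [getElem?_initialColumn] at hx hy
  rw [Fin.le_def]; omega

theorem rowsFromBottom_initialColumns {m m' : ℕ} (h : m ≤ m') (hm : m' ≤ n + 1) :
    RowsFromBottom (initialColumn n m) (initialColumn n m') := by
  have h1 := length_initialColumn (n := n) (h.trans hm)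
  have h2 := length_initialColumn (n := n) hm
  refine ⟨by omega, ?_⟩
  intro k x y hx hy
  have h3 := (List.getElem?_eq_some_iff.1 hx).1
  have h4 := (List.getElem?_eq_some_iff.1 hy).1
  rw [List.length_reverse] at h3 h4
  rw [List.getElem?_reverse h3, getElem?_initialColumn] at hx
  rw [List.getElem?_reverse h4, getElem?_initialColumn] at hy
  rw [Fin.le_def]; omega

/-- A letter already present in a column bumps itself, so it travels unchanged past all of these
columns. -/
theorem insertLetter_initialColumns {x : Fin (n + 1)} {L : List ℕ} (hL : ∀ m ∈ L, x.val < m)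
    (T : Filling n) : insertLetter x (L.map (initialColumn n) ++ T) =
      L.map (initialColumn n) ++ insertLetter x T := by
  induction L with
  | nil => rfl
  | cons m L ih =>
    rw [List.forall_mem_cons] at hL
    have h := bump_self (initialColumn_sorted (n := n) m) (mem_initialColumn.2 hL.1)
    rw [List.map_cons, List.cons_append, insertLetter_of_some h, ih hL.2, List.cons_append]

theorem initialColumn_succ {m : ℕ} (hm : m < n + 1) :
    initialColumn n (m + 1) = initialColumn n m ++ [⟨m, hm⟩] := by
  rw [initialColumn, List.take_add_one, List.getElem?_eq_getElem (by simpa using hm)]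
  simp [initialColumn]

theorem foldl_insertLetter_initialColumn {m : ℕ} (hm : m ≤ n) {L : List ℕ}
    (hL : ∀ m' ∈ L, m + 1 ≤ m') : insertColumn (L.map (initialColumn n)) (initialColumn n (m + 1)) =
      (L ++ [m + 1]).map (initialColumn n) := by
  induction m with
  | zero =>
    have h := insertLetter_initialColumns (x := (0 : Fin (n + 1))) (L := L)
      (fun m hm => by have := hL m hm; simp; omega) []
    have h1 : initialColumn n 1 = [0] := by
      rw [initialColumn_succ (m := 0) (by omega), initialColumn, List.take_zero]; rfl
    simpa [insertColumn, h1, insertLetter] using h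
  | succ m ih =>
    have h1 := ih (by omega) fun m' hm' => (Nat.le_succ _).trans (hL m' hm')
    have h2 := insertLetter_initialColumns (x := (⟨m + 1, by omega⟩ : Fin (n + 1))) (L := L)
      (fun m hm => hL m hm) [initialColumn n (m + 1)]
    have h3 : bump (⟨m + 1, by omega⟩ : Fin (n + 1)) (initialColumn n (m + 1)) =
        (initialColumn n (m + 1) ++ [⟨m + 1, by omega⟩], none) :=
      bump_of_forall_lt fun y hy => Fin.lt_def.2 (mem_initialColumn.1 hy)
    rw [initialColumn_succ (by omega), insertColumn, List.foldl_append]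
    rw [insertColumn] at h1
    rw [h1, List.foldl_cons, List.foldl_nil, List.map_append, List.map_cons, List.map_nil, h2,
      insertLetter_of_none h3, ← initialColumn_succ, List.map_append]
    rfl

/-- From right to left the column lengths weakly decrease, so each inserted column passes through
the longer ones and is added at the right end. Thus highest weight goes to highest weight. -/
theorem columnInsertion_initialColumns {L : List ℕ} (hL : ∀ m ∈ L, 1 ≤ m ∧ m ≤ n + 1)
    (hs : L.Pairwise (· ≤ ·)) : columnInsertion (L.map (initialColumn n)) =
      L.reverse.map (initialColumn n) := by
  induction L with
  | nil => rfl
  | cons m L ih =>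
    rw [List.forall_mem_cons] at hL
    rw [List.pairwise_cons] at hs
    have h := ih hL.2 hs.2
    rw [columnInsertion] at h ⊢
    rw [List.map_cons, List.reverse_cons, List.foldl_append, h, List.foldl_cons, List.foldl_nil]
    obtain ⟨m, rfl⟩ : ∃ k, m = k + 1 := ⟨m - 1, by omega⟩
    rw [foldl_insertLetter_initialColumn (by omega)
      (fun m' hm' => hs.1 m' (List.mem_reverse.1 hm')), List.reverse_cons]

theorem reverseColLens_sorted (a : Fin n → ℕ) : (reverseColLens a).Pairwise (· ≤ ·) := by
  rw [reverseColLens, List.pairwise_flatMap]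
  refine ⟨fun k _ => List.pairwise_replicate.2 (Or.inr le_rfl), ?_⟩
  refine (List.pairwise_lt_finRange n).imp fun {k l} hkl x hx y hy => ?_
  rw [List.eq_of_mem_replicate hx, List.eq_of_mem_replicate hy]
  exact Nat.succ_le_succ hkl.le

theorem mem_reverseColLens {a : Fin n → ℕ} {m : ℕ} (h : m ∈ reverseColLens a) :
    1 ≤ m ∧ m ≤ n := by
  rw [reverseColLens, List.mem_flatMap] at h
  obtain ⟨k, -, hk⟩ := h
  rw [List.eq_of_mem_replicate hk]
  omega

/-- The length condition in `RowsFromBottom` is already contained in the prescribed column lengths.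
-/
theorem SSet_eq (a : Fin n → ℕ) : SSet a = fillingsWith RowsFromBottom (reverseColLens a) := by
  ext T
  refine and_congr_right fun h => and_congr_right fun _ => ⟨fun h' => ?_, fun h' => ?_⟩
  · have h1 := reverseColLens_sorted a
    rw [← h, List.pairwise_map] at h1
    exact (h1.and h').imp fun h => h
  · exact h'.imp fun h => h.2

theorem SSet_isGeneratedBy (a : Fin n → ℕ) : (fillingCrystal n).IsGeneratedBy (SSet a)
    ((reverseColLens a).map (initialColumn n)) := by
  rw [SSet_eq]
  refine rowsFromBottom_stable.isGeneratedBy rowsFromBottom_initialColumn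
    (fun m hm => (mem_reverseColLens hm).2.trans (Nat.le_succ n)) ?_
  refine (reverseColLens_sorted a).imp_of_mem fun {m m'} _ hm' h => ?_
  exact rowsFromBottom_initialColumns h ((mem_reverseColLens hm').2.trans (Nat.le_succ n))

theorem fillingsWith_rowsFromTop_isGeneratedBy (a : Fin n → ℕ) :
    (fillingCrystal n).IsGeneratedBy (fillingsWith RowsFromTop (reverseColLens a).reverse)
      ((reverseColLens a).reverse.map (initialColumn n)) := by
  refine rowsFromTop_stable.isGeneratedBy rowsFromTop_initialColumn
    (fun m hm => (mem_reverseColLens (List.mem_reverse.1 hm)).2.trans (Nat.le_succ n)) ?_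
  refine (List.pairwise_reverse.2 (reverseColLens_sorted a)).imp_of_mem fun {m m'} hm _ h => ?_
  exact rowsFromTop_initialColumns h
    ((mem_reverseColLens (List.mem_reverse.1 hm)).2.trans (Nat.le_succ n))

/-- The general principle makes the image a component; the same principle for ordinary tableaux
identifies that component. -/
theorem columnInsertion_isCrystalIso (a : Fin n → ℕ) :
    IsCrystalIso (fillingCrystal n) (fillingCrystal n) (SSet a)
      (fillingsWith RowsFromTop (reverseColLens a).reverse) columnInsertion := by
  have h := (SSet_isGeneratedBy a).isCrystalIso fillingCrystal_regular
    fillingCrystal_regular.toInvertible (F := columnInsertion)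
    (fun T _ i => (columnInsertion_spec T i).1) (fun T _ i => (columnInsertion_spec T i).2.1)
    (fun T _ i => (columnInsertion_spec T i).2.2)
  rwa [columnInsertion_initialColumns (fun m hm => ⟨(mem_reverseColLens hm).1,
      (mem_reverseColLens hm).2.trans (Nat.le_succ n)⟩) (reverseColLens_sorted a),
    ← (fillingsWith_rowsFromTop_isGeneratedBy a).eq_component fillingCrystal_regular] at h

end Highest

/-! ### Semistandard Young tableaux as fillings -/

section Young

variable {n : ℕ}

/-- Conjugation of partitions: column j reaches row i exactly if more than j columns are longer than
i. It translates between column lengths and the row lengths defining `shape`. -/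
theorem exists_getElem?_lt_iff {L : List ℕ} (hL : L.Pairwise (· ≥ ·)) (i j : ℕ) :
    (∃ m, L[j]? = some m ∧ i < m) ↔ j < L.countP (i < ·) := by
  induction L generalizing j with
  | nil => simp
  | cons x L ih =>
    rw [List.pairwise_cons] at hL
    rw [List.countP_cons]
    by_cases hx : i < x
    · rw [if_pos (by simpa using hx)]
      rcases j with _ | j
      · simp [hx]
      · rw [List.getElem?_cons_succ, ih hL.2]; omega
    · rw [if_neg (by simpa using hx), List.countP_eq_zero.2 fun y hy => by
        have := hL.1 y hy
        simp; omega]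
      simp only [add_zero, not_lt_zero, iff_false]
      rintro ⟨m, hm, him⟩
      rcases List.mem_cons.1 (List.mem_of_getElem? hm) with rfl | hm
      · exact hx him
      · exact hx (him.trans_le (hL.1 m hm))

theorem countP_reverseColLens (a : Fin n → ℕ) (i : ℕ) :
    (reverseColLens a).countP (i < ·) = ∑ k : Fin n, if i ≤ k.val then a k else 0 := by
  rw [reverseColLens, List.countP_flatMap, Fin.sum_univ_def]
  congr 1
  refine List.map_congr_left fun k _ => ?_
  simp [List.countP_replicate]

theorem mem_shape (a : Fin n → ℕ) (i j : ℕ) : (i, j) ∈ shape a ↔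
    ∃ m, (reverseColLens a).reverse[j]? = some m ∧ i < m := by
  rw [exists_getElem?_lt_iff (List.pairwise_reverse.2 (reverseColLens_sorted a)),
    List.countP_reverse, countP_reverseColLens, shape, YoungDiagram.mem_ofRowLens]
  simp only [List.length_ofFn, List.getElem_ofFn]
  have hIci : ∀ hi : i < n, Finset.Ici (⟨i, hi⟩ : Fin n) =
      Finset.univ.filter fun k : Fin n => i ≤ k.val := by
    intro hi; ext k; simp [Fin.le_def]
  constructor
  · rintro ⟨hi, h⟩
    rw [hIci, Finset.sum_filter] at h
    exact h
  · intro h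
    have hi : i < n := by
      by_contra hi
      rw [Finset.sum_eq_zero fun k _ => if_neg (by omega)] at h
      exact absurd h (Nat.not_lt_zero j)
    refine ⟨hi, ?_⟩
    rw [hIci, Finset.sum_filter]
    exact h

theorem colLen_shape {a : Fin n → ℕ} {j m : ℕ} (h : (reverseColLens a).reverse[j]? = some m) :
    (shape a).colLen j = m := by
  refine eq_of_forall_lt_iff fun i => ?_
  rw [← YoungDiagram.mem_iff_lt_colLen, mem_shape, h]
  simp

theorem rowLen_shape (a : Fin n → ℕ) : (shape a).rowLen 0 = (reverseColLens a).length := by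
  refine eq_of_forall_lt_iff fun j => ?_
  rw [← YoungDiagram.mem_iff_lt_rowLen, mem_shape]
  constructor
  · rintro ⟨m, hm, -⟩
    simpa using (List.getElem?_eq_some_iff.1 hm).1
  · intro hj
    have hj' : j < (reverseColLens a).reverse.length := by simpa using hj
    exact ⟨_, List.getElem?_eq_getElem hj',
      (mem_reverseColLens (List.mem_reverse.1 (List.getElem_mem hj'))).1⟩

/-- The entry of a filling in a given row and column, extended by `0`. -/
def fillingEntry (T : Filling n) (i j : ℕ) : ℕ := (((T[j]?.getD [])[i]?).map Fin.val).getD 0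

theorem fillingEntry_eq {T : Filling n} {l : List (Fin (n + 1))} {x : Fin (n + 1)} {i j : ℕ}
    (hl : T[j]? = some l) (hx : l[i]? = some x) : fillingEntry T i j = x.val := by
  simp [fillingEntry, hl, hx]

theorem exists_entry {a : Fin n → ℕ} {T : Filling n}
    (hT : T.map List.length = (reverseColLens a).reverse) {i j : ℕ} (h : (i, j) ∈ shape a) :
    ∃ l x, T[j]? = some l ∧ l[i]? = some x := by
  obtain ⟨m, hm, him⟩ := (mem_shape a i j).1 h
  rw [← hT, List.getElem?_map, Option.map_eq_some_iff] at hm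
  obtain ⟨l, hl, rfl⟩ := hm
  exact ⟨l, l[i], hl, List.getElem?_eq_getElem him⟩

theorem mem_fillingsWith_of_mem_TSet {a : Fin n → ℕ} {T : Filling n} (hT : T ∈ TSet a) :
    T ∈ fillingsWith RowsFromTop (reverseColLens a).reverse := by
  obtain ⟨Y, hY⟩ := hT
  have hlen : T.length = (reverseColLens a).reverse.length := by
    have := congrArg List.length hY
    simpa [columns, rowLen_shape] using this
  have hcol : ∀ (j : ℕ) (hj : j < T.length) (hj' : j < (reverseColLens a).reverse.length),
      T[j].map Fin.val = (List.range (reverseColLens a).reverse[j]).map fun i => Y i j := by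
    intro j hj hj'
    have := congrArg (fun l => l[j]?) hY
    have hjr : j < (shape a).rowLen 0 := by rw [rowLen_shape]; simpa using hj'
    simp only [columns, List.getElem?_map, List.getElem?_eq_getElem hj, List.getElem?_range hjr,
      Option.map_some, Option.some.injEq, colLen_shape (List.getElem?_eq_getElem hj')] at this
    exact this
  have hentry : ∀ (j : ℕ) (hj : j < T.length) (i : ℕ) (x : Fin (n + 1)), T[j][i]? = some x →
      (i, j) ∈ shape a ∧ Y i j = x.val := by
    intro j hj i x hx
    have h1 := congrArg (fun l => l[i]?) (hcol j hj (hlen ▸ hj))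
    simp only [List.getElem?_map, hx, Option.map_some] at h1
    obtain ⟨k, hk, h2⟩ := Option.map_eq_some_iff.1 h1.symm
    rw [List.getElem?_eq_some_iff] at hk
    obtain ⟨hk1, hk2⟩ := hk
    rw [List.getElem_range] at hk2
    subst hk2
    refine ⟨(mem_shape a _ j).2 ⟨_, List.getElem?_eq_getElem (hlen ▸ hj), by simpa using hk1⟩, h2⟩
  have hlens : T.map List.length = (reverseColLens a).reverse := by
    refine List.ext_getElem (by simpa using hlen) fun j h1 h2 => ?_
    have := congrArg List.length (hcol j (by simpa using h1) h2)
    simpa using this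
  refine ⟨hlens, ?_, ?_⟩
  · intro l hl
    obtain ⟨j, hj, rfl⟩ := List.getElem_of_mem hl
    rw [List.sortedLT_iff_pairwise, List.pairwise_iff_getElem]
    intro i i' hi hi' hii
    have h1 := hentry j hj i _ (List.getElem?_eq_getElem hi)
    have h2 := hentry j hj i' _ (List.getElem?_eq_getElem hi')
    rw [Fin.lt_def, ← h1.2, ← h2.2]
    exact Y.col_strict hii h2.1
  · rw [List.pairwise_iff_getElem]
    intro j j' hj hj' hjj
    constructor
    · have h1 := List.pairwise_iff_getElem.1 (List.pairwise_reverse.2 (reverseColLens_sorted a)) j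
        j' (hlen ▸ hj) (hlen ▸ hj') hjj
      simp only [← hlens, List.getElem_map] at h1
      exact h1
    · intro k x y hx hy
      have h1 := hentry j hj k x hx
      have h2 := hentry j' hj' k y hy
      rw [Fin.le_def, ← h1.2, ← h2.2]
      exact Y.row_weak hjj h2.1

theorem mem_TSet_of_mem_fillingsWith {a : Fin n → ℕ} {T : Filling n}
    (hT : T ∈ fillingsWith RowsFromTop (reverseColLens a).reverse) : T ∈ TSet a := by
  obtain ⟨h1, h2, h3⟩ := hT
  rw [List.pairwise_iff_getElem] at h3
  refine ⟨⟨fillingEntry T, ?_, ?_, ?_⟩, ?_⟩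
  · intro i j j' hjj hmem
    obtain ⟨r, y, hr, hy⟩ := exists_entry h1 hmem
    obtain ⟨l, x, hl, hx⟩ := exists_entry h1 ((shape a).up_left_mem le_rfl hjj.le hmem)
    rw [fillingEntry_eq hr hy, fillingEntry_eq hl hx]
    obtain ⟨hj, rfl⟩ := List.getElem?_eq_some_iff.1 hl
    obtain ⟨hj', rfl⟩ := List.getElem?_eq_some_iff.1 hr
    exact (h3 j j' hj hj' hjj).2 i x y hx hy
  · intro i i' j hii hmem
    obtain ⟨r, y, hr, hy⟩ := exists_entry h1 hmem
    obtain ⟨l, x, hl, hx⟩ := exists_entry h1 ((shape a).up_left_mem hii.le le_rfl hmem)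
    rw [fillingEntry_eq hr hy, fillingEntry_eq hl hx]
    rw [hl] at hr
    obtain rfl := Option.some.inj hr
    obtain ⟨hi, rfl⟩ := List.getElem?_eq_some_iff.1 hx
    obtain ⟨hi', rfl⟩ := List.getElem?_eq_some_iff.1 hy
    have := h2 l (List.mem_of_getElem? hl)
    rw [List.sortedLT_iff_pairwise, List.pairwise_iff_getElem] at this
    exact this i i' hi hi' hii
  -- Outside the diagram the entry must be the default 0.
  · intro i j hmem
    rw [fillingEntry]
    rcases hl : T[j]? with _ | l
    · simp
    · rcases hx : l[i]? with _ | x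
      · simp [hx]
      · refine absurd ((mem_shape a i j).2 ⟨l.length, ?_, (List.getElem?_eq_some_iff.1 hx).1⟩) hmem
        rw [← h1, List.getElem?_map, hl]; rfl
  · have hlen : T.length = (shape a).rowLen 0 := by
      have := congrArg List.length h1
      rw [rowLen_shape]
      simpa using this
    refine List.ext_getElem (by simpa [columns] using hlen) fun j hj hj' => ?_
    have hjT : j < T.length := by simpa using hj
    have hc : (shape a).colLen j = T[j].length := by
      refine colLen_shape ?_
      rw [← h1, List.getElem?_map, List.getElem?_eq_getElem hjT]; rfl
    simp only [columns, List.getElem_map, List.getElem_range]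
    refine List.ext_getElem (by simpa using hc.symm) fun i hi hi' => ?_
    simp only [List.getElem_map, List.getElem_range]
    exact (fillingEntry_eq (List.getElem?_eq_getElem hjT) (List.getElem?_eq_getElem _)).symm

theorem TSet_eq (a : Fin n → ℕ) :
    TSet a = fillingsWith RowsFromTop (reverseColLens a).reverse :=
  Set.Subset.antisymm (fun _ => mem_fillingsWith_of_mem_TSet) fun _ => mem_TSet_of_mem_fillingsWith

end Young

/-! ### The monomial crystal -/

section Monomials

variable {n : ℕ}

/-- `lowerSum` as a homomorphism. -/
noncomputable def lowerHom (i : Fin n) (t : ℤ) : Monomial n →+ ℤ where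
  toFun M := lowerSum i M t
  map_zero' := Finsupp.sum_zero_index
  map_add' M N := Finsupp.sum_add_index' (fun _ => by simp) (fun _ _ _ => by split_ifs <;> simp)

/-- `monomialWt` as a homomorphism. -/
noncomputable def wtHom (i : Fin n) : Monomial n →+ ℤ where
  toFun M := monomialWt M i
  map_zero' := Finsupp.sum_zero_index
  map_add' M N := Finsupp.sum_add_index' (fun _ => by simp) (fun _ _ _ => by split_ifs <;> simp)

theorem lowerHom_apply (i : Fin n) (t : ℤ) (M : Monomial n) : lowerHom i t M = lowerSum i M t := rfl

theorem wtHom_apply (i : Fin n) (M : Monomial n) : wtHom i M = monomialWt M i := rfl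

theorem lowerHom_Y (i j : Fin n) (m t : ℤ) :
    lowerHom i t (Y j m) = if j = i ∧ m ≤ t then 1 else 0 := by
  rw [lowerHom_apply, lowerSum, Y, Finsupp.sum_single_index (by simp)]

theorem wtHom_Y (i j : Fin n) (m : ℤ) : wtHom i (Y j m) = if j = i then 1 else 0 := by
  rw [wtHom_apply, monomialWt, Y, Finsupp.sum_single_index (by simp)]

theorem lowerHom_Ybd (i : Fin n) (k : ℕ) (m t : ℤ) :
    lowerHom i t (Ybd n k m) = if k = i.val + 1 ∧ m ≤ t then 1 else 0 := by
  rw [Ybd]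
  split_ifs with h1 h2 h2
  · rw [lowerHom_Y, if_pos]
    exact ⟨Fin.ext (by simp [h2.1]), h2.2⟩
  · rw [lowerHom_Y, if_neg]
    rintro ⟨rfl, h3⟩
    exact h2 ⟨by dsimp only; omega, h3⟩
  · omega
  · exact map_zero _

theorem wtHom_Ybd (i : Fin n) (k : ℕ) (m : ℤ) :
    wtHom i (Ybd n k m) = if k = i.val + 1 then 1 else 0 := by
  rw [Ybd]
  split_ifs with h1 h2 h2
  · rw [wtHom_Y, if_pos]
    exact Fin.ext (by simp [h2])
  · rw [wtHom_Y, if_neg]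
    rintro rfl
    exact h2 (by dsimp only; omega)
  · omega
  · exact map_zero _

theorem lowerHom_X (i : Fin n) (x : Fin (n + 1)) (m t : ℤ) : lowerHom i t (X x m) =
    (if x = i.castSucc ∧ m ≤ t then 1 else 0) - if x = i.succ ∧ m + 1 ≤ t then 1 else 0 := by
  rw [X, map_add, map_neg, lowerHom_Ybd, lowerHom_Ybd]
  simp only [Fin.ext_iff, Fin.val_castSucc, Fin.val_succ, Nat.add_right_cancel_iff]
  ring

theorem wtHom_X (i : Fin n) (x : Fin (n + 1)) (m : ℤ) :
    wtHom i (X x m) = (vectorCrystal n).wt x i := by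
  rw [X, map_add, map_neg, wtHom_Ybd, wtHom_Ybd]
  simp only [vectorCrystal, Fin.ext_iff, Fin.val_castSucc, Fin.val_succ, Nat.add_right_cancel_iff]
  ring

theorem lowerHom_A (i : Fin n) (m t : ℤ) : lowerHom i t (A i m) =
    (if m ≤ t then 1 else 0) + if m + 1 ≤ t then 1 else 0 := by
  rw [A, map_add, map_add, map_sum, lowerHom_Y, lowerHom_Y, Finset.sum_eq_zero]
  · simp
  · intro j hj
    rw [map_zsmul, lowerHom_Y, if_neg (fun h => (Finset.mem_filter.1 hj).2 h.1), smul_zero]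

theorem wtHom_A (i : Fin n) (m : ℤ) : wtHom i (A i m) = 2 := by
  rw [A, map_add, map_add, map_sum, wtHom_Y, wtHom_Y, Finset.sum_eq_zero]
  · simp
  · intro j hj
    rw [map_zsmul, wtHom_Y, if_neg (Finset.mem_filter.1 hj).2, smul_zero]

theorem Y_apply (i j : Fin n) (m k : ℤ) : Y i m (j, k) = if i = j ∧ m = k then 1 else 0 := by
  rw [Y, Finsupp.single_apply]
  simp [Prod.ext_iff]

theorem Ybd_apply (k : ℕ) (m : ℤ) (j : Fin n) (t : ℤ) :
    Ybd n k m (j, t) = if k = j.val + 1 ∧ m = t then 1 else 0 := by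
  rw [Ybd]
  split_ifs with h1 h2 h2
  · rw [Y_apply, if_pos]
    exact ⟨Fin.ext (by simp [h2.1]), h2.2⟩
  · rw [Y_apply, if_neg]
    rintro ⟨rfl, h3⟩
    exact h2 ⟨by dsimp only; omega, h3⟩
  · omega
  · rfl

theorem X_apply (x : Fin (n + 1)) (m : ℤ) (j : Fin n) (t : ℤ) : X x m (j, t) =
    (if x = j.castSucc ∧ m = t then 1 else 0) - if x = j.succ ∧ m + 1 = t then 1 else 0 := by
  rw [X, Finsupp.add_apply, Finsupp.neg_apply, Ybd_apply, Ybd_apply]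
  simp only [Fin.ext_iff, Fin.val_castSucc, Fin.val_succ, Nat.add_right_cancel_iff]
  ring

/-- This is why f_i on monomials changes a letter i of row m into i+1. -/
theorem A_eq (i : Fin n) (m : ℤ) : A i m = X i.castSucc m - X i.succ m := by
  ext ⟨j, t⟩
  rw [A, Finsupp.sub_apply, X_apply, X_apply, Finsupp.add_apply, Finsupp.add_apply,
    Finsupp.finsetSum_apply, Y_apply, Y_apply]
  simp only [Finsupp.smul_apply, Y_apply]
  by_cases hj : j = i
  · subst hj
    rw [Finset.sum_eq_zero]
    · have := castSucc_ne_succ j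
      simp [this, this.symm]
    · intro k hk
      rw [if_neg (fun h => (Finset.mem_filter.1 hk).2 h.1), smul_zero]
  · rw [Finset.sum_eq_single j]
    · simp only [CartanMatrix.A, Matrix.of_apply, c, smul_eq_mul,
        Fin.ext_iff, Fin.lt_def, Fin.val_castSucc, Fin.val_succ, true_and]
      have : j.val ≠ i.val := fun h => hj (Fin.ext h)
      grind
    · intro k _ hk
      rw [if_neg (fun h => hk h.1), smul_zero]
    · intro h
      exact absurd (Finset.mem_filter.2 ⟨Finset.mem_univ j, hj⟩) h

theorem lowerSum_add_upperSum (i : Fin n) (M : Monomial n) (t : ℤ) :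
    lowerSum i M t + upperSum i M t = monomialWt M i := by
  rw [lowerSum, upperSum, monomialWt, ← Finsupp.sum_add]
  refine Finsupp.sum_congr fun p _ => ?_
  by_cases h1 : p.1 = i <;> by_cases h2 : p.2 ≤ t <;> simp [h1, h2, not_le.1, not_lt.2]

/-- Only finitely many subsets of the support can be summed, so the supremum defining φ_i is an
attained maximum. -/
theorem lowerSum_finite_range (i : Fin n) (M : Monomial n) :
    (Set.range (lowerSum i M)).Finite := by
  refine (((M.support.powerset).image fun s => ∑ p ∈ s, M p).finite_toSet).subset ?_
  rintro _ ⟨t, rfl⟩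
  refine Finset.mem_coe.2 (Finset.mem_image.2
    ⟨M.support.filter fun p => p.1 = i ∧ p.2 ≤ t, by simp, ?_⟩)
  rw [Finset.sum_filter]; rfl

theorem exists_lowerSum_eq_zero (i : Fin n) (M : Monomial n) :
    ∃ t₀, ∀ t, t ≤ t₀ → lowerSum i M t = 0 := by
  obtain ⟨t₀, h⟩ := (M.support.image Prod.snd).bddBelow
  refine ⟨t₀ - 1, fun t ht => Finset.sum_eq_zero fun p hp => if_neg ?_⟩
  have := h (Finset.mem_coe.2 (Finset.mem_image_of_mem _ hp))
  omega

theorem exists_upperSum_eq_zero (i : Fin n) (M : Monomial n) : ∃ t, upperSum i M t = 0 := by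
  obtain ⟨t₀, h⟩ := (M.support.image Prod.snd).bddAbove
  refine ⟨t₀, Finset.sum_eq_zero fun p hp => if_neg ?_⟩
  have := h (Finset.mem_coe.2 (Finset.mem_image_of_mem _ hp))
  omega

theorem monomialPhi_eq_of {i : Fin n} {M : Monomial n} {t : ℤ}
    (h : ∀ t', lowerSum i M t' ≤ lowerSum i M t) : monomialPhi i M = lowerSum i M t :=
  IsGreatest.csSup_eq ⟨⟨t, rfl⟩, by rintro _ ⟨t', rfl⟩; exact h t'⟩

theorem exists_monomialPhi (i : Fin n) (M : Monomial n) :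
    ∃ t, monomialPhi i M = lowerSum i M t ∧ ∀ t', lowerSum i M t' ≤ lowerSum i M t := by
  obtain ⟨_, ⟨t, rfl⟩, h⟩ := Set.exists_max_image _ id (lowerSum_finite_range i M) ⟨_, ⟨0, rfl⟩⟩
  have h' : ∀ t', lowerSum i M t' ≤ lowerSum i M t := fun t' => h _ ⟨t', rfl⟩
  exact ⟨t, monomialPhi_eq_of h', h'⟩

theorem lowerSum_le_monomialPhi (i : Fin n) (M : Monomial n) (t : ℤ) :
    lowerSum i M t ≤ monomialPhi i M := by
  obtain ⟨t', h1, h2⟩ := exists_monomialPhi i M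
  rw [h1]; exact h2 t

/-- Lower and upper sums add up to the weight, so maximising the lower sum and maximising minus the
upper sum are the same problem. -/
theorem monomialEps_eq (i : Fin n) (M : Monomial n) :
    monomialEps i M = monomialPhi i M - monomialWt M i := by
  obtain ⟨t, h1, h2⟩ := exists_monomialPhi i M
  rw [h1]
  have h3 := fun t => lowerSum_add_upperSum i M t
  refine IsGreatest.csSup_eq ⟨⟨t, ?_⟩, ?_⟩
  · have := h3 t
    dsimp only; omega
  · rintro _ ⟨t', rfl⟩
    have h4 := h3 t'
    have h5 := h2 t'
    dsimp only; omega

theorem monomialEps_nonneg (i : Fin n) (M : Monomial n) : 0 ≤ monomialEps i M := by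
  obtain ⟨t, ht⟩ := exists_upperSum_eq_zero i M
  have h1 := lowerSum_add_upperSum i M t
  have h2 := lowerSum_le_monomialPhi i M t
  rw [monomialEps_eq]
  omega

/-- The partial sums vanish far to the left. Hence φ_i ≠ 0 bounds the set of maximisers below, and
the infimum is a minimum. -/
theorem nf_spec {i : Fin n} {M : Monomial n} (h : monomialPhi i M ≠ 0) :
    lowerSum i M (nf i M) = monomialPhi i M ∧
      ∀ t, t < nf i M → lowerSum i M t < monomialPhi i M := by
  obtain ⟨t₀, h₀⟩ := exists_lowerSum_eq_zero i M
  obtain ⟨t, ht, -⟩ := exists_monomialPhi i M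
  have hb : BddBelow {m : ℤ | monomialPhi i M = lowerSum i M m} := by
    refine ⟨t₀, fun m hm => ?_⟩
    by_contra h'
    exact h (Eq.trans hm (h₀ m (not_le.1 h').le))
  refine ⟨(Int.csInf_mem ⟨t, ht⟩ hb).symm, fun m hm => ?_⟩
  refine lt_of_le_of_ne (lowerSum_le_monomialPhi i M m) fun h' => ?_
  exact absurd (csInf_le hb (show m ∈ {m : ℤ | monomialPhi i M = lowerSum i M m} from h'.symm))
    (not_le.2 hm)

theorem monomialCrystal_invertible : (monomialCrystal n).Invertible where
  phi_eq i M := by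
    change monomialPhi i M = monomialEps i M + monomialWt M i
    rw [monomialEps_eq]; ring
  e_eq_none i M := by
    change (if monomialEps i M = 0 then none else some _) = none ↔ monomialEps i M = 0
    simp
  e_of_f i M M' h := by
    change (if monomialPhi i M = 0 then none else some (-A i (nf i M) + M)) = some M' at h
    change (if monomialEps i M' = 0 then none else some (A i (ne i M') + M')) = some M
    split_ifs at h with hphi
    obtain rfl := Option.some.inj h
    obtain ⟨h1, h2⟩ := nf_spec hphi
    -- Multiplication by A_i(n_f)⁻¹ lowers the partial sums by 1 at n_f and by 2 beyond it. Before
    -- n_f they were at most φ_i − 1, so n_f becomes the last place where the new maximum φ_i − 1 is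
    -- attained, and e_i undoes f_i.
    have hL : ∀ t, lowerSum i (-A i (nf i M) + M) t = lowerSum i M t -
        ((if nf i M ≤ t then 1 else 0) + if nf i M + 1 ≤ t then 1 else 0) := by
      intro t
      rw [← lowerHom_apply, map_add, map_neg, lowerHom_A, lowerHom_apply]; ring
    have hle := lowerSum_le_monomialPhi i M
    have hphi' : monomialPhi i (-A i (nf i M) + M) = monomialPhi i M - 1 := by
      rw [monomialPhi_eq_of (t := nf i M), hL, h1, if_pos le_rfl, if_neg (by omega)]
      · ring
      · intro t
        rw [hL, hL, h1]
        have h3 := h2 t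
        have h4 := hle t
        split_ifs <;> omega
    have hwt : monomialWt (-A i (nf i M) + M) i = monomialWt M i - 2 := by
      rw [← wtHom_apply, map_add, map_neg, wtHom_A, wtHom_apply]; ring
    have heps := monomialEps_eq i (-A i (nf i M) + M)
    have heps' := monomialEps_eq i M
    have hnn := monomialEps_nonneg i M
    rw [if_neg (by omega)]
    have hne : ne i (-A i (nf i M) + M) = nf i M := by
      refine IsGreatest.csSup_eq ⟨?_, ?_⟩
      · change _ = _
        rw [hphi', hL, h1, if_pos le_rfl, if_neg (by omega)]; ring
      · intro t ht
        change _ = _ at ht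
        rw [hphi', hL] at ht
        have h4 := hle t
        by_contra h5
        rw [if_pos (by omega), if_pos (by omega)] at ht
        omega
    rw [hne, add_neg_cancel_left]

end Monomials

/-! ### The monomial of a reverse tableau -/

section Boxes

variable {n : ℕ}

/-- The product of the `X_x(j)` over the boxes of a column, with entry `x` in the `(j+1)`-st row
from the bottom. -/
noncomputable def columnMonomial : List (Fin (n + 1)) → Monomial n
  | [] => 0
  | x :: l => X x (l.length : ℤ) + columnMonomial l

/-- The product of the `X_x(j)` over the boxes of a filling aligned at the bottom. -/
noncomputable def fillingMonomial (T : Filling n) : Monomial n := (T.map columnMonomial).sum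

@[simp] theorem fillingMonomial_nil : fillingMonomial ([] : Filling n) = 0 := rfl

@[simp] theorem fillingMonomial_cons (l : List (Fin (n + 1))) (T : Filling n) :
    fillingMonomial (l :: T) = columnMonomial l + fillingMonomial T := by simp [fillingMonomial]

theorem wtHom_columnMonomial (i : Fin n) (l : List (Fin (n + 1))) :
    wtHom i (columnMonomial l) = tensorWt (vectorCrystal n) l i := by
  induction l with
  | nil => simp [columnMonomial]
  | cons x l ih => rw [columnMonomial, map_add, wtHom_X, ih, tensorWt_cons]

theorem wtHom_fillingMonomial (i : Fin n) (T : Filling n) :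
    wtHom i (fillingMonomial T) = (fillingCrystal n).wt T i := by
  induction T with
  | nil => simp
  | cons l T ih => rw [fillingMonomial_cons, map_add, ih, wtHom_columnMonomial, filling_wt_cons,
      add_comm]

theorem columnMonomial_replace (u v : List (Fin (n + 1))) (x y : Fin (n + 1)) :
    columnMonomial (u ++ y :: v) =
      columnMonomial (u ++ x :: v) - X x (v.length : ℤ) + X y (v.length : ℤ) := by
  induction u with
  | nil => simp only [List.nil_append, columnMonomial]; abel
  | cons z u ih =>
    simp only [List.cons_append, columnMonomial, ih, List.length_append, List.length_cons]
    abel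

theorem lowerHom_columnMonomial_append (i : Fin n) (t : ℤ) {u : List (Fin (n + 1))}
    (v : List (Fin (n + 1))) (hu : ∀ x ∈ u, x ≠ i.castSucc ∧ x ≠ i.succ) :
    lowerHom i t (columnMonomial (u ++ v)) = lowerHom i t (columnMonomial v) := by
  induction u with
  | nil => rfl
  | cons z u ih =>
    rw [List.forall_mem_cons] at hu
    rw [List.cons_append, columnMonomial, map_add, lowerHom_X, ih hu.2, if_neg (fun h => hu.1.1 h.1),
      if_neg (fun h => hu.1.2 h.1)]
    ring

theorem lowerHom_columnMonomial_eq_zero (i : Fin n) (t : ℤ) {u : List (Fin (n + 1))}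
    (hu : ∀ x ∈ u, x ≠ i.castSucc ∧ x ≠ i.succ) : lowerHom i t (columnMonomial u) = 0 := by
  have := lowerHom_columnMonomial_append i t [] hu
  rw [List.append_nil] at this
  rw [this, columnMonomial, map_zero]

/-- The contribution of a strictly increasing column to the partial sums for `i`. -/
theorem column_cases (i : Fin n) {l : List (Fin (n + 1))} (hl : l.SortedLT) :
    (tensorPhi (vectorCrystal n) i l = 0 ∧ tensorEps (vectorCrystal n) i l = 0 ∧
      ∀ t, lowerHom i t (columnMonomial l) = 0) ∨
    (∃ u v, l = u ++ i.castSucc :: v ∧ (∀ x ∈ v, i.succ < x) ∧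
      tensorPhi (vectorCrystal n) i l = 1 ∧ tensorEps (vectorCrystal n) i l = 0 ∧
      tensorF (vectorCrystal n) i l = some (u ++ i.succ :: v) ∧
      ∀ t, lowerHom i t (columnMonomial l) = if (v.length : ℤ) ≤ t then 1 else 0) ∨
    (∃ u v, l = u ++ i.succ :: v ∧ (∀ x ∈ v, i.succ < x) ∧
      tensorPhi (vectorCrystal n) i l = 0 ∧ tensorEps (vectorCrystal n) i l = 1 ∧
      ∀ t, lowerHom i t (columnMonomial l) = if (v.length : ℤ) + 1 ≤ t then -1 else 0) := by
  obtain ⟨h1, h2⟩ := column_stats i hl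
  have hne := castSucc_ne_succ i
  have hlt : i.castSucc < i.succ := Fin.castSucc_lt_succ
  have hp := List.sortedLT_iff_pairwise.1 hl
  by_cases hi : i.castSucc ∈ l
  · obtain ⟨u, v, rfl⟩ := List.append_of_mem hi
    rw [List.pairwise_append, List.pairwise_cons] at hp
    have hu : ∀ x ∈ u, x ≠ i.castSucc ∧ x ≠ i.succ := fun x hx => by
      have := hp.2.2 x hx i.castSucc (by simp)
      exact ⟨this.ne, (this.trans hlt).ne⟩
    by_cases hs : i.succ ∈ u ++ i.castSucc :: v
    · left
      rw [if_neg (by tauto)] at h1 h2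
      refine ⟨h2, h1, fun t => ?_⟩
      have hs' : i.succ ∈ v := by
        rcases List.mem_append.1 hs with h | h
        · exact absurd rfl (hu _ h).2
        · exact (List.mem_cons.1 h).resolve_left hne.symm
      obtain ⟨w, v, rfl⟩ := List.append_of_mem hs'
      -- No letter lies strictly between i and i+1, so they occupy adjacent rows m+1 and m. The +1
      -- of X_i(m+1) and the −1 of X_{i+1}(m) both start at m+1 and cancel.
      have hw : w = [] := by
        rw [List.eq_nil_iff_forall_not_mem]
        intro z hz
        have h3 := hp.2.1.2
        rw [List.pairwise_append] at h3
        exact not_between i z (hp.2.1.1 z (by simp [hz])) (h3.2.2 z hz _ (by simp))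
      subst hw
      have hv : ∀ x ∈ v, x ≠ i.castSucc ∧ x ≠ i.succ := fun x hx => by
        have h3 := hp.2.1.2
        rw [List.nil_append, List.pairwise_cons] at h3
        exact ⟨(hlt.trans (h3.1 x hx)).ne', (h3.1 x hx).ne'⟩
      rw [lowerHom_columnMonomial_append i t _ hu, List.nil_append, columnMonomial, columnMonomial,
        map_add, map_add, lowerHom_columnMonomial_eq_zero i t hv, lowerHom_X, lowerHom_X]
      simp [hne, hne.symm]
    · right; left
      rw [if_pos ⟨hi, hs⟩] at h2
      rw [if_neg (by tauto)] at h1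
      have hv : ∀ x ∈ v, i.succ < x := fun x hx => by
        have h3 := not_between i x (hp.2.1.1 x hx)
        refine lt_of_le_of_ne (not_lt.1 h3) ?_
        rintro rfl
        exact hs (by simp [hx])
      have hv' : ∀ x ∈ v, x ≠ i.castSucc ∧ x ≠ i.succ := fun x hx =>
        ⟨(hlt.trans (hv x hx)).ne', (hv x hx).ne'⟩
      refine ⟨u, v, rfl, hv, h2, h1, ?_, fun t => ?_⟩
      · rw [tensorF_eq_map hl hi hs, List.map_append, List.map_cons,
          map_raiseLetter fun h => (hu _ h).1 rfl, map_raiseLetter fun h => (hv' _ h).1 rfl]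
        simp [raiseLetter]
      · rw [lowerHom_columnMonomial_append i t _ hu, columnMonomial,
          map_add, lowerHom_columnMonomial_eq_zero i t hv', lowerHom_X]
        simp [hne]
  · rw [if_neg (by tauto)] at h2
    by_cases hs : i.succ ∈ l
    · right; right
      rw [if_pos ⟨hs, hi⟩] at h1
      obtain ⟨u, v, rfl⟩ := List.append_of_mem hs
      rw [List.pairwise_append, List.pairwise_cons] at hp
      have hu : ∀ x ∈ u, x ≠ i.castSucc ∧ x ≠ i.succ := fun x hx =>
        ⟨by rintro rfl; exact hi (by simp [hx]), (hp.2.2 x hx i.succ (by simp)).ne⟩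
      have hv : ∀ x ∈ v, x ≠ i.castSucc ∧ x ≠ i.succ := fun x hx =>
        ⟨(hlt.trans (hp.2.1.1 x hx)).ne', (hp.2.1.1 x hx).ne'⟩
      refine ⟨u, v, rfl, hp.2.1.1, h2, h1, fun t => ?_⟩
      rw [lowerHom_columnMonomial_append i t _ hu, columnMonomial,
        map_add, lowerHom_columnMonomial_eq_zero i t hv, lowerHom_X]
      simp only [hne.symm, false_and, if_false, true_and]
      split_ifs <;> rfl
    · left
      rw [if_neg (by tauto)] at h1
      exact ⟨h2, h1, fun t => lowerHom_columnMonomial_eq_zero i t fun x hx =>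
        ⟨by rintro rfl; exact hi hx, by rintro rfl; exact hs hx⟩⟩

/-- With only letters > i+1 below row r, the first possible contribution is +1 at r from X_i(r); an
i+1 in row r acts only from r+1 on. -/
theorem lowerHom_columnMonomial_below (i : Fin n) {r : ℕ} {l : List (Fin (n + 1))}
    (h : ∀ k < r, ∀ y, l.reverse[k]? = some y → i.succ < y) :
    (∀ t < (r : ℤ), lowerHom i t (columnMonomial l) = 0) ∧
    0 ≤ lowerHom i r (columnMonomial l) ∧
    ((∀ y, l.reverse[r]? = some y → y ≠ i.castSucc) → lowerHom i r (columnMonomial l) = 0) := by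
  induction l with
  | nil => simp [columnMonomial]
  | cons x l ih =>
    have hx : (x :: l).reverse[l.length]? = some x := by simp
    have hlt : i.castSucc < i.succ := Fin.castSucc_lt_succ
    have hrev : ∀ (k : ℕ) y, l.reverse[k]? = some y → (x :: l).reverse[k]? = some y := by
      intro k y hk
      rw [List.reverse_cons, List.getElem?_append_left (List.getElem?_eq_some_iff.1 hk).1, hk]
    obtain ⟨h1, h2, h3⟩ := ih fun k hk y hy => h k hk y (hrev k y hy)
    simp only [columnMonomial, map_add, lowerHom_X]
    refine ⟨fun t ht => ?_, ?_, fun h' => ?_⟩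
    · rw [h1 t ht]
      by_cases hr : (l.length : ℤ) ≤ t
      · have := h l.length (by omega) x hx
        rw [if_neg (fun h => (hlt.trans this).ne' h.1), if_neg (fun h => this.ne' h.1)]; rfl
      · rw [if_neg (fun h => hr h.2), if_neg (fun h => hr (by omega))]; rfl
    · rw [if_neg (c := x = i.succ ∧ _)]
      · split_ifs <;> omega
      · rintro ⟨h4, h5⟩
        exact (h l.length (by omega) x hx).ne' h4
    · rw [h3 fun y hy => h' y (hrev r y hy), if_neg, if_neg]; · rfl
      · rintro ⟨h4, h5⟩
        exact (h l.length (by omega) x hx).ne' h4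
      · rintro ⟨h4, h5⟩
        rcases Nat.lt_or_ge l.length r with h6 | h6
        · exact (hlt.trans (h l.length h6 x hx)).ne' h4
        · obtain rfl : r = l.length := by omega
          exact h' x hx h4

theorem lowerHom_fillingMonomial_below (i : Fin n) {r : ℕ} {T : Filling n}
    (h : ∀ l ∈ T, ∀ k < r, ∀ y, l.reverse[k]? = some y → i.succ < y) :
    (∀ t < (r : ℤ), lowerHom i t (fillingMonomial T) = 0) ∧
    0 ≤ lowerHom i r (fillingMonomial T) ∧
    ((∀ l ∈ T, ∀ y, l.reverse[r]? = some y → y ≠ i.castSucc) →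
      lowerHom i r (fillingMonomial T) = 0) := by
  induction T with
  | nil => simp
  | cons l T ih =>
    rw [List.forall_mem_cons] at h
    obtain ⟨h1, h2, h3⟩ := ih h.2
    obtain ⟨h4, h5, h6⟩ := lowerHom_columnMonomial_below i h.1
    simp only [fillingMonomial_cons, map_add]
    refine ⟨fun t ht => by rw [h1 t ht, h4 t ht]; rfl, by omega, fun h7 => ?_⟩
    rw [List.forall_mem_cons] at h7
    rw [h3 h7.2, h6 h7.1]; rfl

theorem rowsFromBottom_below {u v d : List (Fin (n + 1))} {x₀ : Fin (n + 1)}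
    (h : RowsFromBottom (u ++ x₀ :: v) d) :
    (∀ b, (∀ x ∈ v, b < x) → ∀ k < v.length, ∀ y, d.reverse[k]? = some y → b < y) ∧
    ∀ y, d.reverse[v.length]? = some y → x₀ ≤ y := by
  have hrev : (u ++ x₀ :: v).reverse = v.reverse ++ x₀ :: u.reverse := by simp
  constructor
  · intro b hb k hk y hy
    have hk' : k < v.reverse.length := by simpa using hk
    have hx : (u ++ x₀ :: v).reverse[k]? = some v.reverse[k] := by
      rw [hrev, List.getElem?_append_left hk', List.getElem?_eq_getElem]
    exact (hb _ (List.mem_reverse.1 (List.getElem_mem hk'))).trans_le (h.2 k _ y hx hy)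
  · intro y hy
    refine h.2 v.length x₀ y ?_ hy
    rw [hrev, List.getElem?_append_right (by simp)]
    simp

/-- `φ_i` and `f_i` of a reverse tableau in terms of the partial sums of its monomial. -/
theorem fillingMonomial_f (i : Fin n) {T : Filling n} (hT : ColumnStrict T)
    (hr : T.Pairwise RowsFromBottom) :
    (∀ t, lowerHom i t (fillingMonomial T) ≤ (fillingCrystal n).phi i T) ∧
    (0 < (fillingCrystal n).phi i T → ∃ r, lowerHom i r (fillingMonomial T) =
      (fillingCrystal n).phi i T ∧
      (∀ t < r, lowerHom i t (fillingMonomial T) < (fillingCrystal n).phi i T) ∧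
      ∃ T', (fillingCrystal n).f i T = some T' ∧
        fillingMonomial T' = -A i r + fillingMonomial T) := by
  induction T with
  | nil => simp
  | cons l T ih =>
    simp only [ColumnStrict, List.forall_mem_cons] at hT
    rw [List.pairwise_cons] at hr
    obtain ⟨ih1, ih2⟩ := ih hT.2 hr.2
    have hphi := filling_phi_cons i l T
    have hwt := tensorPhi_eq (vectorCrystal_regular n) i l
    have hnn := (fillingCrystal_regular (n := n)).phi_nonneg i T
    simp only [fillingMonomial_cons, map_add]
    rcases column_cases i hT.1 with ⟨h1, h2, h3⟩ | ⟨u, v, rfl, hv, h1, h2, hf, h3⟩ |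
      ⟨u, v, rfl, hv, h1, h2, h3⟩
    -- The leftmost column is invisible for i: f_i acts on T.
    · simp only [h3, zero_add]
      refine ⟨fun t => (ih1 t).trans (by omega), fun h4 => ?_⟩
      obtain ⟨r, h5, h6, T', h7, h8⟩ := ih2 (by omega)
      refine ⟨r, by omega, fun t ht => by have := h6 t ht; omega, l :: T', ?_, ?_⟩
      · rw [filling_f_cons, if_pos (by omega), h7]; rfl
      · rw [fillingMonomial_cons, h8]; abel
    -- The leftmost column has an unpaired i in row `v.length`. The sums of T vanish before that
    -- row, so a positive maximum of T is first attained no earlier, and adding 1 from this row on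
    -- preserves its place. If φ_i(T) = 0, the first maximum is at this row itself, where f_i acts.
    · obtain ⟨b1, b2, -⟩ := lowerHom_fillingMonomial_below i (r := v.length) (T := T)
        fun d hd => (rowsFromBottom_below (hr.1 d hd)).1 _ hv
      simp only [h3]
      refine ⟨fun t => ?_, fun _ => ?_⟩
      · have := ih1 t
        split_ifs <;> omega
      · by_cases h4 : 0 < (fillingCrystal n).phi i T
        · obtain ⟨r, h5, h6, T', h7, h8⟩ := ih2 h4
          have h9 : (v.length : ℤ) ≤ r := by
            by_contra h9
            have := b1 r (by omega)
            omega
          refine ⟨r, by rw [if_pos h9]; omega, fun t ht => ?_, (u ++ i.castSucc :: v) :: T', ?_, ?_⟩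
          · have := h6 t ht
            split_ifs <;> omega
          · rw [filling_f_cons, if_pos (by omega), h7]; rfl
          · rw [fillingMonomial_cons, h8]; abel
        · have h5 := ih1 v.length
          refine ⟨v.length, by rw [if_pos le_rfl]; omega, fun t ht => ?_, (u ++ i.succ :: v) :: T, ?_, ?_⟩
          · rw [if_neg (by omega), b1 t ht]; omega
          · rw [filling_f_cons, if_neg (by omega), hf]; rfl
          · rw [fillingMonomial_cons, columnMonomial_replace u v i.castSucc i.succ, A_eq]; abel
    -- The leftmost column has an unpaired i+1 in row `v.length`, which subtracts 1 from the next
    -- index on. Row comparison excludes i from this row of T, so the sums of T vanish up to and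
    -- including it, and the place of the first maximum is unchanged if the maximum stays positive.
    · obtain ⟨b1, -, b2⟩ := lowerHom_fillingMonomial_below i (r := v.length) (T := T)
        fun d hd => (rowsFromBottom_below (hr.1 d hd)).1 _ hv
      have b3 := b2 fun d hd y hy => by
        have h4 := (rowsFromBottom_below (hr.1 d hd)).2 y hy
        exact (Fin.castSucc_lt_succ.trans_le h4).ne'
      have b4 : ∀ t ≤ (v.length : ℤ), lowerHom i t (fillingMonomial T) = 0 := by
        intro t ht
        rcases ht.lt_or_eq with h | rfl
        exacts [b1 t h, b3]
      simp only [h3]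
      refine ⟨fun t => ?_, fun h4 => ?_⟩
      · have h5 := ih1 t
        have h6 := b4 t
        split_ifs <;> omega
      · obtain ⟨r, h5, h6, T', h7, h8⟩ := ih2 (by omega)
        have h9 : (v.length : ℤ) + 1 ≤ r := by
          by_contra h9
          have := b4 r (by omega)
          omega
        refine ⟨r, by rw [if_pos h9]; omega, fun t ht => ?_, (u ++ i.succ :: v) :: T', ?_, ?_⟩
        · have h10 := h6 t ht
          have h11 := b4 t
          split_ifs <;> omega
        · rw [filling_f_cons, if_pos (by omega), h7]; rfl
        · rw [fillingMonomial_cons, h8]; abel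

/-- The product telescopes: consecutive letters stand in consecutive rows, so Y_x(m) of one box
cancels Y_x(m)⁻¹ of the box below. -/
theorem columnMonomial_of_consecutive {l : List (Fin (n + 1))} {p : ℕ}
    (h : ∀ (k : ℕ) (hk : k < l.length), l[k].val = p + k) :
    columnMonomial l = -Ybd n p l.length + Ybd n (p + l.length) 0 := by
  induction l generalizing p with
  | nil => simp [columnMonomial]
  | cons x l ih =>
    have hx : x.val = p := h 0 (by simp)
    rw [columnMonomial, ih (p := p + 1) fun k hk => by
      have := h (k + 1) (by simpa using hk)
      rw [List.getElem_cons_succ] at this; omega, X, hx, List.length_cons, Nat.cast_add_one,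
      add_right_comm p 1, add_assoc p]
    abel

theorem columnMonomial_initialColumn {m : ℕ} (hm : m ≤ n + 1) :
    columnMonomial (initialColumn n m) = Ybd n m 0 := by
  rw [columnMonomial_of_consecutive (p := 0), length_initialColumn hm, Ybd, dif_neg (by omega)]
  · simp
  · intro k hk
    have := (getElem?_initialColumn (n := n)).1 (List.getElem?_eq_getElem hk)
    omega

theorem fillingMonomial_highest (a : Fin n → ℕ) :
    fillingMonomial ((reverseColLens a).map (initialColumn n)) = highestMonomial a := by
  rw [fillingMonomial, List.map_map, List.map_congr_left (f := columnMonomial ∘ initialColumn n)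
    (g := fun m => Ybd n m 0) fun m hm => columnMonomial_initialColumn
      ((mem_reverseColLens hm).2.trans (Nat.le_succ n)), reverseColLens, highestMonomial,
    Fin.sum_univ_def, List.map_flatMap, List.flatMap_def, List.sum_flatten,
    List.map_map]
  congr 1
  refine List.map_congr_left fun k _ => ?_
  rw [Function.comp_apply, List.map_replicate, List.sum_replicate, Ybd, dif_pos (by omega)]
  rfl

theorem fillingMonomial_phi (i : Fin n) {T : Filling n} (hT : ColumnStrict T)
    (hr : T.Pairwise RowsFromBottom) :
    monomialPhi i (fillingMonomial T) = (fillingCrystal n).phi i T := by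
  obtain ⟨h1, h2⟩ := fillingMonomial_f i hT hr
  have hnn := (fillingCrystal_regular (n := n)).phi_nonneg i T
  obtain ⟨t, ht⟩ : ∃ t, lowerHom i t (fillingMonomial T) = (fillingCrystal n).phi i T := by
    rcases hnn.lt_or_eq with h | h
    · obtain ⟨r, h3, -⟩ := h2 h
      exact ⟨r, h3⟩
    · obtain ⟨t, ht⟩ := exists_lowerSum_eq_zero i (fillingMonomial T)
      exact ⟨t, (ht t le_rfl).trans h⟩
  rw [← ht]
  exact monomialPhi_eq_of fun t' => (h1 t').trans ht.ge

/-- Starting from tableaux avoids any prior description of M(λ): only the source must have a unique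
highest weight element, and the component appears as the image. -/
theorem fillingMonomial_isCrystalIso (a : Fin n → ℕ) :
    IsCrystalIso (fillingCrystal n) (monomialCrystal n) (SSet a) (MSet a) fillingMonomial := by
  rw [MSet, ← fillingMonomial_highest]
  have hS : ∀ T ∈ SSet a, ColumnStrict T ∧ T.Pairwise RowsFromBottom := fun T hT => by
    rw [SSet_eq] at hT; exact hT.2
  refine (SSet_isGeneratedBy a).isCrystalIso fillingCrystal_regular monomialCrystal_invertible
    (fun T _ i => wtHom_fillingMonomial i T) (fun T hT i => ?_) (fun T hT i => ?_)
  · obtain ⟨h1, h2⟩ := hS T hT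
    have h3 := fillingCrystal_regular.phi_eq i T
    have h4 := wtHom_fillingMonomial i T
    change monomialEps i _ = _
    rw [monomialEps_eq, fillingMonomial_phi i h1 h2, ← wtHom_apply]
    omega
  · obtain ⟨h1, h2⟩ := hS T hT
    have hphi := fillingMonomial_phi i h1 h2
    have hnn := (fillingCrystal_regular (n := n)).phi_nonneg i T
    change (if monomialPhi i _ = 0 then none else some _) = _
    rw [hphi]
    split_ifs with h
    · rw [(fillingCrystal_regular.f_eq_none i T).2 h]; rfl
    · obtain ⟨r, h3, h4, T', h5, h6⟩ := (fillingMonomial_f i h1 h2).2 (by omega)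
      have hnf : nf i (fillingMonomial T) = r := by
        refine IsLeast.csInf_eq ⟨?_, ?_⟩
        · exact hphi.trans h3.symm
        · intro m hm
          by_contra h7
          have h8 := h4 m (not_le.1 h7)
          have h9 : monomialPhi i _ = lowerSum i _ m := hm
          rw [hphi, ← lowerHom_apply] at h9
          omega
      rw [h5, Option.map_some, h6, hnf]

end Boxes

/-! ### The map `ψ` -/

section Psi

variable {n : ℕ}

theorem XMonomial_add (m m' : Fin (n + 1) → Fin n → ℕ) :
    XMonomial (fun x j => m x j + m' x j) = XMonomial m + XMonomial m' := by
  simp [XMonomial, add_smul, Finset.sum_add_distrib]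

theorem XMonomial_single (x : Fin (n + 1)) (j : Fin n) :
    XMonomial (fun x' j' => if x' = x ∧ j' = j then 1 else 0) = X x (j.val : ℤ) := by
  rw [XMonomial, Finset.sum_eq_single x, Finset.sum_eq_single j]
  · simp
  · intro j' _ hj; simp [hj]
  · simp
  · intro x' _ hx; simp [hx]
  · simp

/-- The number of boxes with entry `x` in the `(j+1)`-st row from the bottom. -/
def rowMultiplicity (T : Filling n) (x : Fin (n + 1)) (j : Fin n) : ℕ :=
  T.countP fun l => l.reverse[j.val]? = some x

theorem columnMonomial_eq {l : List (Fin (n + 1))} (hl : l.length ≤ n) : columnMonomial l =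
    XMonomial fun x j => if l.reverse[j.val]? = some x then 1 else 0 := by
  induction l with
  | nil => simp [columnMonomial, XMonomial]
  | cons y l ih =>
    rw [List.length_cons] at hl
    have h := XMonomial_single y (⟨l.length, by omega⟩ : Fin n)
    rw [columnMonomial, ih (by omega), ← h, ← XMonomial_add]
    congr 1; funext x j
    rw [List.reverse_cons]
    rcases lt_trichotomy j.val l.length with h1 | h1 | h1
    · rw [List.getElem?_append_left (by simpa using h1)]
      simp [Fin.ext_iff, h1.ne]
    · rw [List.getElem?_append_right (by simp [h1]), List.getElem?_eq_none (l := l.reverse)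
        (by simp [h1])]
      simp [Fin.ext_iff, h1, eq_comm]
    · rw [List.getElem?_eq_none (by simp; omega), List.getElem?_eq_none (by simp; omega)]
      simp [Fin.ext_iff, h1.ne']

theorem fillingMonomial_eq {T : Filling n} (hT : ∀ l ∈ T, l.length ≤ n) :
    fillingMonomial T = XMonomial (rowMultiplicity T) := by
  induction T with
  | nil => simp [rowMultiplicity, XMonomial]
  | cons l T ih =>
    rw [List.forall_mem_cons] at hT
    rw [fillingMonomial_cons, columnMonomial_eq hT.1, ih hT.2, ← XMonomial_add]
    congr 1; funext x j
    simp [rowMultiplicity, List.countP_cons, add_comm]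

/-- The exponent of `X_x(k)`, extended by `0` to all `k ∈ ℤ`. -/
def extendRows (m : Fin (n + 1) → Fin n → ℕ) (x : Fin (n + 1)) (k : ℤ) : ℤ :=
  ∑ j : Fin n, if (j.val : ℤ) = k then (m x j : ℤ) else 0

theorem XMonomial_apply (m : Fin (n + 1) → Fin n → ℕ) (i : Fin n) (k : ℤ) :
    XMonomial m (i, k) = extendRows m i.castSucc k - extendRows m i.succ (k - 1) := by
  have h : ∀ x j, (m x j • X x (j.val : ℤ) : Monomial n) (i, k) =
      (if x = i.castSucc then (if (j.val : ℤ) = k then (m x j : ℤ) else 0) else 0) -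
      if x = i.succ then (if (j.val : ℤ) = k - 1 then (m x j : ℤ) else 0) else 0 := by
    intro x j
    rw [Finsupp.smul_apply, X_apply, nsmul_eq_mul]
    have : (j.val : ℤ) + 1 = k ↔ (j.val : ℤ) = k - 1 := by omega
    simp only [this, ite_and, mul_sub, mul_ite, mul_one, mul_zero]
  rw [XMonomial, Finsupp.finsetSum_apply]
  simp only [Finsupp.finsetSum_apply, h, Finset.sum_sub_distrib]
  congr 1
  · rw [Finset.sum_eq_single i.castSucc (fun x _ hx => by simp [hx]) (by simp)]
    simp [extendRows]
  · rw [Finset.sum_eq_single i.succ (fun x _ hx => by simp [hx]) (by simp)]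
    simp [extendRows]

theorem extendRows_apply (m : Fin (n + 1) → Fin n → ℕ) (x : Fin (n + 1)) (j : Fin n) :
    extendRows m x j.val = m x j := by
  rw [extendRows, Finset.sum_eq_single j]
  · simp
  · intro j' _ hj
    rw [if_neg]
    intro h
    exact hj (Fin.ext (by exact_mod_cast h))
  · simp

/-- Comparing exponents of Y_i(k) shows that the difference D of two exponent arrays is constant
along D_i(k) = D_{i+1}(k−1). Each such diagonal, followed through the n+1 letters, leaves the range
0 ≤ k ≤ n−1, where D vanishes. The bound on j is thus exactly what gives uniqueness. -/
theorem XMonomial_injective : Function.Injective (XMonomial (n := n)) := by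
  intro m m' h
  set D : Fin (n + 1) → ℤ → ℤ := fun x k => extendRows m x k - extendRows m' x k with hD
  have hstep : ∀ (i : Fin n) k, D i.castSucc k = D i.succ (k - 1) := by
    intro i k
    have := DFunLike.congr_fun h (i, k)
    rw [XMonomial_apply, XMonomial_apply] at this
    simp only [hD]
    omega
  have hout : ∀ x k, k < 0 ∨ (n : ℤ) ≤ k → D x k = 0 := by
    intro x k hk
    simp only [hD, extendRows]
    rw [Finset.sum_eq_zero fun j _ => if_neg (by omega),
      Finset.sum_eq_zero fun j _ => if_neg (by omega), sub_zero]
  have hzero : ∀ (x : Fin (n + 1)) k, D x k = D 0 (k + x.val) := by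
    intro x
    induction x using Fin.induction with
    | zero => simp
    | succ i ih =>
      intro k
      have h1 := hstep i (k + 1)
      rw [add_sub_cancel_right] at h1
      rw [← h1, ih (k + 1), Fin.val_castSucc, Fin.val_succ]
      congr 1; push_cast; ring
  have hD0 : ∀ k, D 0 k = 0 := by
    intro k
    rcases lt_or_ge k n with hk | hk
    · have h1 := hzero (Fin.last n) (k - n)
      rw [Fin.val_last, sub_add_cancel] at h1
      rw [← h1, hout _ _ (Or.inl (by omega))]
    · exact hout _ _ (Or.inr hk)
  funext x j
  have h1 := hzero x j.val
  rw [hD0] at h1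
  simp only [hD, extendRows_apply] at h1
  omega

/-- If the places where g is defined form an initial segment, discarding the others shifts no index.
-/
theorem getElem?_filterMap {α β : Type*} {g : α → Option β} {L : List α}
    (h : L.Pairwise fun a b => (g b).isSome → (g a).isSome) (k : ℕ) :
    (L.filterMap g)[k]? = L[k]?.bind g := by
  induction L generalizing k with
  | nil => simp
  | cons a L ih =>
    rw [List.pairwise_cons] at h
    rcases ha : g a with _ | b
    · have hL : ∀ b ∈ L, g b = none := fun b hb => by
        have := h.1 b hb
        rw [ha] at this
        simpa using this
      rw [List.filterMap_cons_none ha, List.filterMap_eq_nil_iff.2 hL]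
      symm
      rcases hk : (a :: L)[k]? with _ | b
      · simp
      · rcases List.mem_cons.1 (List.mem_of_getElem? hk) with rfl | hb
        · simp [ha]
        · simp [hL b hb]
    · rw [List.filterMap_cons_some ha]
      rcases k with _ | k
      · simp [ha]
      · simpa using ih h.2 k

theorem filterMap_finRange_getElem? {α : Type*} {l : List α} (hl : l.length ≤ n) :
    (List.finRange n).filterMap (fun j => l[j.val]?) = l := by
  refine List.ext_getElem? fun k => ?_
  rw [getElem?_filterMap]
  · rcases Nat.lt_or_ge k n with hk | hk
    · rw [List.getElem?_eq_getElem (by simpa using hk)]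
      simp
    · rw [List.getElem?_eq_none (by simpa using hk), List.getElem?_eq_none (by omega)]; rfl
  · refine (List.pairwise_lt_finRange n).imp fun {i j} hij => ?_
    rw [Fin.lt_def] at hij
    intro h
    simp at h ⊢
    omega

theorem rowFromRight_pairwise (m : Fin (n + 1) → ℕ) : (rowFromRight m).Pairwise (· ≥ ·) := by
  rw [rowFromRight, List.pairwise_flatMap]
  refine ⟨fun k _ => List.pairwise_replicate.2 (Or.inr le_rfl), ?_⟩
  refine (List.pairwise_reverse.2 (List.pairwise_lt_finRange _)).imp fun {k l} hkl x hx y hy => ?_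
  rw [List.eq_of_mem_replicate hx, List.eq_of_mem_replicate hy]
  exact hkl.le

theorem count_rowFromRight (m : Fin (n + 1) → ℕ) (x : Fin (n + 1)) :
    (rowFromRight m).count x = m x := by
  rw [rowFromRight, List.count_flatMap, List.map_reverse, List.sum_reverse, ← Fin.sum_univ_def,
    Finset.sum_eq_single x]
  · simp
  · intro y _ hy
    simp [List.count_replicate, hy]
  · simp

/-- The rows of a reverse tableau, read from right to left. -/
theorem rowFromRight_rowMultiplicity {T : Filling n} (hr : T.Pairwise RowsFromBottom) (j : Fin n) :
    (rowFromRight fun x => rowMultiplicity T x j) =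
      T.reverse.filterMap fun l => l.reverse[j.val]? := by
  -- Both lists are weakly decreasing with the same multiplicities, hence equal.
  refine List.Perm.eq_of_pairwise (le := (· ≥ ·)) (fun a b _ _ h h' => le_antisymm h' h)
    (rowFromRight_pairwise _) ?_ ?_
  · rw [List.pairwise_filterMap]
    exact (List.pairwise_reverse.2 hr).imp fun {l l'} h x hx y hy => h.2 j y x hy hx
  · rw [List.perm_iff_count]
    intro x
    rw [count_rowFromRight, rowMultiplicity, List.count, List.countP_filterMap, List.countP_reverse]
    congr 1; funext l
    rcases l.reverse[j.val]? with _ | y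
    · simp
    · by_cases h : y = x <;> simp [h]

/-- Columns weakly lengthen towards the right, so each row, read from the right, fills an initial
segment of the columns; the k-th entries of the rows therefore reassemble the k-th column. -/
theorem fillingOfRows_rowMultiplicity {T : Filling n} (hr : T.Pairwise RowsFromBottom)
    (hlen : ∀ l ∈ T, 1 ≤ l.length ∧ l.length ≤ n) : fillingOfRows (rowMultiplicity T) = T := by
  have hsup : (Finset.univ.sup fun j =>
      (rowFromRight fun x => rowMultiplicity T x j).length) = T.length := by
    refine le_antisymm (Finset.sup_le fun j _ => ?_) ?_
    · rw [rowFromRight_rowMultiplicity hr]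
      exact (List.length_filterMap_le _ _).trans (by simp)
    · rcases T with _ | ⟨l, T⟩
      · simp
      · have hn := hlen l (by simp)
        -- Every column is nonempty, so the bottom row meets all of them and attains the supremum.
        refine le_trans ?_ (Finset.le_sup (Finset.mem_univ (⟨0, by omega⟩ : Fin n)))
        rw [rowFromRight_rowMultiplicity hr, List.filterMap_length_eq_length.2]
        · simp
        · intro l' hl'
          have := hlen l' (List.mem_reverse.1 hl')
          simp; omega
  have hcol : ∀ (j : Fin n) (k : ℕ), (rowFromRight fun x => rowMultiplicity T x j)[k]? =
      T.reverse[k]?.bind fun l => l.reverse[j.val]? := by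
    intro j k
    rw [rowFromRight_rowMultiplicity hr, getElem?_filterMap]
    refine (List.pairwise_reverse.2 hr).imp fun {l l'} h hl => ?_
    have h1 := h.1
    simp at hl ⊢
    omega
  rw [fillingOfRows, hsup]
  simp only [hcol]
  rw [List.map_reverse, List.reverse_eq_iff]
  refine List.ext_getElem (by simp) fun k hk hk' => ?_
  rw [List.getElem_map, List.getElem_range, List.getElem?_eq_getElem hk']
  simp only [Option.bind_some]
  have hmem := List.mem_reverse.1 (List.getElem_mem hk')
  rw [List.filterMap_reverse, filterMap_finRange_getElem? (by simpa using (hlen _ hmem).2),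
    List.reverse_reverse]

theorem length_of_mem_SSet {a : Fin n → ℕ} {T : Filling n} (hT : T ∈ SSet a) :
    ∀ l ∈ T, 1 ≤ l.length ∧ l.length ≤ n := by
  intro l hl
  have := List.mem_map_of_mem (f := List.length) hl
  rw [hT.1] at this
  exact mem_reverseColLens this

theorem fillingMonomial_eq_of_mem {a : Fin n → ℕ} {T : Filling n} (hT : T ∈ SSet a) :
    fillingMonomial T = XMonomial (rowMultiplicity T) :=
  fillingMonomial_eq fun l hl => (length_of_mem_SSet hT l hl).2

/-- Uniqueness of the exponents forces the chosen array to be the row multiplicities of T. -/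
theorem psi_fillingMonomial {a : Fin n → ℕ} {T : Filling n} (hT : T ∈ SSet a) :
    psi (fillingMonomial T) = T := by
  have hex : ∃ m : Fin (n + 1) → Fin n → ℕ, fillingMonomial T = XMonomial m :=
    ⟨_, fillingMonomial_eq_of_mem hT⟩
  have h : hex.choose = rowMultiplicity T :=
    XMonomial_injective (hex.choose_spec.symm.trans (fillingMonomial_eq_of_mem hT))
  rw [psi, dif_pos hex, h]
  refine fillingOfRows_rowMultiplicity ?_ (length_of_mem_SSet hT)
  rw [SSet_eq] at hT
  exact hT.2.2

end Psi
end TypeACrystal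

/-! ### Assembly of the isomorphisms. -/

theorem corollary4p6 (n : ℕ) (a : Fin n → ℕ) :
    (∀ M ∈ TypeACrystal.MSet a,
      ∃! m : Fin (n + 1) → Fin n → ℕ, M = TypeACrystal.XMonomial m) ∧
    TypeACrystal.IsCrystalIso (TypeACrystal.monomialCrystal n) (TypeACrystal.fillingCrystal n)
      (TypeACrystal.MSet a) (TypeACrystal.SSet a) TypeACrystal.psi ∧
    TypeACrystal.IsCrystalIso (TypeACrystal.fillingCrystal n) (TypeACrystal.fillingCrystal n)
      (TypeACrystal.SSet a) (TypeACrystal.TSet a) TypeACrystal.columnInsertion ∧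
    TypeACrystal.IsCrystalIso (TypeACrystal.monomialCrystal n) (TypeACrystal.fillingCrystal n)
      (TypeACrystal.MSet a) (TypeACrystal.TSet a)
      (TypeACrystal.columnInsertion ∘ TypeACrystal.psi) := by
  open TypeACrystal in
  have hΦ := fillingMonomial_isCrystalIso a
  have hψ := hΦ.symm_of_leftInverse fun T hT => psi_fillingMonomial hT
  have hφ := columnInsertion_isCrystalIso a
  rw [← TSet_eq] at hφ
  refine ⟨fun M hM => ?_, hψ, hφ, hφ.comp hψ⟩
  obtain ⟨T, hT, rfl⟩ := hΦ.bijOn.surjOn hM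
  exact ⟨_, fillingMonomial_eq_of_mem hT, fun m hm =>
    XMonomial_injective (hm.symm.trans (fillingMonomial_eq_of_mem hT))⟩
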